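/- Let $k$ be an algebraically closed field of characteristic $0$, let $A$ be a finitely generated abelian group, $\Gamma\subseteq A$ a finite subgroup and $\pi\colon A\to A/\Gamma$ the quotient map. Let $R=k[x_1,\dots,x_n]$ be a polynomial algebra with a $k$-algebra grading $R=\bigoplus_{c\in A}R_c$, let $a\in A$ and let $w\in R_a$ be homogeneous of degree $a$. The algebra $R$ is also $A/\Gamma$-graded, by $R_b=\bigoplus_{\pi(c)=b}R_c$, and then $w$ is homogeneous of degree $\pi(a)$. For $B\in\{A,A/\Gamma\}$ and a $B$-graded $R$-module $M$ let $M(d)$ denote the twist, $M(d)_c=M_{c+d}$. Write $d_w$ for the degree of $w$ in $B$ (so $d_w=a$, respectively $\pi(a)$). A factorization of $w$ consists of finitely generated $B$-graded $R$-modules $E_{-1},E_0$ and degree-preserving $R$-linear maps $\phi_0\colon E_{-1}\to E_0$ and $\phi_{-1}\colon E_0\to E_{-1}(d_w)$ such that both composites are multiplication by $w$. Let $\mathrm{D}^{\mathrm{abs}}[\mathsf{fact}(R,B,w)]$ be their absolute derived category: the Verdier quotient of the triangulated homotopy category of factorizations (morphisms are homotopy classes of pairs of degree-preserving $R$-linear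 maps that commute with the structure maps) by the thick subcategory generated by the totalizations of short exact sequences of factorizations. It is a $k$-linear triangulated category. The group $\Gamma$ acts on $\mathrm{D}^{\mathrm{abs}}[\mathsf{fact}(R,A,w)]$ by the twists $E\mapsto E(\gamma)$. Let $$\mathrm{R}\colon \mathrm{D}^{\mathrm{abs}}[\mathsf{fact}(R,A,w)]\to \mathrm{D}^{\mathrm{abs}}[\mathsf{fact}(R,A/\Gamma,w)]$$ be the restriction functor, induced by regrading each module as $M_b=\bigoplus_{\pi(c)=b}M_c$ for $b\in A/\Gamma$. Put $\mathcal T=\mathrm{D}^{\mathrm{abs}}[\mathsf{fact}(R,A,w)]$. The orbit category $\mathcal T/\Gamma$ has the same objects as $\mathcal T$ and morphisms $\mathrm{Hom}_{\mathcal T/\Gamma}(E,F)=\bigoplus_{\gamma\in\Gamma}\mathrm{Hom}_{\mathcal T}(E,F(\gamma))$; the composite of $f\colon E\to F(\gamma)$ and $f'\colon F\to G(\gamma')$ is $f'(\gamma)\circ f\colon E\to G(\gamma+\gamma')$. Then $\mathrm{R}$ is a $\Gamma$-cover. That is, $\Gamma$ is a finitely generated abelian group acting on $\mathcal T$ by exact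 autoequivalences; $\mathrm{R}$ is exact; there is a $k$-linear fully faithful functor $\mathcal T/\Gamma\to\mathrm{D}^{\mathrm{abs}}[\mathsf{fact}(R,A/\Gamma,w)]$ whose composite with the natural functor $\mathcal T\to\mathcal T/\Gamma$ is isomorphic to $\mathrm{R}$; and every object of $\mathrm{D}^{\mathrm{abs}}[\mathsf{fact}(R,A/\Gamma,w)]$ is a direct summand of $\mathrm{R}(E)$ for some object $E$ of $\mathcal T$. -/

import Mathlib

universe uk uR uA uB x

namespace GradedFact

open CategoryTheory Limits

section Modules

variable {k : Type uk} [CommRing k] {R : Type uR} [CommRing R] [Algebra k R]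
  {A : Type uA} [AddCommGroup A]

/-- Finitely generated `A`-graded modules over `R = ⨁ c, 𝓐 c`. -/
structure GrMod (𝓐 : A → Submodule k R) where
  carrier : Type x
  [addCommGroup : AddCommGroup carrier]
  [moduleR : Module R carrier]
  [modulek : Module k carrier]
  [tower : IsScalarTower k R carrier]
  /-- the homogeneous component of degree `c` -/
  gr : A → Submodule k carrier
  indep : iSupIndep gr
  iSup_gr : ⨆ c, gr c = ⊤
  smul_mem : ∀ {i j : A} {r : R} {m : carrier}, r ∈ 𝓐 i → m ∈ gr j → r • m ∈ gr (i + j)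
  finite : Module.Finite R carrier

namespace GrMod

variable {𝓐 : A → Submodule k R}

instance : CoeSort (GrMod.{uk, uR, uA, x} 𝓐) (Type x) := ⟨carrier⟩

attribute [instance] addCommGroup moduleR modulek tower finite

/-- A linear map is homogeneous of degree zero. -/
def IsHomog (M N : GrMod.{uk, uR, uA, x} 𝓐) (f : M →ₗ[R] N) : Prop :=
  ∀ (c : A) (m : M), m ∈ M.gr c → f m ∈ N.gr c

/-- The twist `M(a)`, with `M(a)_c = M_{c + a}`. -/
abbrev tw (M : GrMod.{uk, uR, uA, x} 𝓐) (a : A) : GrMod.{uk, uR, uA, x} 𝓐 where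
  carrier := M
  gr c := M.gr (c + a)
  indep := M.indep.comp (add_left_injective a)
  iSup_gr := by
    rw [← M.iSup_gr]
    exact (Equiv.addRight a).surjective.iSup_comp (g := M.gr)
  smul_mem {i j r m} hr hm := by
    rw [add_assoc]
    exact M.smul_mem hr hm
  finite := M.finite

lemma tw_zero (M : GrMod.{uk, uR, uA, x} 𝓐) : M.tw 0 = M := by
  cases M
  simp [tw]

lemma tw_tw (M : GrMod.{uk, uR, uA, x} 𝓐) (a b : A) : (M.tw a).tw b = M.tw (a + b) := by
  cases M
  simp only [tw, mk.injEq, heq_eq_eq, true_and]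
  funext c
  congr 1
  abel

/-- The direct sum of two graded modules. -/
abbrev prod (M N : GrMod.{uk, uR, uA, x} 𝓐) : GrMod.{uk, uR, uA, x} 𝓐 where
  carrier := M × N
  gr c := (M.gr c).prod (N.gr c)
  indep := by
    have hM := (iSupIndep_iff_finsetSum_eq_zero_imp_eq_zero _).1 M.indep
    have hN := (iSupIndep_iff_finsetSum_eq_zero_imp_eq_zero _).1 N.indep
    rw [iSupIndep_iff_finsetSum_eq_zero_imp_eq_zero]
    intro s v hv h i hi
    have h₁ := congrArg Prod.fst h
    have h₂ := congrArg Prod.snd h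
    rw [Prod.fst_sum] at h₁
    rw [Prod.snd_sum] at h₂
    exact Prod.ext (hM s (fun j => (v j).1) (fun j hj => (hv j hj).1) h₁ i hi)
      (hN s (fun j => (v j).2) (fun j hj => (hv j hj).2) h₂ i hi)
  iSup_gr := by
    rw [eq_top_iff]
    rintro ⟨m, n⟩ -
    have h₁ : Submodule.map (LinearMap.inl k M N) (⨆ c, M.gr c) ≤
        ⨆ c, (M.gr c).prod (N.gr c) := by
      rw [Submodule.map_iSup]
      refine iSup_mono fun c => ?_
      rintro _ ⟨y, hy, rfl⟩
      exact ⟨hy, zero_mem _⟩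
    have h₂ : Submodule.map (LinearMap.inr k M N) (⨆ c, N.gr c) ≤
        ⨆ c, (M.gr c).prod (N.gr c) := by
      rw [Submodule.map_iSup]
      refine iSup_mono fun c => ?_
      rintro _ ⟨y, hy, rfl⟩
      exact ⟨zero_mem _, hy⟩
    have e : ((m, n) : M × N) = LinearMap.inl k M N m + LinearMap.inr k M N n := by simp
    rw [e]
    exact add_mem (h₁ ⟨m, by simp [M.iSup_gr], rfl⟩) (h₂ ⟨n, by simp [N.iSup_gr], rfl⟩)
  smul_mem hr hm := ⟨M.smul_mem hr hm.1, N.smul_mem hr hm.2⟩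
  finite := inferInstance

/-- The zero module. -/
abbrev zero : GrMod.{uk, uR, uA, x} 𝓐 where
  carrier := PUnit
  gr _ := ⊥
  indep := by
    intro i
    simp
  iSup_gr := Subsingleton.elim _ _
  smul_mem _ _ := Subsingleton.elim _ _
  finite := inferInstance

end GrMod

end Modules

section Factorizations

variable {k : Type uk} [CommRing k] {R : Type uR} [CommRing R] [Algebra k R]
  {A : Type uA} [AddCommGroup A]

open GrMod

/-- Factorizations `(X₋₁, X₀, φ₋₁, φ₀)` of `W` with finitely generated graded components, where
`φ₀ : X₋₁ → X₀` and `φ₋₁ : X₀ → X₋₁(a)` are homogeneous of degree zero and both composites are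
multiplication by `W`. The fields `X₁` and `φ₁` stand for `X₋₁` and `φ₋₁`. -/
structure Fac (𝓐 : A → Submodule k R) (a : A) (W : R) where
  X₁ : GrMod.{uk, uR, uA, x} 𝓐
  X₀ : GrMod.{uk, uR, uA, x} 𝓐
  φ₀ : X₁ →ₗ[R] X₀
  φ₁ : X₀ →ₗ[R] X₁
  homog₀ : IsHomog X₁ X₀ φ₀
  homog₁ : IsHomog X₀ (X₁.tw a) φ₁
  φ₁_φ₀ : ∀ m, φ₁ (φ₀ m) = W • m
  φ₀_φ₁ : ∀ m, φ₀ (φ₁ m) = W • m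

namespace Fac

variable {𝓐 : A → Submodule k R} {a : A} {W : R}

/-- Closed morphisms of degree zero: pairs `(f₋₁, f₀)` of homogeneous linear maps that commute
with the structure maps. -/
def closedMaps (E F : Fac.{uk, uR, uA, x} 𝓐 a W) :
    Submodule k ((E.X₁ →ₗ[R] F.X₁) × (E.X₀ →ₗ[R] F.X₀)) where
  carrier := {f | IsHomog E.X₁ F.X₁ f.1 ∧ IsHomog E.X₀ F.X₀ f.2 ∧
    (∀ m, f.2 (E.φ₀ m) = F.φ₀ (f.1 m)) ∧ (∀ m, f.1 (E.φ₁ m) = F.φ₁ (f.2 m))}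
  add_mem' {f g} hf hg :=
    ⟨fun c m hm => add_mem (hf.1 c m hm) (hg.1 c m hm),
      fun c m hm => add_mem (hf.2.1 c m hm) (hg.2.1 c m hm),
      fun m => by simp [hf.2.2.1 m, hg.2.2.1 m], fun m => by simp [hf.2.2.2 m, hg.2.2.2 m]⟩
  zero_mem' := ⟨fun c m _ => zero_mem _, fun c m _ => zero_mem _,
    fun m => by simp, fun m => by simp⟩
  smul_mem' r f hf :=
    ⟨fun c m hm => (F.X₁.gr c).smul_mem r (hf.1 c m hm),
      fun c m hm => (F.X₀.gr c).smul_mem r (hf.2.1 c m hm),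
      fun m => by
        have := hf.2.2.1 m
        simp only [Prod.smul_fst, Prod.smul_snd, LinearMap.smul_apply, this]
        rw [← algebraMap_smul R r (f.1 m), map_smul, algebraMap_smul],
      fun m => by
        have := hf.2.2.2 m
        simp only [Prod.smul_fst, Prod.smul_snd, LinearMap.smul_apply, this]
        rw [← algebraMap_smul R r (f.2 m), map_smul, algebraMap_smul]⟩

end Fac
end Factorizations

section Category

variable {k : Type uk} [CommRing k] {R : Type uR} [CommRing R] [Algebra k R]
  {A : Type uA} [AddCommGroup A] {𝓐 : A → Submodule k R} {a : A} {W : R}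

open GrMod

namespace Fac

/-- The category of factorizations and closed morphisms of degree zero. -/
instance : Category (Fac.{uk, uR, uA, x} 𝓐 a W) where
  Hom E F := closedMaps E F
  id E := ⟨(LinearMap.id, LinearMap.id),
    fun _ _ hm => hm, fun _ _ hm => hm, fun _ => rfl, fun _ => rfl⟩
  comp f g := ⟨(g.1.1 ∘ₗ f.1.1, g.1.2 ∘ₗ f.1.2),
    fun c m hm => g.2.1 c _ (f.2.1 c m hm), fun c m hm => g.2.2.1 c _ (f.2.2.1 c m hm),
    fun m => (congrArg g.1.2 (f.2.2.2.1 m)).trans (g.2.2.2.1 _),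
    fun m => (congrArg g.1.1 (f.2.2.2.2 m)).trans (g.2.2.2.2 _)⟩

variable {E F G : Fac.{uk, uR, uA, x} 𝓐 a W}

/-- The component of a morphism in degree `-1`. -/
def f₁ (f : E ⟶ F) : E.X₁ →ₗ[R] F.X₁ := f.1.1

/-- The component of a morphism in degree `0`. -/
def f₀ (f : E ⟶ F) : E.X₀ →ₗ[R] F.X₀ := f.1.2

lemma f₁_mem (f : E ⟶ F) {c : A} {m : E.X₁} (hm : m ∈ E.X₁.gr c) : f₁ f m ∈ F.X₁.gr c :=
  f.2.1 c m hm

lemma f₀_mem (f : E ⟶ F) {c : A} {m : E.X₀} (hm : m ∈ E.X₀.gr c) : f₀ f m ∈ F.X₀.gr c :=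
  f.2.2.1 c m hm

lemma f₀_φ₀ (f : E ⟶ F) (m : E.X₁) : f₀ f (E.φ₀ m) = F.φ₀ (f₁ f m) := f.2.2.2.1 m

lemma f₁_φ₁ (f : E ⟶ F) (m : E.X₀) : f₁ f (E.φ₁ m) = F.φ₁ (f₀ f m) := f.2.2.2.2 m

/-- Constructor for morphisms of factorizations. -/
def homMk (g₁ : E.X₁ →ₗ[R] F.X₁) (g₀ : E.X₀ →ₗ[R] F.X₀) (h₁ : IsHomog E.X₁ F.X₁ g₁)
    (h₀ : IsHomog E.X₀ F.X₀ g₀) (c₀ : ∀ m, g₀ (E.φ₀ m) = F.φ₀ (g₁ m))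
    (c₁ : ∀ m, g₁ (E.φ₁ m) = F.φ₁ (g₀ m)) : E ⟶ F :=
  ⟨(g₁, g₀), h₁, h₀, c₀, c₁⟩

@[simp] lemma homMk_f₁ (g₁ : E.X₁ →ₗ[R] F.X₁) (g₀ : E.X₀ →ₗ[R] F.X₀) (h₁ h₀ c₀ c₁) :
    f₁ (homMk (E := E) (F := F) g₁ g₀ h₁ h₀ c₀ c₁) = g₁ := rfl

@[simp] lemma homMk_f₀ (g₁ : E.X₁ →ₗ[R] F.X₁) (g₀ : E.X₀ →ₗ[R] F.X₀) (h₁ h₀ c₀ c₁) :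
    f₀ (homMk (E := E) (F := F) g₁ g₀ h₁ h₀ c₀ c₁) = g₀ := rfl

lemma hom_ext {f g : E ⟶ F} (h₁ : ∀ m, f₁ f m = f₁ g m) (h₀ : ∀ m, f₀ f m = f₀ g m) : f = g :=
  Subtype.ext (Prod.ext (LinearMap.ext h₁) (LinearMap.ext h₀))

@[simp] lemma id_f₁ (m : E.X₁) : f₁ (𝟙 E) m = m := rfl
@[simp] lemma id_f₀ (m : E.X₀) : f₀ (𝟙 E) m = m := rfl
@[simp] lemma comp_f₁ (f : E ⟶ F) (g : F ⟶ G) (m : E.X₁) : f₁ (f ≫ g) m = f₁ g (f₁ f m) := rfl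
@[simp] lemma comp_f₀ (f : E ⟶ F) (g : F ⟶ G) (m : E.X₀) : f₀ (f ≫ g) m = f₀ g (f₀ f m) := rfl

instance : Preadditive (Fac.{uk, uR, uA, x} 𝓐 a W) where
  homGroup E F := inferInstanceAs (AddCommGroup (closedMaps E F))
  add_comp _ _ _ f f' g := hom_ext (fun m => map_add (f₁ g) (f₁ f m) (f₁ f' m))
    (fun m => map_add (f₀ g) (f₀ f m) (f₀ f' m))
  comp_add _ _ _ _ _ _ := rfl

@[simp] lemma add_f₁ (f g : E ⟶ F) (m : E.X₁) : f₁ (f + g) m = f₁ f m + f₁ g m := rfl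
@[simp] lemma add_f₀ (f g : E ⟶ F) (m : E.X₀) : f₀ (f + g) m = f₀ f m + f₀ g m := rfl
@[simp] lemma sub_f₁ (f g : E ⟶ F) (m : E.X₁) : f₁ (f - g) m = f₁ f m - f₁ g m := rfl
@[simp] lemma sub_f₀ (f g : E ⟶ F) (m : E.X₀) : f₀ (f - g) m = f₀ f m - f₀ g m := rfl
@[simp] lemma neg_f₁ (f : E ⟶ F) (m : E.X₁) : f₁ (-f) m = -f₁ f m := rfl
@[simp] lemma neg_f₀ (f : E ⟶ F) (m : E.X₀) : f₀ (-f) m = -f₀ f m := rfl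
@[simp] lemma zero_f₁ (m : E.X₁) : f₁ (0 : E ⟶ F) m = 0 := rfl
@[simp] lemma zero_f₀ (m : E.X₀) : f₀ (0 : E ⟶ F) m = 0 := rfl

instance : Linear k (Fac.{uk, uR, uA, x} 𝓐 a W) where
  homModule E F := inferInstanceAs (Module k (closedMaps E F))
  smul_comp _ _ _ r f g := hom_ext (fun m => (f₁ g).map_smul_of_tower r (f₁ f m))
    (fun m => (f₀ g).map_smul_of_tower r (f₀ f m))
  comp_smul _ _ _ _ _ _ := rfl

@[simp] lemma smul_f₁ (r : k) (f : E ⟶ F) (m : E.X₁) : f₁ (r • f) m = r • f₁ f m := rfl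
@[simp] lemma smul_f₀ (r : k) (f : E ⟶ F) (m : E.X₀) : f₀ (r • f) m = r • f₀ f m := rfl

/-- The zero factorization. -/
abbrev zero : Fac.{uk, uR, uA, x} 𝓐 a W where
  X₁ := GrMod.zero
  X₀ := GrMod.zero
  φ₀ := 0
  φ₁ := 0
  homog₀ _ _ _ := Subsingleton.elim _ _
  homog₁ _ _ _ := Subsingleton.elim _ _
  φ₁_φ₀ _ := Subsingleton.elim _ _
  φ₀_φ₁ _ := Subsingleton.elim _ _

instance : HasZeroObject (Fac.{uk, uR, uA, x} 𝓐 a W) :=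
  ⟨zero, (IsZero.iff_id_eq_zero zero).2
    (hom_ext (fun _ => Subsingleton.elim _ _) (fun _ => Subsingleton.elim _ _))⟩

/-- The translation `E[1] = (E₀, E₋₁(a), -φ₋₁, -φ₀)`. -/
abbrev translate (E : Fac.{uk, uR, uA, x} 𝓐 a W) : Fac.{uk, uR, uA, x} 𝓐 a W where
  X₁ := E.X₀
  X₀ := E.X₁.tw a
  φ₀ := -E.φ₁
  φ₁ := -E.φ₀
  homog₀ c m hm := neg_mem (E.homog₁ c m hm)
  homog₁ c m hm := neg_mem (E.homog₀ _ m hm)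
  φ₁_φ₀ m := by
    change -E.φ₀ (-E.φ₁ m) = _
    rw [map_neg, neg_neg, E.φ₀_φ₁]
  φ₀_φ₁ m := by
    change -E.φ₁ (-E.φ₀ m) = _
    rw [map_neg, neg_neg, E.φ₁_φ₀]

/-- The inverse translation `E[-1] = (E₀(-a), E₋₁, -φ₋₁, -φ₀)`. -/
abbrev untranslate (E : Fac.{uk, uR, uA, x} 𝓐 a W) : Fac.{uk, uR, uA, x} 𝓐 a W where
  X₁ := E.X₀.tw (-a)
  X₀ := E.X₁
  φ₀ := -E.φ₁
  φ₁ := -E.φ₀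
  homog₀ c m hm := by
    have := neg_mem (E.homog₁ _ m hm)
    change _ ∈ E.X₁.gr (c + -a + a) at this
    rwa [neg_add_cancel_right] at this
  homog₁ c m hm := by
    have := neg_mem (E.homog₀ _ m hm)
    change _ ∈ E.X₀.gr (c + a + -a)
    rwa [add_neg_cancel_right]
  φ₁_φ₀ m := by
    change -E.φ₀ (-E.φ₁ m) = _
    rw [map_neg, neg_neg, E.φ₀_φ₁]
  φ₀_φ₁ m := by
    change -E.φ₁ (-E.φ₀ m) = _
    rw [map_neg, neg_neg, E.φ₁_φ₀]

variable (𝓐 a W) in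
/-- The translation functor `[1]`. -/
abbrev T : Fac.{uk, uR, uA, x} 𝓐 a W ⥤ Fac.{uk, uR, uA, x} 𝓐 a W where
  obj E := E.translate
  map {E F} f := homMk (E := E.translate) (F := F.translate) (f₀ f) (f₁ f)
    (fun _ _ hm => f₀_mem f hm) (fun _ _ hm => f₁_mem f hm)
    (fun m => by
      change f₁ f (-E.φ₁ m) = -F.φ₁ (f₀ f m)
      rw [map_neg, f₁_φ₁])
    (fun m => by
      change f₀ f (-E.φ₀ m) = -F.φ₀ (f₁ f m)
      rw [map_neg, f₀_φ₀])

variable (𝓐 a W) in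
/-- The inverse translation functor `[-1]`. -/
abbrev T' : Fac.{uk, uR, uA, x} 𝓐 a W ⥤ Fac.{uk, uR, uA, x} 𝓐 a W where
  obj E := E.untranslate
  map {E F} f := homMk (E := E.untranslate) (F := F.untranslate) (f₀ f) (f₁ f)
    (fun _ _ hm => f₀_mem f hm) (fun _ _ hm => f₁_mem f hm)
    (fun m => by
      change f₁ f (-E.φ₁ m) = -F.φ₁ (f₀ f m)
      rw [map_neg, f₁_φ₁])
    (fun m => by
      change f₀ f (-E.φ₀ m) = -F.φ₀ (f₁ f m)
      rw [map_neg, f₀_φ₀])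

lemma hom_heq {E E' F F' : Fac.{uk, uR, uA, x} 𝓐 a W} (hE : E = E') (hF : F = F')
    {f : E ⟶ F} {f' : E' ⟶ F'} (h₁ : HEq (f₁ f) (f₁ f')) (h₀ : HEq (f₀ f) (f₀ f')) : HEq f f' := by
  subst hE hF
  exact heq_of_eq (Subtype.ext (Prod.ext (eq_of_heq h₁) (eq_of_heq h₀)))

/-- Factorizations with the same underlying modules and maps are equal. -/
lemma ext_tw (E : Fac.{uk, uR, uA, x} 𝓐 a W) (X₁ X₀ : GrMod.{uk, uR, uA, x} 𝓐) (h₁ : E.X₁ = X₁)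
    (h₀ : E.X₀ = X₀) (φ₀ : X₁ →ₗ[R] X₀) (φ₁ : X₀ →ₗ[R] X₁) (hφ₀ : HEq E.φ₀ φ₀)
    (hφ₁ : HEq E.φ₁ φ₁) (g₀ g₁ g₂ g₃) : E = ⟨X₁, X₀, φ₀, φ₁, g₀, g₁, g₂, g₃⟩ := by
  subst h₁ h₀
  obtain rfl := eq_of_heq hφ₀
  obtain rfl := eq_of_heq hφ₁
  rfl

lemma untranslate_translate (E : Fac.{uk, uR, uA, x} 𝓐 a W) : E.translate.untranslate = E := by
  refine ext_tw _ _ _ ?_ rfl _ _ ?_ ?_ _ _ _ _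
  · exact (tw_tw _ _ _).trans (by rw [add_neg_cancel, tw_zero])
  · exact heq_of_eq (neg_neg _)
  · exact heq_of_eq (neg_neg _)

lemma translate_untranslate (E : Fac.{uk, uR, uA, x} 𝓐 a W) : E.untranslate.translate = E := by
  refine ext_tw _ _ _ rfl ?_ _ _ ?_ ?_ _ _ _ _
  · exact (tw_tw _ _ _).trans (by rw [neg_add_cancel, tw_zero])
  · exact heq_of_eq (neg_neg _)
  · exact heq_of_eq (neg_neg _)

lemma T_T' : T.{uk, uR, uA, x} 𝓐 a W ⋙ T' 𝓐 a W = 𝟭 _ :=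
  Functor.hext (fun E => untranslate_translate E) (fun E F _ =>
    hom_heq (untranslate_translate E) (untranslate_translate F) HEq.rfl HEq.rfl)

lemma T'_T : T'.{uk, uR, uA, x} 𝓐 a W ⋙ T 𝓐 a W = 𝟭 _ :=
  Functor.hext (fun E => translate_untranslate E) (fun E F _ =>
    hom_heq (translate_untranslate E) (translate_untranslate F) HEq.rfl HEq.rfl)

end Fac

end Category

section Iterate

variable {C : Type*} [Category* C] (S S' : C ⥤ C)

/-- The `n`-th iterate of a functor. -/
def natIter : ℕ → (C ⥤ C)
  | 0 => 𝟭 C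
  | n + 1 => natIter n ⋙ S

/-- The `n`-th iterate, for integral `n`, of a functor `S` with strict inverse `S'`. -/
def intIter : ℤ → (C ⥤ C)
  | Int.ofNat n => natIter S n
  | Int.negSucc n => natIter S' (n + 1)

lemma natIter_succ' (n : ℕ) : natIter S (n + 1) = S ⋙ natIter S n := by
  induction n with
  | zero => rfl
  | succ n ih =>
    change natIter S (n + 1) ⋙ S = S ⋙ (natIter S n ⋙ S)
    rw [ih]
    rfl

variable {S S'}

lemma intIter_zero : intIter S S' 0 = 𝟭 C := rfl

lemma intIter_add_one (h : S' ⋙ S = 𝟭 C) (n : ℤ) :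
    intIter S S' (n + 1) = intIter S S' n ⋙ S := by
  match n with
  | Int.ofNat n => rfl
  | Int.negSucc 0 =>
    change 𝟭 C = (𝟭 C ⋙ S') ⋙ S
    exact h.symm
  | Int.negSucc (n + 1) =>
    change natIter S' (n + 1) = natIter S' (n + 1) ⋙ S' ⋙ S
    rw [h]
    rfl

lemma intIter_sub_one (h : S ⋙ S' = 𝟭 C) (h' : S' ⋙ S = 𝟭 C) (n : ℤ) :
    intIter S S' (n - 1) = intIter S S' n ⋙ S' := by
  have := intIter_add_one h' (n - 1)
  rw [sub_add_cancel] at this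
  rw [this]
  change _ = _ ⋙ (S ⋙ S')
  rw [h]
  rfl

lemma intIter_add (h : S ⋙ S' = 𝟭 C) (h' : S' ⋙ S = 𝟭 C) (n m : ℤ) :
    intIter S S' (n + m) = intIter S S' n ⋙ intIter S S' m := by
  induction m with
  | zero =>
    rw [add_zero]
    rfl
  | succ m ih => rw [← add_assoc, intIter_add_one h', intIter_add_one h', ih]; rfl
  | pred m ih =>
    rw [← add_sub_assoc, intIter_sub_one h h', intIter_sub_one h h', ih]; rfl

lemma intIter_induction {P : (C ⥤ C) → Prop} (h₀ : P (𝟭 C)) (h : ∀ F, P F → P (F ⋙ S))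
    (h' : ∀ F, P F → P (F ⋙ S')) (n : ℤ) : P (intIter S S' n) := by
  have h₁ (n : ℕ) : P (natIter S n) := by
    induction n with
    | zero => exact h₀
    | succ n ih => exact h _ ih
  have h₂ (n : ℕ) : P (natIter S' n) := by
    induction n with
    | zero => exact h₀
    | succ n ih => exact h' _ ih
  match n with
  | Int.ofNat n => exact h₁ n
  | Int.negSucc n => exact h₂ (n + 1)

/-- The shift by `ℤ` generated by a functor with a strict inverse. -/
abbrev hasShiftOfStrict (h : S ⋙ S' = 𝟭 C) (h' : S' ⋙ S = 𝟭 C) : HasShift C ℤ :=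
  hasShiftMk C ℤ
    { F := intIter S S'
      zero := eqToIso intIter_zero
      add := fun n m => eqToIso (intIter_add h h' n m)
      assoc_hom_app := fun _ _ _ _ => by
        simp [eqToHom_app, eqToHom_map]
      zero_add_hom_app := fun _ _ => by
        rw [eqToIso.hom, eqToIso.inv, eqToHom_app, eqToHom_app, eqToHom_map, eqToHom_trans]
      add_zero_hom_app := fun _ _ => by
        rw [eqToIso.hom, eqToIso.inv, eqToHom_app, eqToHom_app, eqToHom_trans] }

end Iterate

section Homotopy

variable {k : Type uk} [CommRing k] {R : Type uR} [CommRing R] [Algebra k R]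
  {A : Type uA} [AddCommGroup A] {𝓐 : A → Submodule k R} {a : A} {W : R}

open GrMod

namespace Fac

instance : HasShift (Fac.{uk, uR, uA, x} 𝓐 a W) ℤ := hasShiftOfStrict T_T' T'_T

lemma shiftFunctor_eq (n : ℤ) :
    shiftFunctor (Fac.{uk, uR, uA, x} 𝓐 a W) n = intIter (T 𝓐 a W) (T' 𝓐 a W) n := rfl

instance (n : ℤ) : (shiftFunctor (Fac.{uk, uR, uA, x} 𝓐 a W) n).Linear k := by
  rw [shiftFunctor_eq]
  refine intIter_induction (P := fun F => F.Linear k) inferInstance ?_ ?_ n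
  · intro F hF
    have : (T.{uk, uR, uA, x} 𝓐 a W).Linear k := ⟨fun f r => rfl⟩
    infer_instance
  · intro F hF
    have : (T'.{uk, uR, uA, x} 𝓐 a W).Linear k := ⟨fun f r => rfl⟩
    infer_instance

instance (n : ℤ) : (shiftFunctor (Fac.{uk, uR, uA, x} 𝓐 a W) n).Additive := by
  rw [shiftFunctor_eq]
  refine intIter_induction (P := fun F => F.Additive) inferInstance ?_ ?_ n
  · intro F hF
    have : (T.{uk, uR, uA, x} 𝓐 a W).Additive := ⟨rfl⟩
    infer_instance
  · intro F hF
    have : (T'.{uk, uR, uA, x} 𝓐 a W).Additive := ⟨rfl⟩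
    infer_instance

/-- A null-homotopy of `f : E ⟶ F`: a pair of homogeneous maps `h₋₁ : E₋₁ → F₀(-a)` and
`h₀ : E₀ → F₋₁` whose differential is `f`. -/
structure NullHomotopy {E F : Fac.{uk, uR, uA, x} 𝓐 a W} (f : E ⟶ F) where
  h₁ : E.X₁ →ₗ[R] F.X₀
  h₀ : E.X₀ →ₗ[R] F.X₁
  homog₁ : IsHomog E.X₁ (F.X₀.tw (-a)) h₁
  homog₀ : IsHomog E.X₀ F.X₁ h₀
  eq₁ : ∀ m, f₁ f m = h₀ (E.φ₀ m) + F.φ₁ (h₁ m)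
  eq₀ : ∀ m, f₀ f m = h₁ (E.φ₁ m) + F.φ₀ (h₀ m)

variable (𝓐 a W) in
/-- Two morphisms are homotopic if their difference is null-homotopic. -/
def homRel : HomRel (Fac.{uk, uR, uA, x} 𝓐 a W) := fun _ _ f g => Nonempty (NullHomotopy (f - g))

namespace NullHomotopy

variable {E F G : Fac.{uk, uR, uA, x} 𝓐 a W}

/-- Null-homotopies can be added. -/
def add {f g : E ⟶ F} (h : NullHomotopy f) (h' : NullHomotopy g) : NullHomotopy (f + g) where
  h₁ := h.h₁ + h'.h₁
  h₀ := h.h₀ + h'.h₀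
  homog₁ c m hm := add_mem (h.homog₁ c m hm) (h'.homog₁ c m hm)
  homog₀ c m hm := add_mem (h.homog₀ c m hm) (h'.homog₀ c m hm)
  eq₁ m := by
    simp only [add_f₁, h.eq₁, h'.eq₁, LinearMap.add_apply, map_add]
    abel
  eq₀ m := by
    simp only [add_f₀, h.eq₀, h'.eq₀, LinearMap.add_apply, map_add]
    abel

/-- Null-homotopies can be multiplied by scalars. -/
def smul {f : E ⟶ F} (h : NullHomotopy f) (r : k) : NullHomotopy (r • f) where
  h₁ := r • h.h₁
  h₀ := r • h.h₀
  homog₁ c m hm := Submodule.smul_mem _ r (h.homog₁ c m hm)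
  homog₀ c m hm := Submodule.smul_mem _ r (h.homog₀ c m hm)
  eq₁ m := by
    simp only [smul_f₁, h.eq₁, LinearMap.smul_apply, LinearMap.map_smul_of_tower, smul_add]
  eq₀ m := by
    simp only [smul_f₀, h.eq₀, LinearMap.smul_apply, LinearMap.map_smul_of_tower, smul_add]

/-- The null-homotopy of the zero morphism. -/
def zero : NullHomotopy (0 : E ⟶ F) where
  h₁ := 0
  h₀ := 0
  homog₁ _ _ _ := zero_mem _
  homog₀ _ _ _ := zero_mem _
  eq₁ m := by simp
  eq₀ m := by simp

/-- Postcomposition of a null-homotopy with a morphism. -/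
def compRight {f : E ⟶ F} (h : NullHomotopy f) (g : F ⟶ G) : NullHomotopy (f ≫ g) where
  h₁ := f₀ g ∘ₗ h.h₁
  h₀ := f₁ g ∘ₗ h.h₀
  homog₁ c m hm := f₀_mem g (h.homog₁ c m hm)
  homog₀ c m hm := f₁_mem g (h.homog₀ c m hm)
  eq₁ m := by simp only [comp_f₁, h.eq₁, LinearMap.comp_apply, map_add, f₁_φ₁]
  eq₀ m := by simp only [comp_f₀, h.eq₀, LinearMap.comp_apply, map_add, f₀_φ₀]

/-- Precomposition of a null-homotopy with a morphism. -/
def compLeft {g : F ⟶ G} (h : NullHomotopy g) (f : E ⟶ F) : NullHomotopy (f ≫ g) where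
  h₁ := h.h₁ ∘ₗ f₁ f
  h₀ := h.h₀ ∘ₗ f₀ f
  homog₁ c m hm := h.homog₁ c _ (f₁_mem f hm)
  homog₀ c m hm := h.homog₀ c _ (f₀_mem f hm)
  eq₁ m := by simp only [comp_f₁, h.eq₁, LinearMap.comp_apply, f₀_φ₀]
  eq₀ m := by simp only [comp_f₀, h.eq₀, LinearMap.comp_apply, f₁_φ₁]

/-- The negative of a null-homotopy. -/
def neg {f : E ⟶ F} (h : NullHomotopy f) : NullHomotopy (-f) where
  h₁ := -h.h₁
  h₀ := -h.h₀
  homog₁ c m hm := neg_mem (h.homog₁ c m hm)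
  homog₀ c m hm := neg_mem (h.homog₀ c m hm)
  eq₁ m := by
    simp only [neg_f₁, h.eq₁, LinearMap.neg_apply, map_neg]
    abel
  eq₀ m := by
    simp only [neg_f₀, h.eq₀, LinearMap.neg_apply, map_neg]
    abel

/-- The translation of a null-homotopy. -/
def translate {f : E ⟶ F} (h : NullHomotopy f) : NullHomotopy ((T 𝓐 a W).map f) where
  h₁ := -h.h₀
  h₀ := -h.h₁
  homog₁ c m hm := by
    change _ ∈ F.X₁.gr (c + -a + a)
    rw [neg_add_cancel_right]
    exact neg_mem (h.homog₀ c m hm)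
  homog₀ c m hm := by
    have := neg_mem (h.homog₁ _ m hm)
    change _ ∈ F.X₀.gr (c + a + -a) at this
    rwa [add_neg_cancel_right] at this
  eq₁ m := by
    change f₀ f m = -h.h₁ (-E.φ₁ m) + -F.φ₀ (-h.h₀ m)
    rw [h.eq₀, map_neg, map_neg, neg_neg, neg_neg]
  eq₀ m := by
    change f₁ f m = -h.h₀ (-E.φ₀ m) + -F.φ₁ (-h.h₁ m)
    rw [h.eq₁, map_neg, map_neg, neg_neg, neg_neg]

/-- The inverse translation of a null-homotopy. -/
def untranslate {f : E ⟶ F} (h : NullHomotopy f) : NullHomotopy ((T' 𝓐 a W).map f) where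
  h₁ := -h.h₀
  h₀ := -h.h₁
  homog₁ c m hm := neg_mem (h.homog₀ _ m hm)
  homog₀ c m hm := neg_mem (h.homog₁ c m hm)
  eq₁ m := by
    change f₀ f m = -h.h₁ (-E.φ₁ m) + -F.φ₀ (-h.h₀ m)
    rw [h.eq₀, map_neg, map_neg, neg_neg, neg_neg]
  eq₀ m := by
    change f₁ f m = -h.h₀ (-E.φ₀ m) + -F.φ₁ (-h.h₁ m)
    rw [h.eq₁, map_neg, map_neg, neg_neg, neg_neg]

end NullHomotopy

instance : Congruence (homRel.{uk, uR, uA, x} 𝓐 a W) where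
  equivalence :=
    { refl := fun f => ⟨by rw [sub_self]; exact .zero⟩
      symm := fun ⟨h⟩ => ⟨by rw [← neg_sub]; exact h.neg⟩
      trans := fun {f g l} ⟨h⟩ ⟨h'⟩ => ⟨by rw [← sub_add_sub_cancel f g l]; exact h.add h'⟩ }
  comp_left := fun _ _ _ ⟨h⟩ => ⟨by rw [← Preadditive.comp_sub]; exact h.compLeft _⟩
  comp_right := fun _ ⟨h⟩ => ⟨by rw [← Preadditive.sub_comp]; exact h.compRight _⟩

instance : (homRel.{uk, uR, uA, x} 𝓐 a W).IsCompatibleWithShift ℤ where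
  condition n := by
    rw [shiftFunctor_eq]
    refine intIter_induction (P := fun S => ∀ ⦃X Y : Fac.{uk, uR, uA, x} 𝓐 a W⦄ (f g : X ⟶ Y),
      homRel 𝓐 a W f g → homRel 𝓐 a W (S.map f) (S.map g)) ?_ ?_ ?_ n
    · intro X Y f g h
      exact h
    · intro S hS X Y f g h
      obtain ⟨h'⟩ := hS f g h
      exact ⟨h'.translate⟩
    · intro S hS X Y f g h
      obtain ⟨h'⟩ := hS f g h
      exact ⟨h'.untranslate⟩

end Fac

open Fac

variable (𝓐 a W) in
/-- The homotopy category of factorizations. -/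
abbrev HoFac := CategoryTheory.Quotient (homRel.{uk, uR, uA, x} 𝓐 a W)

namespace HoFac

variable (𝓐 a W) in
/-- The functor from factorizations to the homotopy category. -/
abbrev quot : Fac.{uk, uR, uA, x} 𝓐 a W ⥤ HoFac.{uk, uR, uA, x} 𝓐 a W :=
  CategoryTheory.Quotient.functor (homRel 𝓐 a W)

instance : Preadditive (HoFac.{uk, uR, uA, x} 𝓐 a W) :=
  CategoryTheory.Quotient.preadditive _ (by
    rintro _ _ _ _ _ _ ⟨h⟩ ⟨h'⟩
    exact ⟨by rw [add_sub_add_comm]; exact h.add h'⟩)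

instance : (quot.{uk, uR, uA, x} 𝓐 a W).Additive where

instance : Linear k (HoFac.{uk, uR, uA, x} 𝓐 a W) :=
  CategoryTheory.Quotient.linear k (homRel 𝓐 a W)
    (fun r _ _ _ _ ⟨h⟩ => ⟨by rw [← smul_sub]; exact h.smul r⟩)

instance : (quot.{uk, uR, uA, x} 𝓐 a W).Linear k :=
  CategoryTheory.Quotient.linear_functor _ (homRel 𝓐 a W) _

instance : HasZeroObject (HoFac.{uk, uR, uA, x} 𝓐 a W) :=
  ⟨(quot 𝓐 a W).obj Fac.zero, by
    rw [IsZero.iff_id_eq_zero, ← (quot 𝓐 a W).map_id]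
    have : 𝟙 (Fac.zero : Fac.{uk, uR, uA, x} 𝓐 a W) = 0 :=
      hom_ext (fun _ => Subsingleton.elim _ _) (fun _ => Subsingleton.elim _ _)
    rw [this, Functor.map_zero]⟩

section

variable {G : Type*} [AddMonoid G] [HasShift (Fac.{uk, uR, uA, x} 𝓐 a W) G]
  [(homRel.{uk, uR, uA, x} 𝓐 a W).IsCompatibleWithShift G]

instance [∀ n : G, (shiftFunctor (Fac.{uk, uR, uA, x} 𝓐 a W) n).Additive] (n : G) :
    (shiftFunctor (HoFac.{uk, uR, uA, x} 𝓐 a W) n).Additive := by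
  have : (quot.{uk, uR, uA, x} 𝓐 a W ⋙ shiftFunctor _ n).Additive :=
    Functor.additive_of_iso ((quot 𝓐 a W).commShiftIso n)
  exact Functor.additive_of_full_essSurj_comp (quot 𝓐 a W) _

instance [∀ n : G, (shiftFunctor (Fac.{uk, uR, uA, x} 𝓐 a W) n).Linear k] (n : G) :
    (shiftFunctor (HoFac.{uk, uR, uA, x} 𝓐 a W) n).Linear k where
  map_smul := by
    rintro ⟨X⟩ ⟨Y⟩ f r
    obtain ⟨f, rfl⟩ := (quot 𝓐 a W).map_surjective f
    have h₁ := NatIso.naturality_1 ((quot 𝓐 a W).commShiftIso n) f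
    have h₂ := NatIso.naturality_1 ((quot 𝓐 a W).commShiftIso n) (r • f)
    dsimp at h₁ h₂
    rw [← Functor.map_smul, ← h₁, ← h₂]
    simp only [Functor.map_smul, Linear.smul_comp, Linear.comp_smul]

end

lemma eq_of_nullHomotopy {E F : Fac.{uk, uR, uA, x} 𝓐 a W} {f g : E ⟶ F}
    (h : NullHomotopy (f - g)) : (quot 𝓐 a W).map f = (quot 𝓐 a W).map g :=
  CategoryTheory.Quotient.sound _ ⟨h⟩

lemma exists_nullHomotopy {E F : Fac.{uk, uR, uA, x} 𝓐 a W} {f g : E ⟶ F}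
    (h : (quot 𝓐 a W).map f = (quot 𝓐 a W).map g) : Nonempty (NullHomotopy (f - g)) :=
  (CategoryTheory.Quotient.functor_map_eq_iff _ _ _).1 h

end HoFac

end Homotopy

section Cone

variable {k : Type uk} [CommRing k] {R : Type uR} [CommRing R] [Algebra k R]
  {A : Type uA} [AddCommGroup A] {𝓐 : A → Submodule k R} {a : A} {W : R}

open GrMod Pretriangulated

namespace Fac

variable {E F G : Fac.{uk, uR, uA, x} 𝓐 a W}

/-- The cone of `f : E ⟶ F`: the factorization with components `F₋₁ ⊕ E₀` and `F₀ ⊕ E₋₁(a)`,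
which is the totalization of the complex `E ⟶ F`. -/
abbrev cone (f : E ⟶ F) : Fac.{uk, uR, uA, x} 𝓐 a W where
  X₁ := F.X₁.prod E.X₀
  X₀ := F.X₀.prod (E.X₁.tw a)
  φ₀ := (F.φ₀.coprod (f₀ f)).prod (-(E.φ₁ ∘ₗ LinearMap.snd R F.X₁ E.X₀))
  φ₁ := (F.φ₁.coprod (f₁ f)).prod (-(E.φ₀ ∘ₗ LinearMap.snd R F.X₀ E.X₁))
  homog₀ c m hm := ⟨add_mem (F.homog₀ c _ hm.1) (f₀_mem f hm.2), neg_mem (E.homog₁ c _ hm.2)⟩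
  homog₁ c m hm := ⟨add_mem (F.homog₁ c _ hm.1) (f₁_mem f hm.2), neg_mem (E.homog₀ _ _ hm.2)⟩
  φ₁_φ₀ := fun ⟨y, z⟩ => by
    ext
    · simp [F.φ₁_φ₀, f₁_φ₁]
    · simp [E.φ₀_φ₁]
  φ₀_φ₁ := fun ⟨y, z⟩ => by
    ext
    · simp [F.φ₀_φ₁, f₀_φ₀]
    · simp [E.φ₁_φ₀]

lemma cone_φ₀ (f : E ⟶ F) (m : F.X₁ × E.X₀) :
    (cone f).φ₀ m = (F.φ₀ m.1 + f₀ f m.2, -E.φ₁ m.2) := rfl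

lemma cone_φ₁ (f : E ⟶ F) (m : F.X₀ × E.X₁) :
    (cone f).φ₁ m = (F.φ₁ m.1 + f₁ f m.2, -E.φ₀ m.2) := rfl

/-- The inclusion of the target in the cone. -/
def coneIn (f : E ⟶ F) : F ⟶ cone f :=
  homMk (F := cone f) (LinearMap.inl R F.X₁ E.X₀) (LinearMap.inl R F.X₀ E.X₁)
    (fun _ _ hm => ⟨hm, zero_mem _⟩) (fun _ _ hm => ⟨hm, zero_mem _⟩)
    (fun m => by ext <;> simp) (fun m => by ext <;> simp)

@[simp] lemma coneIn_f₁ (f : E ⟶ F) (m : F.X₁) : f₁ (coneIn f) m = (m, (0 : E.X₀)) := rfl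
@[simp] lemma coneIn_f₀ (f : E ⟶ F) (m : F.X₀) : f₀ (coneIn f) m = (m, (0 : E.X₁)) := rfl

/-- The projection of the cone to the translate of the source. -/
def coneOut (f : E ⟶ F) : cone f ⟶ E⟦(1 : ℤ)⟧ :=
  homMk (E := cone f) (F := E.translate) (LinearMap.snd R F.X₁ E.X₀) (LinearMap.snd R F.X₀ E.X₁)
    (fun _ _ hm => hm.2) (fun _ _ hm => hm.2) (fun _ => rfl) (fun _ => rfl)

@[simp] lemma coneOut_f₁ (f : E ⟶ F) (m : F.X₁ × E.X₀) :
    f₁ (E := cone f) (F := E.translate) (coneOut f) m = m.2 := rfl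
@[simp] lemma coneOut_f₀ (f : E ⟶ F) (m : F.X₀ × E.X₁) :
    f₀ (E := cone f) (F := E.translate) (coneOut f) m = m.2 := rfl

/-- Equal morphisms are homotopic. -/
def NullHomotopy.ofEq {f g : E ⟶ F} (h : f = g) : NullHomotopy (f - g) where
  h₁ := 0
  h₀ := 0
  homog₁ _ _ _ := zero_mem _
  homog₀ _ _ _ := zero_mem _
  eq₁ m := by simp [h]
  eq₀ m := by simp [h]

/-- The morphism from a cone given by a morphism `g` and a null-homotopy of `f ≫ g`. -/
def coneDesc (f : E ⟶ F) (g : F ⟶ G) (h : NullHomotopy (f ≫ g)) : cone f ⟶ G :=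
  homMk (E := cone f) ((f₁ g).coprod h.h₀) ((f₀ g).coprod h.h₁)
    (fun c m hm => add_mem (f₁_mem g hm.1) (h.homog₀ c _ hm.2))
    (fun c m hm => add_mem (f₀_mem g hm.1) (by
      have := h.homog₁ _ _ hm.2
      change _ ∈ G.X₀.gr (c + a + -a) at this
      rwa [add_neg_cancel_right] at this))
    (fun ⟨y, z⟩ => by
      have := h.eq₀ z
      rw [comp_f₀] at this
      simp [f₀_φ₀, this]
      abel)
    (fun ⟨y, z⟩ => by
      have := h.eq₁ z
      rw [comp_f₁] at this
      simp [f₁_φ₁, this]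
      abel)

/-- The map of cones given by a square that commutes up to homotopy. -/
def coneMap {E' F' : Fac.{uk, uR, uA, x} 𝓐 a W} (f : E ⟶ F) (f' : E' ⟶ F') (u : E ⟶ E')
    (v : F ⟶ F') (h : NullHomotopy (f ≫ v - u ≫ f')) : cone f ⟶ cone f' :=
  homMk (E := cone f) (F := cone f')
    (((f₁ v).coprod h.h₀).prod (f₀ u ∘ₗ LinearMap.snd R F.X₁ E.X₀))
    (((f₀ v).coprod h.h₁).prod (f₁ u ∘ₗ LinearMap.snd R F.X₀ E.X₁))
    (fun c m hm => ⟨add_mem (f₁_mem v hm.1) (h.homog₀ c _ hm.2), f₀_mem u hm.2⟩)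
    (fun c m hm => ⟨add_mem (f₀_mem v hm.1) (by
      have := h.homog₁ _ _ hm.2
      change _ ∈ F'.X₀.gr (c + a + -a) at this
      rwa [add_neg_cancel_right] at this), f₁_mem u hm.2⟩)
    (fun ⟨y, z⟩ => by
      have := h.eq₀ z
      rw [sub_f₀, comp_f₀, comp_f₀, sub_eq_iff_eq_add] at this
      ext
      · simp [f₀_φ₀, this]
        abel
      · simp [f₁_φ₁])
    (fun ⟨y, z⟩ => by
      have := h.eq₁ z
      rw [sub_f₁, comp_f₁, comp_f₁, sub_eq_iff_eq_add] at this
      ext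
      · simp [f₁_φ₁, this]
        abel
      · simp [f₀_φ₀])

lemma coneMap_f₁ {E' F' : Fac.{uk, uR, uA, x} 𝓐 a W} (f : E ⟶ F) (f' : E' ⟶ F') (u : E ⟶ E')
    (v : F ⟶ F') (h) (m : F.X₁ × E.X₀) :
    f₁ (coneMap f f' u v h) m = (f₁ v m.1 + h.h₀ m.2, f₀ u m.2) := rfl

lemma coneMap_f₀ {E' F' : Fac.{uk, uR, uA, x} 𝓐 a W} (f : E ⟶ F) (f' : E' ⟶ F') (u : E ⟶ E')
    (v : F ⟶ F') (h) (m : F.X₀ × E.X₁) :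
    f₀ (coneMap f f' u v h) m = (f₀ v m.1 + h.h₁ m.2, f₁ u m.2) := rfl

/-- The standard triangle `E ⟶ F ⟶ cone f ⟶ E[1]`. -/
abbrev triangle (f : E ⟶ F) : Triangle (Fac.{uk, uR, uA, x} 𝓐 a W) :=
  Triangle.mk f (coneIn f) (coneOut f)

/-- The cone of an identity is contractible. -/
def nullHomotopyConeId (E : Fac.{uk, uR, uA, x} 𝓐 a W) : NullHomotopy (𝟙 (cone (𝟙 E))) where
  h₁ := LinearMap.inr R E.X₀ E.X₁ ∘ₗ LinearMap.fst R E.X₁ E.X₀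
  h₀ := LinearMap.inr R E.X₁ E.X₀ ∘ₗ LinearMap.fst R E.X₀ E.X₁
  homog₁ c m hm := by
    refine ⟨zero_mem _, ?_⟩
    change _ ∈ E.X₁.gr (c + -a + a)
    rw [neg_add_cancel_right]
    exact hm.1
  homog₀ c m hm := ⟨zero_mem _, hm.1⟩
  eq₁ := fun ⟨y, z⟩ => by
    change (y, z) = _
    ext
    · simp
    · change z = E.φ₀ y + f₀ (𝟙 E) z + -E.φ₀ y
      simp
  eq₀ := fun ⟨y, z⟩ => by
    change (y, z) = _
    ext
    · simp
    · change z = E.φ₁ y + f₁ (𝟙 E) z + -E.φ₁ y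
      simp

/-- The comparison map from `E[1]` to the cone of `F ⟶ cone f`. -/
def rotateMap (f : E ⟶ F) : E⟦(1 : ℤ)⟧ ⟶ cone (coneIn f) :=
  homMk (E := E.translate) (F := cone (coneIn f))
    ((LinearMap.inr R F.X₁ E.X₀).prod (-(f₀ f))) ((LinearMap.inr R F.X₀ E.X₁).prod (-(f₁ f)))
    (fun _ _ hm => ⟨⟨zero_mem _, hm⟩, neg_mem (f₀_mem f hm)⟩)
    (fun _ _ hm => ⟨⟨zero_mem _, hm⟩, neg_mem (f₁_mem f hm)⟩)
    (fun m => by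
      change (((0 : F.X₀), -E.φ₁ m), -f₁ f (-E.φ₁ m)) =
        ((F.φ₀ 0 + f₀ f m + -f₀ f m, -E.φ₁ m + 0), -F.φ₁ (-f₀ f m))
      simp [f₁_φ₁])
    (fun m => by
      change (((0 : F.X₁), -E.φ₀ m), -f₀ f (-E.φ₀ m)) =
        ((F.φ₁ 0 + f₁ f m + -f₁ f m, -E.φ₀ m + 0), -F.φ₀ (-f₁ f m))
      simp [f₀_φ₀])

/-- The homotopy inverse of `rotateMap`. -/
def rotateInv (f : E ⟶ F) : cone (coneIn f) ⟶ E⟦(1 : ℤ)⟧ :=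
  homMk (E := cone (coneIn f)) (F := E.translate)
    (LinearMap.snd R F.X₁ E.X₀ ∘ₗ LinearMap.fst R (F.X₁ × E.X₀) F.X₀)
    (LinearMap.snd R F.X₀ E.X₁ ∘ₗ LinearMap.fst R (F.X₀ × E.X₁) F.X₁)
    (fun _ _ hm => hm.1.2) (fun _ _ hm => hm.1.2)
    (fun ⟨⟨_, z⟩, _⟩ => add_zero (-E.φ₁ z))
    (fun ⟨⟨_, z⟩, _⟩ => add_zero (-E.φ₀ z))

lemma rotateMap_rotateInv (f : E ⟶ F) : rotateMap f ≫ rotateInv f = 𝟙 _ := rfl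

/-- The homotopy that makes `rotateInv` a homotopy inverse of `rotateMap`. -/
def rotateHomotopy (f : E ⟶ F) : NullHomotopy (rotateInv f ≫ rotateMap f - 𝟙 _) where
  h₁ := LinearMap.inr R (F.X₀ × E.X₁) F.X₁ ∘ₗ (-(LinearMap.fst R F.X₁ E.X₀ ∘ₗ
    LinearMap.fst R (F.X₁ × E.X₀) F.X₀))
  h₀ := LinearMap.inr R (F.X₁ × E.X₀) F.X₀ ∘ₗ (-(LinearMap.fst R F.X₀ E.X₁ ∘ₗ
    LinearMap.fst R (F.X₀ × E.X₁) F.X₁))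
  homog₁ c m hm := by
    refine ⟨zero_mem _, neg_mem (?_ : _ ∈ F.X₁.gr (c + -a + a))⟩
    rw [neg_add_cancel_right]
    exact hm.1.1
  homog₀ c m hm := ⟨zero_mem _, neg_mem hm.1.1⟩
  eq₁ := fun ⟨⟨y, z⟩, t⟩ => by
    change (((0 : F.X₁), z), -f₀ f z) - ((y, z), t) =
      (((0 : F.X₁), (0 : E.X₀)), -(F.φ₀ y + f₀ f z + t)) +
        ((F.φ₁ 0 + f₁ f 0 + -y, -E.φ₀ 0 + 0), -F.φ₀ (-y))
    ext
    · simp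
    · simp
    · simp only [Prod.snd_sub, Prod.snd_add, map_neg]
      abel
  eq₀ := fun ⟨⟨y, z⟩, t⟩ => by
    change (((0 : F.X₀), z), -f₁ f z) - ((y, z), t) =
      (((0 : F.X₀), (0 : E.X₁)), -(F.φ₁ y + f₁ f z + t)) +
        ((F.φ₀ 0 + f₀ f 0 + -y, -E.φ₁ 0 + 0), -F.φ₁ (-y))
    ext
    · simp
    · simp
    · simp only [Prod.snd_sub, Prod.snd_add, map_neg]
      abel

lemma coneIn_rotateInv (f : E ⟶ F) : coneIn (coneIn f) ≫ rotateInv f = coneOut f := rfl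

lemma rotateMap_coneOut (f : E ⟶ F) : rotateMap f ≫ coneOut (coneIn f) = -f⟦(1 : ℤ)⟧' := rfl

section Octahedron

variable (f : E ⟶ F) (g : F ⟶ G)

/-- The map `cone f ⟶ cone (f ≫ g)`. -/
abbrev octaMap₁ : cone f ⟶ cone (f ≫ g) :=
  coneMap f (f ≫ g) (𝟙 E) g (.ofEq (Category.id_comp _).symm)

/-- The map `cone (f ≫ g) ⟶ cone g`. -/
abbrev octaMap₃ : cone (f ≫ g) ⟶ cone g :=
  coneMap (f ≫ g) g f (𝟙 G) (.ofEq (Category.comp_id _))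

/-- The comparison map from `cone g` to the cone of `octaMap₁`. -/
def octaHom : cone g ⟶ cone (octaMap₁ f g) :=
  homMk (E := cone g) (F := cone (octaMap₁ f g))
    (((LinearMap.inl R G.X₁ E.X₀).prodMap (LinearMap.inl R F.X₀ E.X₁)))
    (((LinearMap.inl R G.X₀ E.X₁).prodMap (LinearMap.inl R F.X₁ E.X₀)))
    (fun _ _ hm => ⟨⟨hm.1, zero_mem _⟩, ⟨hm.2, zero_mem _⟩⟩)
    (fun _ _ hm => ⟨⟨hm.1, zero_mem _⟩, ⟨hm.2, zero_mem _⟩⟩)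
    (fun ⟨y, z⟩ => by
      change ((G.φ₀ y + f₀ g z, (0 : E.X₁)), (-F.φ₁ z, (0 : E.X₀))) =
        ((G.φ₀ y + f₀ (f ≫ g) 0 + (f₀ g z + 0), -E.φ₁ 0 + 0), (-(F.φ₁ z + f₁ f 0), - -E.φ₀ 0))
      simp)
    (fun ⟨y, z⟩ => by
      change ((G.φ₁ y + f₁ g z, (0 : E.X₀)), (-F.φ₀ z, (0 : E.X₁))) =
        ((G.φ₁ y + f₁ (f ≫ g) 0 + (f₁ g z + 0), -E.φ₀ 0 + 0), (-(F.φ₀ z + f₀ f 0), - -E.φ₁ 0))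
      simp)

/-- The homotopy inverse of `octaHom`. -/
def octaInv : cone (octaMap₁ f g) ⟶ cone g :=
  homMk (E := cone (octaMap₁ f g)) (F := cone g)
    (((LinearMap.fst R G.X₁ E.X₀).prodMap (LinearMap.fst R F.X₀ E.X₁)) +
      (LinearMap.inr R G.X₁ F.X₀ ∘ₗ f₀ f ∘ₗ LinearMap.snd R G.X₁ E.X₀ ∘ₗ
        LinearMap.fst R (G.X₁ × E.X₀) (F.X₀ × E.X₁)))
    (((LinearMap.fst R G.X₀ E.X₁).prodMap (LinearMap.fst R F.X₁ E.X₀)) +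
      (LinearMap.inr R G.X₀ F.X₁ ∘ₗ f₁ f ∘ₗ LinearMap.snd R G.X₀ E.X₁ ∘ₗ
        LinearMap.fst R (G.X₀ × E.X₁) (F.X₁ × E.X₀)))
    (fun _ _ hm => ⟨add_mem hm.1.1 (zero_mem _), add_mem hm.2.1 (f₀_mem f hm.1.2)⟩)
    (fun _ _ hm => ⟨add_mem hm.1.1 (zero_mem _), add_mem hm.2.1 (f₁_mem f hm.1.2)⟩)
    (fun ⟨⟨y, z⟩, ⟨s, t⟩⟩ => by
      change (G.φ₀ y + f₀ g (f₀ f z) + (f₀ g s + 0) + 0, -(F.φ₁ s + f₁ f t) + f₁ f (-E.φ₁ z + t)) =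
        (G.φ₀ (y + 0) + f₀ g (s + f₀ f z), -F.φ₁ (s + f₀ f z))
      ext
      · simp only [add_zero, map_add]
        abel
      · simp only [map_add, map_neg, f₁_φ₁]
        abel)
    (fun ⟨⟨y, z⟩, ⟨s, t⟩⟩ => by
      change (G.φ₁ y + f₁ g (f₁ f z) + (f₁ g s + 0) + 0, -(F.φ₀ s + f₀ f t) + f₀ f (-E.φ₀ z + t)) =
        (G.φ₁ (y + 0) + f₁ g (s + f₁ f z), -F.φ₀ (s + f₁ f z))
      ext
      · simp only [add_zero, map_add]
        abel
      · simp only [map_add, map_neg, f₀_φ₀]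
        abel)

lemma octaHom_octaInv : octaHom f g ≫ octaInv f g = 𝟙 _ :=
  hom_ext (fun ⟨y, z⟩ => by
    change (y + 0, z + f₀ f 0) = (y, z)
    simp) (fun ⟨y, z⟩ => by
    change (y + 0, z + f₁ f 0) = (y, z)
    simp)

lemma coneIn_octaInv : coneIn (octaMap₁ f g) ≫ octaInv f g = octaMap₃ f g :=
  hom_ext (fun ⟨y, z⟩ => by
    change (y + 0, 0 + f₀ f z) = (y + 0, f₀ f z)
    simp) (fun ⟨y, z⟩ => by
    change (y + 0, 0 + f₁ f z) = (y + 0, f₁ f z)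
    simp)

lemma octaHom_coneOut : octaHom f g ≫ coneOut (octaMap₁ f g) = coneOut g ≫ (coneIn f)⟦(1 : ℤ)⟧' :=
  rfl

/-- The homotopy that makes `octaInv` a homotopy inverse of `octaHom`. -/
def octaHomotopy : NullHomotopy (octaInv f g ≫ octaHom f g - 𝟙 _) where
  h₁ := LinearMap.inr R (G.X₀ × E.X₁) (F.X₁ × E.X₀) ∘ₗ LinearMap.inr R F.X₁ E.X₀ ∘ₗ
    (-(LinearMap.snd R G.X₁ E.X₀ ∘ₗ LinearMap.fst R (G.X₁ × E.X₀) (F.X₀ × E.X₁)))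
  h₀ := LinearMap.inr R (G.X₁ × E.X₀) (F.X₀ × E.X₁) ∘ₗ LinearMap.inr R F.X₀ E.X₁ ∘ₗ
    (-(LinearMap.snd R G.X₀ E.X₁ ∘ₗ LinearMap.fst R (G.X₀ × E.X₁) (F.X₁ × E.X₀)))
  homog₁ c m hm := by
    refine ⟨zero_mem _, zero_mem _, neg_mem (?_ : _ ∈ E.X₀.gr (c + -a + a))⟩
    rw [neg_add_cancel_right]
    exact hm.1.2
  homog₀ c m hm := ⟨zero_mem _, zero_mem _, neg_mem hm.1.2⟩
  eq₁ := fun ⟨⟨y, z⟩, ⟨s, t⟩⟩ => by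
    change ((y + 0, (0 : E.X₀)), (s + f₀ f z, (0 : E.X₁))) - ((y, z), (s, t)) =
      (((0 : G.X₁), (0 : E.X₀)), ((0 : F.X₀), -(-E.φ₁ z + t))) +
        ((G.φ₁ 0 + f₁ (f ≫ g) 0 + (f₁ g 0 + 0), -E.φ₀ 0 + -z),
          (-(F.φ₀ 0 + f₀ f (-z)), - -E.φ₁ (-z)))
    ext <;> simp
  eq₀ := fun ⟨⟨y, z⟩, ⟨s, t⟩⟩ => by
    change ((y + 0, (0 : E.X₁)), (s + f₁ f z, (0 : E.X₀))) - ((y, z), (s, t)) =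
      (((0 : G.X₀), (0 : E.X₁)), ((0 : F.X₁), -(-E.φ₀ z + t))) +
        ((G.φ₀ 0 + f₀ (f ≫ g) 0 + (f₀ g 0 + 0), -E.φ₁ 0 + -z),
          (-(F.φ₁ 0 + f₁ f (-z)), - -E.φ₀ (-z)))
    ext <;> simp

end Octahedron

lemma f₁_eqToHom {E F : Fac.{uk, uR, uA, x} 𝓐 a W} (h : E = F) (m : E.X₁) :
    HEq (f₁ (eqToHom h) m) m := by
  subst h
  rfl

lemma f₀_eqToHom {E F : Fac.{uk, uR, uA, x} 𝓐 a W} (h : E = F) (m : E.X₀) :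
    HEq (f₀ (eqToHom h) m) m := by
  subst h
  rfl

lemma shiftFunctorComm_app (E : Fac.{uk, uR, uA, x} 𝓐 a W) (n m : ℤ) :
    ∃ h, (shiftFunctorComm (Fac.{uk, uR, uA, x} 𝓐 a W) n m).hom.app E = eqToHom h := by
  have h₁ (n m : ℤ) : ∃ h, shiftFunctorAdd (Fac.{uk, uR, uA, x} 𝓐 a W) n m = eqToIso h :=
    ⟨intIter_add T_T' T'_T n m, rfl⟩
  obtain ⟨h, e⟩ := h₁ n m
  obtain ⟨h', e'⟩ := h₁ m n
  refine ⟨?_, ?_⟩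
  · rw [← h, ← h', add_comm]
  · rw [shiftFunctorComm, shiftFunctorAdd', e, e']
    simp [eqToHom_app]

lemma f₁_eqToHom' (E : Fac.{uk, uR, uA, x} 𝓐 a W)
    (h : E.translate.untranslate = E.untranslate.translate) (m : E.X₁) :
    f₁ (E := E.translate.untranslate) (F := E.untranslate.translate) (eqToHom h) m = m :=
  eq_of_heq (f₁_eqToHom h m)

lemma f₀_eqToHom' (E : Fac.{uk, uR, uA, x} 𝓐 a W)
    (h : E.translate.untranslate = E.untranslate.translate) (m : E.X₀) :
    f₀ (E := E.translate.untranslate) (F := E.untranslate.translate) (eqToHom h) m = m :=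
  eq_of_heq (f₀_eqToHom h m)

/-- The comparison of the shift of a cone by `-1` with the cone of the shift. -/
def shiftConeIso (f : E ⟶ F) : (cone f)⟦(-1 : ℤ)⟧ ≅ cone (f⟦(-1 : ℤ)⟧') where
  hom := homMk (E := (cone f).untranslate) (F := cone ((T' 𝓐 a W).map f))
    ((LinearMap.id (M := F.X₀)).prodMap (-LinearMap.id (M := E.X₁)))
    ((LinearMap.id (M := F.X₁)).prodMap (-LinearMap.id (M := E.X₀)))
    (fun c m hm => ⟨hm.1, neg_mem (by
      have : m.2 ∈ E.X₁.gr (c + -a + a) := hm.2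
      rwa [neg_add_cancel_right] at this)⟩)
    (fun c m hm => ⟨hm.1, neg_mem (by
      change m.2 ∈ E.X₀.gr (c + a + -a)
      rw [add_neg_cancel_right]
      exact hm.2)⟩)
    (fun ⟨y, z⟩ => by
      change (-(F.φ₁ y + f₁ f z), - - -E.φ₀ z) = (-F.φ₁ y + f₁ f (-z), - -E.φ₀ (-z))
      simp [add_comm])
    (fun ⟨y, z⟩ => by
      change (-(F.φ₀ y + f₀ f z), - - -E.φ₁ z) = (-F.φ₀ y + f₀ f (-z), - -E.φ₁ (-z))
      simp [add_comm])
  inv := homMk (E := cone ((T' 𝓐 a W).map f)) (F := (cone f).untranslate)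
    ((LinearMap.id (M := F.X₀)).prodMap (-LinearMap.id (M := E.X₁)))
    ((LinearMap.id (M := F.X₁)).prodMap (-LinearMap.id (M := E.X₀)))
    (fun c m hm => ⟨hm.1, neg_mem (by
      change m.2 ∈ E.X₁.gr (c + -a + a)
      rw [neg_add_cancel_right]
      exact hm.2)⟩)
    (fun c m hm => ⟨hm.1, neg_mem (by
      have : m.2 ∈ E.X₀.gr (c + a + -a) := hm.2
      rwa [add_neg_cancel_right] at this)⟩)
    (fun ⟨y, z⟩ => by
      change (-F.φ₁ y + f₁ f z, - - -E.φ₀ z) = (-(F.φ₁ y + f₁ f (-z)), - -E.φ₀ (-z))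
      simp [add_comm])
    (fun ⟨y, z⟩ => by
      change (-F.φ₀ y + f₀ f z, - - -E.φ₁ z) = (-(F.φ₀ y + f₀ f (-z)), - -E.φ₁ (-z))
      simp [add_comm])
  hom_inv_id := hom_ext (fun ⟨y, z⟩ => Prod.ext rfl (neg_neg z))
    (fun ⟨y, z⟩ => Prod.ext rfl (neg_neg z))
  inv_hom_id := hom_ext (fun ⟨y, z⟩ => Prod.ext rfl (neg_neg z))
    (fun ⟨y, z⟩ => Prod.ext rfl (neg_neg z))

lemma shiftCone_comm (f : E ⟶ F) (h : E.translate.untranslate = E.untranslate.translate) :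
    -((T' 𝓐 a W).map (show cone f ⟶ E.translate from coneOut f) ≫ eqToHom h) =
      (show (cone f).untranslate ⟶ cone ((T' 𝓐 a W).map f) from (shiftConeIso f).hom) ≫
        (show cone ((T' 𝓐 a W).map f) ⟶ E.untranslate.translate from coneOut ((T' 𝓐 a W).map f)) := by
  refine hom_ext (fun m => ?_) (fun m => ?_)
  · rw [neg_f₁, comp_f₁, f₁_eqToHom']
    rfl
  · rw [neg_f₀, comp_f₀, f₀_eqToHom']
    rfl

lemma negOnePow_neg_one_smul (f : E ⟶ F) : (-1 : ℤ).negOnePow • f = -f := by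
  simp [Int.negOnePow_neg]

/-- The shift of a standard triangle by `-1`. -/
noncomputable def shiftTriangleIso (f : E ⟶ F) :
    (Triangle.shiftFunctor _ (-1)).obj (triangle f) ≅ triangle (f⟦(-1 : ℤ)⟧') :=
  Triangle.isoMk _ _ (Iso.refl _) (-Iso.refl _) (shiftConeIso f)
    (by
      change ((-1 : ℤ).negOnePow • f⟦(-1 : ℤ)⟧') ≫ (-𝟙 _) = 𝟙 _ ≫ f⟦(-1 : ℤ)⟧'
      simp [Int.negOnePow_neg])
    (by
      change ((-1 : ℤ).negOnePow • (coneIn f)⟦(-1 : ℤ)⟧') ≫ (shiftConeIso f).hom =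
        (-𝟙 _) ≫ coneIn (f⟦(-1 : ℤ)⟧')
      simp only [Int.negOnePow_neg, Int.negOnePow_one, Units.neg_smul, one_smul,
        Preadditive.neg_comp, Category.id_comp]
      congr 1
      refine hom_ext (fun m => ?_) (fun m => ?_)
      · exact Prod.ext rfl neg_zero
      · exact Prod.ext rfl neg_zero)
    (by
      obtain ⟨h, e⟩ := shiftFunctorComm_app E 1 (-1)
      refine (congrArg (_ ≫ ·) (CategoryTheory.Functor.map_id _ _)).trans
        ((Category.comp_id _).trans ?_)
      refine (negOnePow_neg_one_smul _).trans ?_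
      refine (congrArg (fun t => -((coneOut f)⟦(-1 : ℤ)⟧' ≫ t)) e).trans ?_
      exact shiftCone_comm f h)

end Fac

open Fac

namespace HoFac

/-- The isomorphism given by a homotopy equivalence. -/
def isoOfHomotopy {E F : Fac.{uk, uR, uA, x} 𝓐 a W} (f : E ⟶ F) (g : F ⟶ E)
    (h : NullHomotopy (f ≫ g - 𝟙 _)) (h' : NullHomotopy (g ≫ f - 𝟙 _)) :
    (quot 𝓐 a W).obj E ≅ (quot 𝓐 a W).obj F where
  hom := (quot 𝓐 a W).map f
  inv := (quot 𝓐 a W).map g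
  hom_inv_id := by rw [← Functor.map_comp, ← CategoryTheory.Functor.map_id]; exact eq_of_nullHomotopy h
  inv_hom_id := by rw [← Functor.map_comp, ← CategoryTheory.Functor.map_id]; exact eq_of_nullHomotopy h'

/-- The standard triangle in the homotopy category. -/
noncomputable abbrev triangleh {E F : Fac.{uk, uR, uA, x} 𝓐 a W} (f : E ⟶ F) :
    Triangle (HoFac.{uk, uR, uA, x} 𝓐 a W) :=
  (quot 𝓐 a W).mapTriangle.obj (triangle f)

variable (𝓐 a W) in
/-- The triangles isomorphic to a standard triangle. -/
def distTriangles : Set (Triangle (HoFac.{uk, uR, uA, x} 𝓐 a W)) :=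
  {T | ∃ (E F : Fac.{uk, uR, uA, x} 𝓐 a W) (f : E ⟶ F), Nonempty (T ≅ triangleh f)}

lemma isomorphic_dist (T₁ : Triangle (HoFac.{uk, uR, uA, x} 𝓐 a W))
    (hT₁ : T₁ ∈ distTriangles 𝓐 a W) (T₂ : Triangle (HoFac.{uk, uR, uA, x} 𝓐 a W))
    (e : T₂ ≅ T₁) : T₂ ∈ distTriangles 𝓐 a W := by
  obtain ⟨X, Y, f, ⟨e'⟩⟩ := hT₁
  exact ⟨X, Y, f, ⟨e ≪≫ e'⟩⟩

lemma isZero_quot_obj {E : Fac.{uk, uR, uA, x} 𝓐 a W} (h : NullHomotopy (𝟙 E)) :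
    IsZero ((quot 𝓐 a W).obj E) := by
  rw [IsZero.iff_id_eq_zero, ← (quot 𝓐 a W).map_id, ← (quot 𝓐 a W).map_zero]
  exact eq_of_nullHomotopy (by rw [sub_zero]; exact h)

lemma contractible_dist (X : HoFac.{uk, uR, uA, x} 𝓐 a W) :
    Pretriangulated.contractibleTriangle X ∈ distTriangles 𝓐 a W := by
  obtain ⟨X⟩ := X
  refine ⟨_, _, 𝟙 X, ⟨?_⟩⟩
  have h := isZero_quot_obj (nullHomotopyConeId X)
  exact Triangle.isoMk _ _ (Iso.refl _) (Iso.refl _) h.isoZero.symm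
    (by
      change 𝟙 ((quot 𝓐 a W).obj X) ≫ 𝟙 _ = 𝟙 _ ≫ (quot 𝓐 a W).map (𝟙 X)
      rw [CategoryTheory.Functor.map_id]) (h.eq_of_tgt _ _) ((isZero_zero _).eq_of_src _ _)

lemma cocone_dist {X Y : HoFac.{uk, uR, uA, x} 𝓐 a W} (f : X ⟶ Y) :
    ∃ (Z : HoFac.{uk, uR, uA, x} 𝓐 a W) (g : Y ⟶ Z) (h : Z ⟶ X⟦(1 : ℤ)⟧),
      Triangle.mk f g h ∈ distTriangles 𝓐 a W := by
  obtain ⟨X⟩ := X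
  obtain ⟨Y⟩ := Y
  obtain ⟨f, rfl⟩ := (quot _ _ _).map_surjective f
  exact ⟨_, _, _, ⟨_, _, f, ⟨Iso.refl _⟩⟩⟩

/-- The rotation of a standard triangle. -/
noncomputable def rotateIso {E F : Fac.{uk, uR, uA, x} 𝓐 a W} (f : E ⟶ F) :
    (triangleh f).rotate ≅ triangleh (coneIn f) :=
  Triangle.isoMk _ _ (Iso.refl _) (Iso.refl _)
    (((quot 𝓐 a W).commShiftIso (1 : ℤ)).symm.app E ≪≫
      isoOfHomotopy (rotateMap f) (rotateInv f) (.ofEq (rotateMap_rotateInv f)) (rotateHomotopy f))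
    ((Category.comp_id _).trans (Category.id_comp _).symm) (by
      change ((quot 𝓐 a W).map (coneOut f) ≫ ((quot 𝓐 a W).commShiftIso (1 : ℤ)).hom.app E) ≫
        ((quot 𝓐 a W).commShiftIso (1 : ℤ)).inv.app E ≫ (quot 𝓐 a W).map (rotateMap f) =
        𝟙 _ ≫ (quot 𝓐 a W).map (coneIn (coneIn f))
      rw [Category.assoc, Iso.hom_inv_id_app_assoc, Category.id_comp, ← coneIn_rotateInv,
        ← Functor.map_comp, Category.assoc]
      refine eq_of_nullHomotopy ?_
      have := (rotateHomotopy f).compLeft (coneIn (coneIn f))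
      rwa [Preadditive.comp_sub, Category.comp_id] at this) (by
      change (-((quot 𝓐 a W).map f)⟦(1 : ℤ)⟧') ≫ (𝟙 _)⟦(1 : ℤ)⟧' =
        (((quot 𝓐 a W).commShiftIso (1 : ℤ)).inv.app E ≫ (quot 𝓐 a W).map (rotateMap f)) ≫
          (quot 𝓐 a W).map (coneOut (coneIn f)) ≫ ((quot 𝓐 a W).commShiftIso (1 : ℤ)).hom.app F
      rw [CategoryTheory.Functor.map_id, Category.comp_id, Category.assoc, ← Functor.map_comp_assoc,
        rotateMap_coneOut, Functor.map_neg, Preadditive.neg_comp, Functor.commShiftIso_hom_naturality,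
        Preadditive.comp_neg, Iso.inv_hom_id_app_assoc])

lemma rotate_dist' (T : Triangle (HoFac.{uk, uR, uA, x} 𝓐 a W)) (hT : T ∈ distTriangles 𝓐 a W) :
    T.rotate ∈ distTriangles 𝓐 a W := by
  obtain ⟨_, _, f, ⟨e⟩⟩ := hT
  exact ⟨_, _, _, ⟨(rotate _).mapIso e ≪≫ rotateIso f⟩⟩

lemma shift_dist_one (T : Triangle (HoFac.{uk, uR, uA, x} 𝓐 a W)) (hT : T ∈ distTriangles 𝓐 a W) :
    T.rotate.rotate.rotate ∈ distTriangles 𝓐 a W :=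
  rotate_dist' _ (rotate_dist' _ (rotate_dist' _ hT))

/-- The map of standard triangles given by a square that commutes up to homotopy. -/
noncomputable def trianglehMap {E F E' F' : Fac.{uk, uR, uA, x} 𝓐 a W} (f : E ⟶ F) (f' : E' ⟶ F')
    (u : E ⟶ E') (v : F ⟶ F') (h : NullHomotopy (f ≫ v - u ≫ f')) : triangleh f ⟶ triangleh f' where
  hom₁ := (quot 𝓐 a W).map u
  hom₂ := (quot 𝓐 a W).map v
  hom₃ := (quot 𝓐 a W).map (coneMap f f' u v h)
  comm₁ := by
    change (quot 𝓐 a W).map f ≫ (quot 𝓐 a W).map v = (quot 𝓐 a W).map u ≫ (quot 𝓐 a W).map f'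
    rw [← Functor.map_comp, ← Functor.map_comp]
    exact eq_of_nullHomotopy h
  comm₂ := by
    change (quot 𝓐 a W).map (coneIn f) ≫ (quot 𝓐 a W).map (coneMap f f' u v h) =
      (quot 𝓐 a W).map v ≫ (quot 𝓐 a W).map (coneIn f')
    rw [← Functor.map_comp, ← Functor.map_comp]
    congr 1
    refine hom_ext (fun m => ?_) (fun m => ?_)
    · change (f₁ v m + h.h₀ 0, f₀ u 0) = (f₁ v m, 0)
      simp
    · change (f₀ v m + h.h₁ 0, f₁ u 0) = (f₀ v m, 0)
      simp
  comm₃ := by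
    change ((quot 𝓐 a W).map (coneOut f) ≫ ((quot 𝓐 a W).commShiftIso (1 : ℤ)).hom.app E) ≫
        ((quot 𝓐 a W).map u)⟦(1 : ℤ)⟧' = (quot 𝓐 a W).map (coneMap f f' u v h) ≫
        (quot 𝓐 a W).map (coneOut f') ≫ ((quot 𝓐 a W).commShiftIso (1 : ℤ)).hom.app E'
    rw [Category.assoc, ← Functor.commShiftIso_hom_naturality, ← Functor.map_comp_assoc,
      ← Functor.map_comp_assoc]
    rfl

lemma exists_trianglehMap {E F E' F' : Fac.{uk, uR, uA, x} 𝓐 a W} (f : E ⟶ F) (f' : E' ⟶ F')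
    (u : (triangleh f).obj₁ ⟶ (triangleh f').obj₁) (v : (triangleh f).obj₂ ⟶ (triangleh f').obj₂)
    (fac : (triangleh f).mor₁ ≫ v = u ≫ (triangleh f').mor₁) :
    ∃ γ : triangleh f ⟶ triangleh f', γ.hom₁ = u ∧ γ.hom₂ = v := by
  obtain ⟨u', rfl⟩ := (quot 𝓐 a W).map_surjective u
  obtain ⟨v', rfl⟩ := (quot 𝓐 a W).map_surjective v
  obtain ⟨H⟩ : Nonempty (NullHomotopy
      ((show E ⟶ F from f) ≫ (show F ⟶ F' from v') - (show E ⟶ E' from u') ≫ f')) := exists_nullHomotopy <| by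
    rw [Functor.map_comp, Functor.map_comp]
    exact fac
  exact ⟨trianglehMap f f' u' v' H, rfl, rfl⟩

lemma complete_dist (T₁ T₂ : Triangle (HoFac.{uk, uR, uA, x} 𝓐 a W))
    (hT₁ : T₁ ∈ distTriangles 𝓐 a W) (hT₂ : T₂ ∈ distTriangles 𝓐 a W)
    (u : T₁.obj₁ ⟶ T₂.obj₁) (v : T₁.obj₂ ⟶ T₂.obj₂) (fac : T₁.mor₁ ≫ v = u ≫ T₂.mor₁) :
    ∃ w : T₁.obj₃ ⟶ T₂.obj₃, T₁.mor₂ ≫ w = v ≫ T₂.mor₂ ∧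
      T₁.mor₃ ≫ u⟦(1 : ℤ)⟧' = w ≫ T₂.mor₃ := by
  obtain ⟨E, F, f, ⟨e⟩⟩ := hT₁
  obtain ⟨E', F', f', ⟨e'⟩⟩ := hT₂
  obtain ⟨γ', h₁, h₂⟩ := exists_trianglehMap f f' (e.inv.hom₁ ≫ u ≫ e'.hom.hom₁)
    (e.inv.hom₂ ≫ v ≫ e'.hom.hom₂) (by
      rw [e.inv.comm₁_assoc, reassoc_of% fac, e'.hom.comm₁, Category.assoc, Category.assoc])
  let γ := e.hom ≫ γ' ≫ e'.inv
  have k₁ : γ.hom₁ = u := by simp [γ, h₁]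
  have k₂ : γ.hom₂ = v := by simp [γ, h₂]
  refine ⟨γ.hom₃, ?_, ?_⟩
  · rw [← k₂]
    exact γ.comm₂
  · rw [← k₁]
    exact γ.comm₃

/-- The shift of a standard triangle in the homotopy category. -/
noncomputable def shiftIso {E F : Fac.{uk, uR, uA, x} 𝓐 a W} (f : E ⟶ F) :
    (Triangle.shiftFunctor _ (-1)).obj (triangleh f) ≅
      (quot 𝓐 a W).mapTriangle.obj ((Triangle.shiftFunctor _ (-1)).obj (triangle f)) := by
  exact ((quot 𝓐 a W).mapTriangle.commShiftIso (-1 : ℤ)).symm.app (triangle f)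

lemma shift_dist (T : Triangle (HoFac.{uk, uR, uA, x} 𝓐 a W)) (hT : T ∈ distTriangles 𝓐 a W) :
    (Triangle.shiftFunctor _ (-1)).obj T ∈ distTriangles 𝓐 a W := by
  obtain ⟨E, F, f, ⟨e⟩⟩ := hT
  exact ⟨_, _, _, ⟨(Triangle.shiftFunctor _ (-1)).mapIso e ≪≫
    (shiftIso f ≪≫ (quot 𝓐 a W).mapTriangle.mapIso (shiftTriangleIso f))⟩⟩

lemma rotate_dist (T : Triangle (HoFac.{uk, uR, uA, x} 𝓐 a W)) :
    T ∈ distTriangles 𝓐 a W ↔ T.rotate ∈ distTriangles 𝓐 a W := by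
  refine ⟨rotate_dist' T, fun hT => ?_⟩
  refine isomorphic_dist _ ?_ _ ((triangleRotation _).unitIso.app T)
  exact isomorphic_dist _ (shift_dist _ (rotate_dist' _ (rotate_dist' _ hT))) _
    ((invRotateIsoRotateRotateShiftFunctorNegOne _).app T.rotate)

noncomputable instance : Pretriangulated (HoFac.{uk, uR, uA, x} 𝓐 a W) where
  distinguishedTriangles := distTriangles 𝓐 a W
  isomorphic_distinguished := isomorphic_dist
  contractible_distinguished := contractible_dist
  distinguished_cocone_triangle := cocone_dist
  rotate_distinguished_triangle := rotate_dist
  complete_distinguished_triangle_morphism := complete_dist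

lemma triangleh_distinguished {E F : Fac.{uk, uR, uA, x} 𝓐 a W} (f : E ⟶ F) :
    triangleh f ∈ distTriang (HoFac.{uk, uR, uA, x} 𝓐 a W) :=
  ⟨_, _, f, ⟨Iso.refl _⟩⟩

lemma octahedron_dist {E F G : Fac.{uk, uR, uA, x} 𝓐 a W} (f : E ⟶ F) (g : F ⟶ G) :
    Triangle.mk ((quot 𝓐 a W).map (octaMap₁ f g)) ((quot 𝓐 a W).map (octaMap₃ f g))
      ((triangleh g).mor₃ ≫ ((triangleh f).mor₂)⟦(1 : ℤ)⟧') ∈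
      distTriang (HoFac.{uk, uR, uA, x} 𝓐 a W) := by
  refine ⟨_, _, octaMap₁ f g, ⟨?_⟩⟩
  refine Triangle.isoMk _ _ (Iso.refl _) (Iso.refl _)
    (isoOfHomotopy (octaHom f g) (octaInv f g) (.ofEq (octaHom_octaInv f g)) (octaHomotopy f g))
    ((Category.comp_id _).trans (Category.id_comp _).symm) ?_ ?_
  · change (quot 𝓐 a W).map (octaMap₃ f g) ≫ (quot 𝓐 a W).map (octaHom f g) =
      𝟙 _ ≫ (quot 𝓐 a W).map (coneIn (octaMap₁ f g))
    rw [Category.id_comp, ← coneIn_octaInv, ← Functor.map_comp, Category.assoc]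
    refine eq_of_nullHomotopy ?_
    have := (octaHomotopy f g).compLeft (coneIn (octaMap₁ f g))
    rwa [Preadditive.comp_sub, Category.comp_id] at this
  · change (((quot 𝓐 a W).map (coneOut g) ≫ ((quot 𝓐 a W).commShiftIso (1 : ℤ)).hom.app F) ≫
      ((quot 𝓐 a W).map (coneIn f))⟦(1 : ℤ)⟧') ≫ (𝟙 _)⟦(1 : ℤ)⟧' =
      (quot 𝓐 a W).map (octaHom f g) ≫ (quot 𝓐 a W).map (coneOut (octaMap₁ f g)) ≫
        ((quot 𝓐 a W).commShiftIso (1 : ℤ)).hom.app (cone f)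
    rw [CategoryTheory.Functor.map_id, Category.comp_id, Category.assoc,
      ← Functor.commShiftIso_hom_naturality, ← Functor.map_comp_assoc, ← Functor.map_comp_assoc,
      octaHom_coneOut]

instance : IsTriangulated (HoFac.{uk, uR, uA, x} 𝓐 a W) :=
  IsTriangulated.mk' (by
    rintro ⟨E⟩ ⟨F⟩ ⟨G⟩ f g
    obtain ⟨f, rfl⟩ := (quot 𝓐 a W).map_surjective f
    obtain ⟨g, rfl⟩ := (quot 𝓐 a W).map_surjective g
    let α := trianglehMap f (f ≫ g) (𝟙 E) g (.ofEq (Category.id_comp _).symm)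
    let β := trianglehMap (f ≫ g) g f (𝟙 G) (.ofEq (Category.comp_id _))
    refine ⟨_, _, _, _, _, _, _, _, Iso.refl _, Iso.refl _, Iso.refl _,
      (Category.comp_id _).trans (Category.id_comp _).symm,
      (Category.comp_id _).trans (Category.id_comp _).symm,
      _, _, triangleh_distinguished f, _, _, triangleh_distinguished g,
      _, _, triangleh_distinguished (f ≫ g), ⟨⟨α.hom₃, β.hom₃, α.comm₂, ?_, ?_, β.comm₃,
        octahedron_dist f g⟩⟩⟩
    · refine α.comm₃.symm.trans ?_
      change _ ≫ ((quot 𝓐 a W).map (𝟙 E))⟦(1 : ℤ)⟧' = _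
      rw [CategoryTheory.Functor.map_id, CategoryTheory.Functor.map_id]
      exact Category.comp_id _
    · refine β.comm₂.trans ?_
      change (quot 𝓐 a W).map (𝟙 G) ≫ _ = _
      rw [CategoryTheory.Functor.map_id]
      exact Category.id_comp _)

end HoFac

end Cone

section AbsoluteDerived

variable {k : Type uk} [CommRing k] {R : Type uR} [CommRing R] [Algebra k R]
  {A : Type uA} [AddCommGroup A] {𝓐 : A → Submodule k R} {a : A} {W : R}

open GrMod

namespace Fac

variable {E F G : Fac.{uk, uR, uA, x} 𝓐 a W}

/-- The zero null-homotopy. -/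
def NullHomotopy.ofEqZero {f : E ⟶ F} (h : f = 0) : NullHomotopy f where
  h₁ := 0
  h₀ := 0
  homog₁ _ _ _ := zero_mem _
  homog₀ _ _ _ := zero_mem _
  eq₁ m := by simp [h]
  eq₀ m := by simp [h]

/-- The sequence `0 ⟶ E ⟶ F ⟶ G ⟶ 0` of closed morphisms is exact (in each component). -/
structure ShortExact (f : E ⟶ F) (g : F ⟶ G) : Prop where
  comp_eq_zero : f ≫ g = 0
  injective₁ : Function.Injective (f₁ f)
  injective₀ : Function.Injective (f₀ f)
  exact₁ : Function.Exact (f₁ f) (f₁ g)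
  exact₀ : Function.Exact (f₀ f) (f₀ g)
  surjective₁ : Function.Surjective (f₁ g)
  surjective₀ : Function.Surjective (f₀ g)

/-- The totalization of a complex `E ⟶ F ⟶ G`: the cone of the map `cone f ⟶ G` induced
by `g`. -/
abbrev total (f : E ⟶ F) (g : F ⟶ G) (h : f ≫ g = 0) : Fac.{uk, uR, uA, x} 𝓐 a W :=
  cone (coneDesc f g (.ofEqZero h))

end Fac

open Fac

variable (𝓐 a W) in
/-- The totalizations of short exact sequences. -/
def totals : ObjectProperty (HoFac.{uk, uR, uA, x} 𝓐 a W) := fun X =>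
  ∃ (E F G : Fac.{uk, uR, uA, x} 𝓐 a W) (f : E ⟶ F) (g : F ⟶ G) (h : ShortExact f g),
    X = (HoFac.quot 𝓐 a W).obj (total f g h.comp_eq_zero)

instance : (totals.{uk, uR, uA, x} 𝓐 a W).Nonempty :=
  ⟨_, ⟨Fac.zero, Fac.zero, Fac.zero, 0, 0,
    ⟨comp_zero, fun _ _ _ => rfl, fun _ _ _ => rfl,
      fun _ => ⟨fun _ => ⟨0, rfl⟩, fun _ => rfl⟩, fun _ => ⟨fun _ => ⟨0, rfl⟩, fun _ => rfl⟩,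
      fun _ => ⟨0, rfl⟩, fun _ => ⟨0, rfl⟩⟩, rfl⟩⟩

variable (𝓐 a W) in
/-- The acyclic factorizations: the thick subcategory generated by the totalizations of
short exact sequences. -/
def acyclic : ObjectProperty (HoFac.{uk, uR, uA, x} 𝓐 a W) :=
  (totals 𝓐 a W).triangEnvelope

instance : (acyclic.{uk, uR, uA, x} 𝓐 a W).IsTriangulated :=
  inferInstanceAs (totals 𝓐 a W).triangEnvelope.IsTriangulated

instance : (acyclic.{uk, uR, uA, x} 𝓐 a W).IsStableUnderRetracts :=
  inferInstanceAs (totals 𝓐 a W).triangEnvelope.IsStableUnderRetracts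

variable (𝓐 a W) in
/-- The absolute derived category `D^abs[fact]` of factorizations of `W` with finitely generated
graded components: the Verdier quotient of the homotopy category by the acyclic objects. -/
abbrev DAbs := (acyclic.{uk, uR, uA, x} 𝓐 a W).trW.Localization

variable (𝓐 a W) in
/-- The localization functor. -/
abbrev loc : HoFac.{uk, uR, uA, x} 𝓐 a W ⥤ DAbs.{uk, uR, uA, x} 𝓐 a W :=
  (acyclic.{uk, uR, uA, x} 𝓐 a W).trW.Q

end AbsoluteDerived

section Regrading

variable {k : Type uk} [CommRing k] {R : Type uR} [CommRing R] [Algebra k R]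
  {A : Type uA} [AddCommGroup A] {B : Type uB} [AddCommGroup B]
  {𝓐 : A → Submodule k R} {a : A} {𝓑 : B → Submodule k R} {b : B} {W : R}

open GrMod Fac Pretriangulated

/-- A functorial way to replace the grading of graded modules by another grading of the same
underlying modules. It is used for the twists and for the restriction of gradings along a
homomorphism. -/
structure Regrade (𝓐 : A → Submodule k R) (a : A) (𝓑 : B → Submodule k R) (b : B) where
  gr : ∀ M : GrMod.{uk, uR, uA, x} 𝓐, B → Submodule k M
  indep : ∀ M, iSupIndep (gr M)
  iSup_gr : ∀ M, ⨆ c, gr M c = ⊤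
  smul_mem : ∀ (M : GrMod.{uk, uR, uA, x} 𝓐) {i j : B} {r : R} {m : M}, r ∈ 𝓑 i → m ∈ gr M j →
    r • m ∈ gr M (i + j)
  map_mem : ∀ {M N : GrMod.{uk, uR, uA, x} 𝓐} (f : M →ₗ[R] N), IsHomog M N f →
    ∀ (c : B) (m : M), m ∈ gr M c → f m ∈ gr N c
  gr_tw : ∀ M c, gr (M.tw a) c = gr M (c + b)

namespace Regrade

variable (r : Regrade.{uk, uR, uA, uB, x} 𝓐 a 𝓑 b)

/-- The regrading of a graded module. -/
abbrev mod (M : GrMod.{uk, uR, uA, x} 𝓐) : GrMod.{uk, uR, uB, x} 𝓑 where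
  carrier := M
  gr := r.gr M
  indep := r.indep M
  iSup_gr := r.iSup_gr M
  smul_mem hr hm := r.smul_mem M hr hm
  finite := M.finite

lemma mod_tw (M : GrMod.{uk, uR, uA, x} 𝓐) : r.mod (M.tw a) = (r.mod M).tw b := by
  have : r.gr (M.tw a) = fun c => r.gr M (c + b) := funext (r.gr_tw M)
  simp only [mod, tw, GrMod.mk.injEq, heq_eq_eq, true_and]
  exact this

lemma gr_tw_neg (M : GrMod.{uk, uR, uA, x} 𝓐) (c : B) :
    r.gr (M.tw (-a)) c = r.gr M (c - b) := by
  have h := r.gr_tw (M.tw (-a)) (c - b)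
  rw [sub_add_cancel] at h
  have e (d : A) : M.gr d = M.gr (d + a + -a) := by rw [add_neg_cancel_right]
  refine h.symm.trans (le_antisymm (fun m hm => ?_) (fun m hm => ?_))
  · exact r.map_mem (M := (M.tw (-a)).tw a) (N := M) LinearMap.id
      (fun d m hm => (e d).symm ▸ hm) _ m hm
  · exact r.map_mem (M := M) (N := (M.tw (-a)).tw a) LinearMap.id
      (fun d m hm => (e d) ▸ hm) _ m hm

lemma mod_tw_neg (M : GrMod.{uk, uR, uA, x} 𝓐) : r.mod (M.tw (-a)) = (r.mod M).tw (-b) := by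
  have : r.gr (M.tw (-a)) = fun c => r.gr M (c + -b) :=
    funext fun c => (r.gr_tw_neg M c).trans (by rw [sub_eq_add_neg])
  simp only [mod, tw, GrMod.mk.injEq, heq_eq_eq, true_and]
  exact this

lemma mem_gr_prod (M N : GrMod.{uk, uR, uA, x} 𝓐) (c : B) (m : M × N) :
    m ∈ r.gr (M.prod N) c ↔ m.1 ∈ r.gr M c ∧ m.2 ∈ r.gr N c := by
  refine ⟨fun h => ⟨?_, ?_⟩, fun h => ?_⟩
  · exact r.map_mem (M := M.prod N) (LinearMap.fst R M N) (fun _ _ hm => hm.1) c m h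
  · exact r.map_mem (M := M.prod N) (LinearMap.snd R M N) (fun _ _ hm => hm.2) c m h
  · have h₁ := r.map_mem (N := M.prod N) (LinearMap.inl R M N)
      (fun _ _ hm => ⟨hm, zero_mem _⟩) c m.1 h.1
    have h₂ := r.map_mem (N := M.prod N) (LinearMap.inr R M N)
      (fun _ _ hm => ⟨zero_mem _, hm⟩) c m.2 h.2
    have := add_mem h₁ h₂
    simpa using this

/-- The regrading of a factorization. -/
abbrev facObj (E : Fac.{uk, uR, uA, x} 𝓐 a W) : Fac.{uk, uR, uB, x} 𝓑 b W where
  X₁ := r.mod E.X₁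
  X₀ := r.mod E.X₀
  φ₀ := E.φ₀
  φ₁ := E.φ₁
  homog₀ := r.map_mem E.φ₀ E.homog₀
  homog₁ c m hm := by
    have := r.map_mem (N := E.X₁.tw a) E.φ₁ E.homog₁ c m hm
    rw [r.gr_tw] at this
    exact this
  φ₁_φ₀ := E.φ₁_φ₀
  φ₀_φ₁ := E.φ₀_φ₁

variable (W) in
/-- The regrading of factorizations. -/
def fac : Fac.{uk, uR, uA, x} 𝓐 a W ⥤ Fac.{uk, uR, uB, x} 𝓑 b W where
  obj E := r.facObj E
  map {E F} f := homMk (E := r.facObj E) (F := r.facObj F)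
    (f₁ (E := E) (F := F) f) (f₀ (E := E) (F := F) f)
    (r.map_mem (f₁ (E := E) (F := F) f) (fun _ _ hm => f₁_mem (E := E) (F := F) f hm))
    (r.map_mem (f₀ (E := E) (F := F) f) (fun _ _ hm => f₀_mem (E := E) (F := F) f hm))
    (f₀_φ₀ (E := E) (F := F) f) (f₁_φ₁ (E := E) (F := F) f)

lemma fac_T : T 𝓐 a W ⋙ r.fac W = r.fac W ⋙ T 𝓑 b W :=
  have h (E : Fac.{uk, uR, uA, x} 𝓐 a W) : r.facObj E.translate = (r.facObj E).translate :=
    ext_tw (r.facObj E.translate) (r.facObj E).translate.X₁ (r.facObj E).translate.X₀ rfl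
      (r.mod_tw E.X₁) (r.facObj E).translate.φ₀ (r.facObj E).translate.φ₁ HEq.rfl HEq.rfl _ _ _ _
  Functor.hext h (fun E F _ => hom_heq (h E) (h F) HEq.rfl HEq.rfl)

lemma fac_T' : T' 𝓐 a W ⋙ r.fac W = r.fac W ⋙ T' 𝓑 b W :=
  have h (E : Fac.{uk, uR, uA, x} 𝓐 a W) : r.facObj E.untranslate = (r.facObj E).untranslate :=
    ext_tw (r.facObj E.untranslate) (r.facObj E).untranslate.X₁ (r.facObj E).untranslate.X₀
      (r.mod_tw_neg E.X₀) rfl (r.facObj E).untranslate.φ₀ (r.facObj E).untranslate.φ₁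
      HEq.rfl HEq.rfl _ _ _ _
  Functor.hext h (fun E F _ => hom_heq (h E) (h F) HEq.rfl HEq.rfl)

lemma fac_shift (n : ℤ) : shiftFunctor (Fac.{uk, uR, uA, x} 𝓐 a W) n ⋙ r.fac W =
    r.fac W ⋙ shiftFunctor (Fac.{uk, uR, uB, x} 𝓑 b W) n := by
  rw [shiftFunctor_eq, shiftFunctor_eq]
  induction n with
  | zero => rfl
  | succ n ih =>
    rw [intIter_add_one T'_T, intIter_add_one T'_T, ← Functor.assoc, ← ih, Functor.assoc, fac_T]
    rfl
  | pred n ih =>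
    rw [intIter_sub_one T_T' T'_T, intIter_sub_one T_T' T'_T, ← Functor.assoc, ← ih,
      Functor.assoc, fac_T']
    rfl

lemma shiftFunctorZero_eq :
    ∃ h, shiftFunctorZero (Fac.{uk, uR, uA, x} 𝓐 a W) ℤ = eqToIso h := 
  ⟨intIter_zero (S := T 𝓐 a W) (S' := T' 𝓐 a W), rfl⟩

lemma shiftFunctorAdd_eq (n m : ℤ) :
    ∃ h, shiftFunctorAdd (Fac.{uk, uR, uA, x} 𝓐 a W) n m = eqToIso h :=
  ⟨intIter_add T_T' T'_T n m, rfl⟩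

noncomputable instance : (r.fac W).CommShift ℤ where
  commShiftIso n := eqToIso (r.fac_shift n)
  commShiftIso_zero := by
    ext1
    ext1
    funext E
    obtain ⟨h, e⟩ := shiftFunctorZero_eq (𝓐 := 𝓐) (a := a) (W := W)
    obtain ⟨h', e'⟩ := shiftFunctorZero_eq (𝓐 := 𝓑) (a := b) (W := W)
    rw [Functor.CommShift.isoZero_hom_app, e, e']
    simp [eqToHom_app, eqToHom_map]
  commShiftIso_add n m := by
    ext1
    ext1
    funext E
    obtain ⟨h, e⟩ := shiftFunctorAdd_eq (𝓐 := 𝓐) (a := a) (W := W) n m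
    obtain ⟨h', e'⟩ := shiftFunctorAdd_eq (𝓐 := 𝓑) (a := b) (W := W) n m
    rw [Functor.CommShift.isoAdd_hom_app, e, e']
    simp [eqToHom_app, eqToHom_map]

/-- The regrading of a null-homotopy. -/
def nullHomotopy {E F : Fac.{uk, uR, uA, x} 𝓐 a W} {f : E ⟶ F} (h : NullHomotopy f) :
    NullHomotopy ((r.fac W).map f) where
  h₁ := h.h₁
  h₀ := h.h₀
  homog₁ c m hm := by
    have := r.map_mem (N := F.X₀.tw (-a)) h.h₁ h.homog₁ c m hm
    rw [r.gr_tw_neg, sub_eq_add_neg] at this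
    exact this
  homog₀ := r.map_mem h.h₀ h.homog₀
  eq₁ := h.eq₁
  eq₀ := h.eq₀

/-- Regrading commutes with cones. -/
def coneIso {E F : Fac.{uk, uR, uA, x} 𝓐 a W} (f : E ⟶ F) :
    (r.fac W).obj (cone f) ≅ cone ((r.fac W).map f) where
  hom := homMk (E := r.facObj (cone f)) (F := cone ((r.fac W).map f)) LinearMap.id LinearMap.id
    (fun c m hm => (r.mem_gr_prod _ _ c m).1 hm)
    (fun c m hm => by
      have := (r.mem_gr_prod F.X₀ (E.X₁.tw a) c m).1 hm
      exact ⟨this.1, (r.gr_tw E.X₁ c).le this.2⟩) (fun _ => rfl) (fun _ => rfl)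
  inv := homMk (E := cone ((r.fac W).map f)) (F := r.facObj (cone f)) LinearMap.id LinearMap.id
    (fun c m hm => (r.mem_gr_prod _ _ c m).2 hm)
    (fun c m hm => (r.mem_gr_prod F.X₀ (E.X₁.tw a) c m).2
      ⟨hm.1, (r.gr_tw E.X₁ c).ge hm.2⟩) (fun _ => rfl) (fun _ => rfl)

lemma coneIso_comm {E F : Fac.{uk, uR, uA, x} 𝓐 a W} (f : E ⟶ F)
    (h : r.facObj E.translate = (r.facObj E).translate) :
    (r.fac W).map (show cone f ⟶ E.translate from coneOut f) ≫ eqToHom h =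
      (r.coneIso f).hom ≫
        (show cone ((r.fac W).map f) ⟶ (r.facObj E).translate from coneOut ((r.fac W).map f)) := by
  have h₁ (m : E.X₀) : f₁ (E := r.facObj E.translate) (F := (r.facObj E).translate) (eqToHom h) m
    = m := eq_of_heq (f₁_eqToHom h m)
  have h₀ (m : E.X₁) : f₀ (E := r.facObj E.translate) (F := (r.facObj E).translate) (eqToHom h) m
    = m := eq_of_heq (f₀_eqToHom h m)
  refine hom_ext (fun m => ?_) (fun m => ?_)
  · exact h₁ _
  · exact h₀ _

/-- Regrading commutes with standard triangles. -/
noncomputable def triangleIso {E F : Fac.{uk, uR, uA, x} 𝓐 a W} (f : E ⟶ F) :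
    (r.fac W).mapTriangle.obj (triangle f) ≅ triangle ((r.fac W).map f) :=
  Triangle.isoMk _ _ (Iso.refl _) (Iso.refl _) (r.coneIso f)
    ((Category.comp_id _).trans (Category.id_comp _).symm)
    (by
      refine Eq.trans ?_ (Category.id_comp _).symm
      rfl)
    (by
      refine (congrArg (_ ≫ ·) (CategoryTheory.Functor.map_id _ _)).trans
        ((Category.comp_id _).trans ?_)
      have e : ((r.fac W).commShiftIso (1 : ℤ)).hom.app E =
        eqToHom (Functor.congr_obj (r.fac_shift 1) E) := eqToHom_app (r.fac_shift 1) E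
      refine (congrArg (fun t => (r.fac W).map (coneOut f) ≫ t) e).trans ?_
      exact r.coneIso_comm f _)

variable (W) in
/-- The regrading of factorizations, on the homotopy category. -/
def ho : HoFac.{uk, uR, uA, x} 𝓐 a W ⥤ HoFac.{uk, uR, uB, x} 𝓑 b W :=
  CategoryTheory.Quotient.lift _ (r.fac W ⋙ HoFac.quot 𝓑 b W)
    (fun _ _ _ _ ⟨h⟩ => HoFac.eq_of_nullHomotopy (r.nullHomotopy h))

noncomputable instance : (r.ho W).CommShift ℤ :=
  inferInstanceAs ((CategoryTheory.Quotient.lift _ (r.fac W ⋙ HoFac.quot 𝓑 b W) _).CommShift ℤ)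

variable (W) in
/-- `ho` is induced by `fac`. -/
def hoIso : HoFac.quot 𝓐 a W ⋙ r.ho W ≅ r.fac W ⋙ HoFac.quot 𝓑 b W := Iso.refl _

instance : NatTrans.CommShift (r.hoIso W).hom ℤ :=
  inferInstanceAs (NatTrans.CommShift (CategoryTheory.Quotient.lift.isLift
    (homRel 𝓐 a W) (r.fac W ⋙ HoFac.quot 𝓑 b W) _).hom ℤ)

instance : (r.ho W).IsTriangulated where
  map_distinguished := by
    rintro T ⟨E, F, f, ⟨e⟩⟩
    exact ⟨_, _, (r.fac W).map f, ⟨(r.ho W).mapTriangle.mapIso e ≪≫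
      (Functor.mapTriangleCompIso _ _).symm.app _ ≪≫
      (Functor.mapTriangleIso (r.hoIso W)).app _ ≪≫
      (Functor.mapTriangleCompIso _ _).app _ ≪≫
      (HoFac.quot 𝓑 b W).mapTriangle.mapIso (r.triangleIso f)⟩⟩

/-- Regrading commutes with totalizations. -/
def totalIso {E F G : Fac.{uk, uR, uA, x} 𝓐 a W} (f : E ⟶ F) (g : F ⟶ G) (h : f ≫ g = 0)
    (h' : (r.fac W).map f ≫ (r.fac W).map g = 0) :
    (r.fac W).obj (total f g h) ≅ total ((r.fac W).map f) ((r.fac W).map g) h' where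
  hom := homMk (E := r.facObj (total f g h))
    (F := total ((r.fac W).map f) ((r.fac W).map g) h') LinearMap.id LinearMap.id
    (fun c m hm => by
      have h₁ := (r.mem_gr_prod G.X₁ (F.X₀.prod (E.X₁.tw a)) c m).1 hm
      have h₂ := (r.mem_gr_prod F.X₀ (E.X₁.tw a) c m.2).1 h₁.2
      exact ⟨h₁.1, h₂.1, (r.gr_tw E.X₁ c).le h₂.2⟩)
    (fun c m hm => by
      have h₁ := (r.mem_gr_prod G.X₀ ((F.X₁.prod E.X₀).tw a) c m).1 hm
      have h₂ := (r.mem_gr_prod F.X₁ E.X₀ (c + b) m.2).1 ((r.gr_tw (F.X₁.prod E.X₀) c).le h₁.2)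
      exact ⟨h₁.1, h₂⟩) (fun _ => rfl) (fun _ => rfl)
  inv := homMk (E := total ((r.fac W).map f) ((r.fac W).map g) h')
    (F := r.facObj (total f g h)) LinearMap.id LinearMap.id
    (fun c m hm => (r.mem_gr_prod G.X₁ (F.X₀.prod (E.X₁.tw a)) c m).2 ⟨hm.1,
      (r.mem_gr_prod F.X₀ (E.X₁.tw a) c m.2).2 ⟨hm.2.1, (r.gr_tw E.X₁ c).ge hm.2.2⟩⟩)
    (fun c m hm => (r.mem_gr_prod G.X₀ ((F.X₁.prod E.X₀).tw a) c m).2 ⟨hm.1,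
      (r.gr_tw (F.X₁.prod E.X₀) c).ge ((r.mem_gr_prod F.X₁ E.X₀ (c + b) m.2).2 hm.2)⟩)
    (fun _ => rfl) (fun _ => rfl)

lemma acyclic_le : acyclic 𝓐 a W ≤ (acyclic 𝓑 b W).inverseImage (r.ho W) := by
  have : ((acyclic 𝓑 b W).inverseImage (r.ho W)).IsStableUnderRetracts :=
    ⟨fun i hY => (acyclic 𝓑 b W).prop_of_retract (i.map (r.ho W)) hY⟩
  refine (ObjectProperty.triangEnvelope_le_iff _).2 ?_
  rintro _ ⟨E, F, G, f, g, h, rfl⟩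
  have h' : (r.fac W).map f ≫ (r.fac W).map g = 0 := by
    rw [← Functor.map_comp, h.comp_eq_zero]
    rfl
  refine (acyclic 𝓑 b W).prop_of_iso ((HoFac.quot 𝓑 b W).mapIso
    (r.totalIso f g h.comp_eq_zero h')).symm ?_
  refine ObjectProperty.le_triangEnvelope _ _ ⟨_, _, _, _, _, ⟨h', ?_, ?_, ?_, ?_, ?_, ?_⟩, rfl⟩
  · exact h.injective₁
  · exact h.injective₀
  · exact h.exact₁
  · exact h.exact₀
  · exact h.surjective₁
  · exact h.surjective₀

lemma trW_map {E F : HoFac.{uk, uR, uA, x} 𝓐 a W} {f : E ⟶ F} (hf : (acyclic 𝓐 a W).trW f) :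
    (acyclic 𝓑 b W).trW ((r.ho W).map f) := by
  have := ObjectProperty.trW_monotone r.acyclic_le _ hf
  rwa [ObjectProperty.inverseImage_trW_iff] at this

variable (W) in
/-- The regrading of factorizations, on the absolute derived category. -/
noncomputable def dabs : DAbs.{uk, uR, uA, x} 𝓐 a W ⥤ DAbs.{uk, uR, uB, x} 𝓑 b W :=
  Localization.lift (r.ho W ⋙ loc 𝓑 b W)
    (fun _ _ _ hf => Localization.inverts (loc 𝓑 b W) _ _ (r.trW_map hf)) (loc 𝓐 a W)

end Regrade

end Regrading

section Gradings

variable {k : Type uk} [CommRing k] {R : Type uR} [CommRing R] [Algebra k R]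
  {A : Type uA} [AddCommGroup A] {B : Type uB} [AddCommGroup B]
  {𝓐 : A → Submodule k R} {a : A} {W : R}

open GrMod Fac

/-- The family with components `⨁_{π c = b} G c`. -/
def coarse {V : Type*} [AddCommGroup V] [Module k V] (π : A →+ B) (G : A → Submodule k V) (b : B) :
    Submodule k V :=
  ⨆ c : {c // π c = b}, G c

lemma le_coarse {V : Type*} [AddCommGroup V] [Module k V] (π : A →+ B) (G : A → Submodule k V)
    (c : A) : G c ≤ coarse π G (π c) :=
  le_iSup (fun c' : {c' // π c' = π c} => G c') ⟨c, rfl⟩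

lemma coarse_induction {V : Type*} [AddCommGroup V] [Module k V] {π : A →+ B}
    {G : A → Submodule k V} {b : B} {P : V → Prop} {v : V} (hv : v ∈ coarse π G b)
    (h : ∀ c, π c = b → ∀ m ∈ G c, P m) (h₀ : P 0) (hadd : ∀ m n, P m → P n → P (m + n)) : P v :=
  Submodule.iSup_induction _ (motive := P) hv (fun c m hm => h c c.2 m hm) h₀ hadd

lemma iSup_coarse {V : Type*} [AddCommGroup V] [Module k V] (π : A →+ B)
    (G : A → Submodule k V) : ⨆ b, coarse π G b = ⨆ c, G c :=
  le_antisymm (iSup_le fun _ => iSup_le fun c => le_iSup G c)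
    (iSup_le fun c => (le_coarse π G c).trans (le_iSup (coarse π G) (π c)))

lemma exists_of_mem_coarse {V : Type*} [AddCommGroup V] [Module k V] {π : A →+ B}
    {G : A → Submodule k V} {b : B} {v : V} (hv : v ∈ coarse π G b) :
    ∃ f : A →₀ V, (∀ c, f c ∈ G c) ∧ (∀ c, π c ≠ b → f c = 0) ∧ (f.sum fun _ m => m) = v := by
  classical
  refine coarse_induction (P := fun v => ∃ f : A →₀ V, (∀ c, f c ∈ G c) ∧
    (∀ c, π c ≠ b → f c = 0) ∧ (f.sum fun _ m => m) = v) hv ?_ ?_ ?_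
  · intro c hc m hm
    refine ⟨Finsupp.single c m, fun d => ?_, fun d hd => ?_, Finsupp.sum_single_index rfl⟩
    · rw [Finsupp.single_apply]
      split_ifs with h
      · exact h ▸ hm
      · exact zero_mem _
    · exact Finsupp.single_eq_of_ne fun h => hd (h ▸ hc)
  · exact ⟨0, fun c => zero_mem _, fun _ _ => rfl, Finsupp.sum_zero_index⟩
  · rintro _ _ ⟨f, h₁, h₂, rfl⟩ ⟨g, h₃, h₄, rfl⟩
    exact ⟨f + g, fun c => add_mem (h₁ c) (h₃ c),
      fun c hc => by rw [Finsupp.add_apply, h₂ c hc, h₄ c hc, add_zero],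
      Finsupp.sum_add_index' (fun _ => rfl) (fun _ _ _ => rfl)⟩

lemma iSupIndep_coarse {V : Type*} [AddCommGroup V] [Module k V] (π : A →+ B)
    {G : A → Submodule k V} (h : iSupIndep G) : iSupIndep (coarse π G) := by
  classical
  rw [iSupIndep_iff_finsetSum_eq_zero_imp_eq_zero] at h ⊢
  intro s v hv h0 i hi
  have key (j : B) : ∃ f : A →₀ V, j ∈ s → (∀ c, f c ∈ G c) ∧ (∀ c, π c ≠ j → f c = 0) ∧
      (f.sum fun _ m => m) = v j := by
    by_cases hj : j ∈ s
    · obtain ⟨f, hf⟩ := exists_of_mem_coarse (hv j hj)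
      exact ⟨f, fun _ => hf⟩
    · exact ⟨0, fun h => (hj h).elim⟩
  choose f hf using key
  have hs : ((∑ j ∈ s, f j).sum fun _ m => m) = 0 := by
    rw [← Finsupp.sum_finsetSum_index (fun _ => rfl) (fun _ _ _ => rfl), ← h0]
    exact Finset.sum_congr rfl fun j hj => (hf j hj).2.2
  have h1 (c : A) : (∑ j ∈ s, f j) c = 0 := by
    by_contra hc
    refine hc (h _ (fun c => (∑ j ∈ s, f j) c) (fun c _ => ?_) hs c (Finsupp.mem_support_iff.2 hc))
    rw [Finsupp.finsetSum_apply]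
    exact sum_mem fun j hj => (hf j hj).1 c
  have h2 : f i = 0 := by
    ext c
    by_cases hc : π c = i
    · have := h1 c
      rwa [Finsupp.finsetSum_apply, Finset.sum_eq_single i
        (fun j hj hji => (hf j hj).2.1 c fun h => hji (h.symm.trans hc))
        (fun h => (h hi).elim)] at this
    · exact (hf i hi).2.1 c hc
  rw [← (hf i hi).2.2, h2]
  exact Finsupp.sum_zero_index

variable (𝓐 a) in
/-- The twist of graded modules by `γ`. -/
def twist (γ : A) : Regrade.{uk, uR, uA, uA, x} 𝓐 a 𝓐 a where
  gr M := (M.tw γ).gr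
  indep M := (M.tw γ).indep
  iSup_gr M := (M.tw γ).iSup_gr
  smul_mem M := (M.tw γ).smul_mem
  map_mem _ hf c m hm := hf (c + γ) m hm
  gr_tw M c := congrArg M.gr (add_right_comm c γ a)

variable (𝓐 a) in
/-- The restriction of gradings along a homomorphism `π : A → B`, with
`M_b = ⨁_{π c = b} M_c`. -/
def coarsen (π : A →+ B) : Regrade.{uk, uR, uA, uB, x} 𝓐 a (coarse π 𝓐) (π a) where
  gr M := coarse π M.gr
  indep M := iSupIndep_coarse π M.indep
  iSup_gr M := (iSup_coarse π M.gr).trans M.iSup_gr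
  smul_mem M i j r m hr hm := by
    refine coarse_induction (P := fun r => r • m ∈ coarse π M.gr (i + j)) hr (fun c hc r hr => ?_) ?_ ?_
    · refine coarse_induction (P := fun m => r • m ∈ coarse π M.gr (i + j)) hm (fun d hd m hm => ?_) ?_ ?_
      · have := le_coarse π M.gr _ (M.smul_mem hr hm)
        rwa [map_add, hc, hd] at this
      · rw [smul_zero]
        exact zero_mem _
      · intro m n hm hn
        rw [smul_add]
        exact add_mem hm hn
    · rw [zero_smul]
      exact zero_mem _
    · intro r s hr hs
      rw [add_smul]
      exact add_mem hr hs
  map_mem {M N} f hf b m hm := by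
    refine coarse_induction (P := fun m => f m ∈ coarse π N.gr b) hm (fun c hc m hm => ?_) ?_ ?_
    · have := le_coarse π N.gr _ (hf c m hm)
      rwa [hc] at this
    · rw [map_zero]
      exact zero_mem _
    · intro m n hm hn
      rw [map_add]
      exact add_mem hm hn
  gr_tw M b := by
    apply le_antisymm
    · refine iSup_le fun c => ?_
      have := le_coarse π M.gr (c + a)
      rwa [map_add, c.2] at this
    · refine iSup_le fun c => ?_
      have := le_coarse π (M.tw a).gr (c - a)
      rw [map_sub, c.2, add_sub_cancel_right] at this
      refine le_trans ?_ this
      change M.gr c ≤ M.gr (c - a + a)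
      rw [sub_add_cancel]

variable (𝓐 a W) in
/-- The restriction functor `D^abs[fact(R, A, W)] ⥤ D^abs[fact(R, B, W)]` along `π : A → B`. -/
noncomputable abbrev res (π : A →+ B) :
    DAbs.{uk, uR, uA, x} 𝓐 a W ⥤ DAbs.{uk, uR, uB, x} (coarse π 𝓐) (π a) W :=
  (coarsen 𝓐 a π).dabs W

end Gradings

section Action

variable {k : Type uk} [CommRing k] {R : Type uR} [CommRing R] [Algebra k R]
  {A : Type uA} [AddCommGroup A]
  {𝓐 : A → Submodule k R} {a : A} {W : R}

open GrMod Fac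

lemma twist_zero_obj (E : Fac.{uk, uR, uA, x} 𝓐 a W) : (twist 𝓐 a 0).facObj E = E := by
  refine ext_tw ((twist 𝓐 a 0).facObj E) E.X₁ E.X₀ (tw_zero _) (tw_zero _) E.φ₀ E.φ₁ HEq.rfl HEq.rfl
    _ _ _ _

lemma twist_zero : (twist.{uk, uR, uA, x} 𝓐 a 0).fac W = 𝟭 _ :=
  Functor.hext twist_zero_obj fun E F _ =>
    hom_heq (twist_zero_obj E) (twist_zero_obj F) HEq.rfl HEq.rfl

lemma twist_add_obj (γ δ : A) (E : Fac.{uk, uR, uA, x} 𝓐 a W) :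
    (twist 𝓐 a (γ + δ)).facObj E = (twist 𝓐 a δ).facObj ((twist 𝓐 a γ).facObj E) :=
  ((ext_tw ((twist 𝓐 a δ).facObj ((twist 𝓐 a γ).facObj E)) ((twist 𝓐 a (γ + δ)).facObj E).X₁
    ((twist 𝓐 a (γ + δ)).facObj E).X₀ (tw_tw _ _ _) (tw_tw _ _ _) E.φ₀ E.φ₁ HEq.rfl HEq.rfl
    _ _ _ _).trans rfl).symm

lemma twist_add (γ δ : A) : (twist.{uk, uR, uA, x} 𝓐 a (γ + δ)).fac W =
    (twist 𝓐 a γ).fac W ⋙ (twist 𝓐 a δ).fac W :=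
  Functor.hext (twist_add_obj γ δ) fun E F _ =>
    hom_heq (twist_add_obj γ δ E) (twist_add_obj γ δ F) HEq.rfl HEq.rfl

/-- A subgroup `Γ` of `A` acts on factorizations by twists. -/
instance (Γ : AddSubgroup A) : HasShift (Fac.{uk, uR, uA, x} 𝓐 a W) Γ :=
  hasShiftMk _ Γ
    { F := fun γ => (twist 𝓐 a (γ : A)).fac W
      zero := eqToIso twist_zero
      add := fun γ δ => eqToIso (twist_add (γ : A) δ)
      assoc_hom_app := fun _ _ _ _ => by
        simp [eqToHom_app, eqToHom_map]
      zero_add_hom_app := fun _ _ => by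
        rw [eqToIso.hom, eqToIso.inv, eqToHom_app, eqToHom_app, eqToHom_map, eqToHom_trans]
      add_zero_hom_app := fun _ _ => by
        rw [eqToIso.hom, eqToIso.inv, eqToHom_app, eqToHom_app, eqToHom_trans] }

variable {Γ : AddSubgroup A} (γ : Γ)

lemma shiftFunctor_eq_twist :
    shiftFunctor (Fac.{uk, uR, uA, x} 𝓐 a W) γ = (twist 𝓐 a (γ : A)).fac W := rfl

instance : (shiftFunctor (Fac.{uk, uR, uA, x} 𝓐 a W) γ).Additive := ⟨rfl⟩

instance : (shiftFunctor (Fac.{uk, uR, uA, x} 𝓐 a W) γ).Linear k := ⟨fun _ _ => rfl⟩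

instance : (homRel.{uk, uR, uA, x} 𝓐 a W).IsCompatibleWithShift Γ :=
  ⟨fun γ _ _ _ _ ⟨h⟩ => ⟨(twist 𝓐 a (γ : A)).nullHomotopy h⟩⟩

noncomputable instance : HasShift (HoFac.{uk, uR, uA, x} 𝓐 a W) Γ :=
  inferInstanceAs (HasShift (CategoryTheory.Quotient (homRel 𝓐 a W)) Γ)

noncomputable instance : (HoFac.quot.{uk, uR, uA, x} 𝓐 a W).CommShift Γ :=
  inferInstanceAs ((CategoryTheory.Quotient.functor (homRel 𝓐 a W)).CommShift Γ)

/-- The action on the homotopy category is given by twists. -/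
noncomputable def shiftIsoTwist :
    shiftFunctor (HoFac.{uk, uR, uA, x} 𝓐 a W) γ ≅ (twist 𝓐 a (γ : A)).ho W :=
  CategoryTheory.Quotient.natIsoLift _ (((HoFac.quot 𝓐 a W).commShiftIso γ).symm ≪≫
    Iso.refl ((twist 𝓐 a (γ : A)).fac W ⋙ HoFac.quot 𝓐 a W))

instance : (shiftFunctor (HoFac.{uk, uR, uA, x} 𝓐 a W) γ).Additive := inferInstance

instance : (shiftFunctor (HoFac.{uk, uR, uA, x} 𝓐 a W) γ).Linear k := inferInstance

lemma trW_shift {E F : HoFac.{uk, uR, uA, x} 𝓐 a W} {f : E ⟶ F} (hf : (acyclic 𝓐 a W).trW f) :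
    (acyclic 𝓐 a W).trW (f⟦γ⟧') :=
  ((acyclic 𝓐 a W).trW.arrow_mk_iso_iff
    (Arrow.isoMk ((shiftIsoTwist γ).app E) ((shiftIsoTwist γ).app F)
      ((shiftIsoTwist γ).hom.naturality f).symm)).2 ((twist 𝓐 a (γ : A)).trW_map hf)

instance : (acyclic.{uk, uR, uA, x} 𝓐 a W).trW.IsCompatibleWithShift Γ where
  condition γ := by
    ext E F f
    refine ⟨fun hf => ?_, fun hf => trW_shift γ hf⟩
    have h := trW_shift (-γ) hf
    exact ((acyclic 𝓐 a W).trW.arrow_mk_iso_iff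
      (Arrow.isoMk ((shiftFunctorCompIsoId _ γ (-γ) (add_neg_cancel γ)).app E)
        ((shiftFunctorCompIsoId _ γ (-γ) (add_neg_cancel γ)).app F)
        ((shiftFunctorCompIsoId _ γ (-γ) (add_neg_cancel γ)).hom.naturality f).symm)).1 h

instance : (shiftFunctor (DAbs.{uk, uR, uA, x} 𝓐 a W) γ).Additive := by
  rw [Localization.functor_additive_iff (loc 𝓐 a W) (acyclic 𝓐 a W).trW]
  exact Functor.additive_of_iso ((loc 𝓐 a W).commShiftIso γ)

instance : (shiftFunctor (DAbs.{uk, uR, uA, x} 𝓐 a W) γ).Linear k := inferInstance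

end Action

section Orbit

universe v u w v' u'

/-- The orbit category of a category `C` by an additive group `Γ` acting on `C`: it has the same
objects, and the morphisms from `X` to `Y` are `⨁ γ, Hom(X, γ Y)`. -/
structure Orbit (C : Type u) (Γ : Type w) where
  /-- the underlying object -/
  as : C

variable {C : Type u} [Category.{v} C] [Preadditive C] {Γ : Type w} [AddGroup Γ] [HasShift C Γ]
  [∀ γ : Γ, (shiftFunctor C γ).Additive]

namespace Orbit

/-- The composition of `f : X ⟶ γ Y` and `g : Y ⟶ δ Z`, as a biadditive map. -/
noncomputable def homogComp (X Y Z : C) (γ δ : Γ) :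
    ShiftedHom X Y γ →+ ShiftedHom Y Z δ →+ ShiftedHom X Z (δ + γ) :=
  AddMonoidHom.mk' (fun f => AddMonoidHom.mk' (fun g => f.comp g rfl)
    (fun g g' => ShiftedHom.comp_add f g g' rfl))
    (fun f f' => AddMonoidHom.ext fun g => ShiftedHom.add_comp f f' g rfl)

open Classical in
/-- The composition of morphisms in the orbit category, as a biadditive map. -/
noncomputable def compHom (X Y Z : C) :
    (DirectSum Γ fun γ => ShiftedHom X Y γ) →+ (DirectSum Γ fun γ => ShiftedHom Y Z γ) →+
      DirectSum Γ fun γ => ShiftedHom X Z γ :=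
  DirectSum.toAddMonoid fun γ => AddMonoidHom.flip <| DirectSum.toAddMonoid fun δ =>
    AddMonoidHom.flip <| (AddMonoidHom.compHom
      (DirectSum.of (fun ε => ShiftedHom X Z ε) (δ + γ))).comp (homogComp X Y Z γ δ)

open Classical in
lemma compHom_of {X Y Z : C} {γ δ ε : Γ} (f : ShiftedHom X Y γ) (g : ShiftedHom Y Z δ)
    (h : δ + γ = ε) :
    compHom X Y Z (DirectSum.of (fun γ => ShiftedHom X Y γ) γ f)
      (DirectSum.of (fun γ => ShiftedHom Y Z γ) δ g) =
      DirectSum.of (fun γ => ShiftedHom X Z γ) ε (f.comp g h) := by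
  subst h
  rw [compHom, DirectSum.toAddMonoid_of, AddMonoidHom.flip_apply, DirectSum.toAddMonoid_of]
  rfl

open Classical in
noncomputable instance : Category (Orbit C Γ) where
  Hom X Y := DirectSum Γ fun γ => ShiftedHom X.as Y.as γ
  id X := DirectSum.of (fun γ => ShiftedHom X.as X.as γ) 0 (ShiftedHom.mk₀ 0 rfl (𝟙 X.as))
  comp {X Y Z} f g := compHom X.as Y.as Z.as f g
  id_comp {X Y} f := by
    induction f using DirectSum.induction_on with
    | zero => rw [map_zero]
    | of γ f => rw [compHom_of _ _ (add_zero γ), ShiftedHom.mk₀_id_comp]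
    | add f g hf hg => rw [map_add, hf, hg]
  comp_id {X Y} f := by
    induction f using DirectSum.induction_on with
    | zero => rw [map_zero, AddMonoidHom.zero_apply]
    | of γ f => rw [compHom_of _ _ (zero_add γ), ShiftedHom.comp_mk₀_id]
    | add f g hf hg => rw [map_add, AddMonoidHom.add_apply, hf, hg]
  assoc {X Y Z T} f g h := by
    induction f using DirectSum.induction_on with
    | zero => simp only [map_zero, AddMonoidHom.zero_apply]
    | add f f' hf hf' => simp only [map_add, AddMonoidHom.add_apply, hf, hf']
    | of α f =>
    induction g using DirectSum.induction_on with
    | zero => simp only [map_zero, AddMonoidHom.zero_apply]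
    | add g g' hg hg' => simp only [map_add, AddMonoidHom.add_apply, hg, hg']
    | of β g =>
    induction h using DirectSum.induction_on with
    | zero => simp only [map_zero]
    | add h h' hh hh' => simp only [map_add, hh, hh']
    | of γ h =>
    rw [compHom_of f g rfl, compHom_of g h rfl, compHom_of (f.comp g rfl) h (add_assoc γ β α).symm,
      compHom_of f (g.comp h rfl) rfl, ShiftedHom.comp_assoc f g h rfl rfl rfl]

noncomputable instance : Preadditive (Orbit C Γ) where
  homGroup X Y := inferInstanceAs (AddCommGroup (DirectSum Γ fun γ => ShiftedHom X.as Y.as γ))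
  add_comp X Y Z f f' g :=
    DFunLike.congr_fun ((compHom (Γ := Γ) X.as Y.as Z.as).map_add f f') g
  comp_add X Y Z f g g' := (compHom (Γ := Γ) X.as Y.as Z.as f).map_add g g'

section Linear

variable (k : Type*) [CommRing k] [Linear k C]

open Classical in
lemma smul_compHom {X Y Z : C} (r : k) (f : DirectSum Γ fun γ => ShiftedHom X Y γ)
    (g : DirectSum Γ fun γ => ShiftedHom Y Z γ) :
    compHom X Y Z (r • f) g = r • compHom X Y Z f g := by
  induction f using DirectSum.induction_on with
  | zero => simp only [smul_zero, map_zero, AddMonoidHom.zero_apply]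
  | add f f' hf hf' => simp only [smul_add, map_add, AddMonoidHom.add_apply, hf, hf']
  | of γ f =>
  induction g using DirectSum.induction_on with
  | zero => simp only [smul_zero, map_zero]
  | add g g' hg hg' => simp only [smul_add, map_add, hg, hg']
  | of δ g =>
  have e (γ : Γ) (Y : C) (f : ShiftedHom X Y γ) :
      r • DirectSum.of (fun γ => ShiftedHom X Y γ) γ f = DirectSum.of _ γ (r • f) :=
    ((DirectSum.lof k Γ (fun γ => ShiftedHom X Y γ) γ).map_smul r f).symm
  rw [e, compHom_of _ _ rfl, compHom_of _ _ rfl, e]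
  congr 1
  exact Linear.smul_comp _ _ _ _ _ _

variable [∀ γ : Γ, (shiftFunctor C γ).Linear k]

open Classical in
lemma compHom_smul {X Y Z : C} (r : k) (f : DirectSum Γ fun γ => ShiftedHom X Y γ)
    (g : DirectSum Γ fun γ => ShiftedHom Y Z γ) :
    compHom X Y Z f (r • g) = r • compHom X Y Z f g := by
  induction f using DirectSum.induction_on with
  | zero => simp only [smul_zero, map_zero, AddMonoidHom.zero_apply]
  | add f f' hf hf' => simp only [smul_add, map_add, AddMonoidHom.add_apply, hf, hf']
  | of γ f =>
  induction g using DirectSum.induction_on with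
  | zero => simp only [smul_zero, map_zero]
  | add g g' hg hg' => simp only [smul_add, map_add, hg, hg']
  | of δ g =>
  have e (X : C) (γ : Γ) (f : ShiftedHom X Z γ) :
      r • DirectSum.of (fun γ => ShiftedHom X Z γ) γ f = DirectSum.of _ γ (r • f) :=
    ((DirectSum.lof k Γ (fun γ => ShiftedHom X Z γ) γ).map_smul r f).symm
  rw [e, compHom_of _ _ rfl, compHom_of _ _ rfl, e]
  congr 1
  rw [ShiftedHom.comp, ShiftedHom.comp, Functor.map_smul, Linear.smul_comp, Linear.comp_smul]

noncomputable instance : Linear k (Orbit C Γ) where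
  homModule X Y := inferInstanceAs (Module k (DirectSum Γ fun γ => ShiftedHom X.as Y.as γ))
  smul_comp _ _ _ r f g := smul_compHom k r f g
  comp_smul _ _ _ f r g := compHom_smul k r f g

end Linear

open Classical in
variable (C Γ) in
/-- The natural functor to the orbit category. -/
noncomputable def toOrbit : C ⥤ Orbit C Γ where
  obj X := ⟨X⟩
  map {X Y} f := DirectSum.of (fun γ : Γ => ShiftedHom X Y γ) 0 (ShiftedHom.mk₀ 0 rfl f)
  map_id _ := rfl
  map_comp {X Y Z} f g := by
    refine (congrArg _ ?_).trans (compHom_of (ShiftedHom.mk₀ (0 : Γ) rfl f)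
      (ShiftedHom.mk₀ (0 : Γ) rfl g) (add_zero 0)).symm
    rw [ShiftedHom.mk₀_comp_mk₀]

end Orbit

variable (k : Type*) [CommRing k] [Linear k C] [∀ γ : Γ, (shiftFunctor C γ).Linear k]
  [HasZeroObject C] [HasShift C ℤ] [∀ n : ℤ, (shiftFunctor C n).Additive] [Pretriangulated C]
  {D : Type u'} [Category.{v'} D] [Preadditive D] [Linear k D]
  [HasZeroObject D] [HasShift D ℤ] [∀ n : ℤ, (shiftFunctor D n).Additive] [Pretriangulated D]

variable (Γ) in
/-- The functor `F : C ⥤ D` of `k`-linear triangulated categories is a `Γ`-cover, where `Γ` is a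
finitely generated group acting on `C`. -/
structure IsCover (F : C ⥤ D) : Prop where
  /-- `Γ` is finitely generated -/
  fg : AddGroup.FG Γ
  /-- `Γ` acts by exact autoequivalences -/
  exact_action : ∀ γ : Γ, ∃ _ : (shiftFunctor C γ).CommShift ℤ, (shiftFunctor C γ).IsTriangulated
  /-- `F` identifies the orbit category with a full subcategory of `D` -/
  orbit : ∃ ι : Orbit C Γ ⥤ D, ι.Full ∧ ι.Faithful ∧ ∃ _ : ι.Additive, ι.Linear k ∧
    Nonempty (Orbit.toOrbit C Γ ⋙ ι ≅ F)
  /-- `F` is exact -/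
  exact : ∃ _ : F.CommShift ℤ, F.IsTriangulated
  /-- every object of `D` is a direct summand of an object in the image of `F` -/
  dense : ∀ Y : D, ∃ X : C, Nonempty (Retract Y (F.obj X))

end Orbit

end GradedFact

/-! Write π : A → B for the quotient map, with kernel Γ. Restriction along π has a right adjoint on
graded modules, induction, with (ind N)_c = N_{π c}. Concretely, an element of ind N is a finitely
supported family whose entry at c has degree π c, and a ring element r of degree d multiplies the
entries by r and moves them from c to c + d. Finiteness of Γ keeps ind N finitely generated
(`indModule_finite`). A map of degree π d, with a chosen lift d, induces a map of degree d. Since w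
is homogeneous of degree a in A, this applies to both structure maps of a factorization and to
null-homotopies. Induction is computed entrywise, so it is exact and commutes with cones. Hence it
maps totalizations of short exact sequences to such totalizations (`ShortExact.ind`, `indTotalIso`),
and it descends, together with the adjunction, to the absolute derived categories (`resAdj`).

Two computations give the theorem. The first is ind (res F) = ⨁ F(γ) over γ in Γ, because the part
of res F in degree π c is the sum of the F_{c + γ} (`isOrbitSum_coarsen`). By adjunction Hom(res E,
res F) = Hom(E, ind (res F)) = ⨁ Hom(E, F(γ)), which is the morphism group of the orbit category
(`Invariant.orbitHom_bijective`).

To turn this bijection into a functor one needs isomorphisms res (E(γ)) ≅ res E that are coherent in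
γ. Before localization they are equalities, since a twist by γ in Γ only permutes the summands of a
coarse degree (`Regrade.twist_trans_coarsen`). The coherence is carried to the derived category by
`Invariant.ofComp`, and `Invariant.orbitFunctor` is the resulting functor.

The second computation is that the map N → res (ind N) repeating each homogeneous component,
followed by the counit, is multiplication by the order of Γ (`diag_counitApp`). In characteristic 0
this is invertible, so every object is a direct summand of a restriction (`exists_retract_res`).
Exactness of restriction and of the twists is inherited from the homotopy categories. -/

namespace GradedFact

open CategoryTheory Limits

/-! ### Homogeneous components of elements of a graded module -/

section Components

variable {k : Type uk} [CommRing k] {R : Type uR} [CommRing R] [Algebra k R]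
  {A : Type uA} [AddCommGroup A]

namespace GrMod

variable {𝓐 : A → Submodule k R}

lemma exists_components (M : GrMod.{uk, uR, uA, x} 𝓐) (m : M) :
    ∃ f : A →₀ M, (∀ c, f c ∈ M.gr c) ∧ (f.sum fun _ y => y) = m := by
  have hm : m ∈ ⨆ c, M.gr c := by
    rw [M.iSup_gr]
    exact Submodule.mem_top
  obtain ⟨f, hf, h⟩ := (Submodule.mem_iSup_iff_exists_finsupp _ _).1 hm
  exact ⟨f, hf, h⟩

/-- Independence of the graded pieces, applied to the finite family f - g, whose entries add up to
zero. -/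
lemma components_unique (M : GrMod.{uk, uR, uA, x} 𝓐) {f g : A →₀ M} (hf : ∀ c, f c ∈ M.gr c)
    (hg : ∀ c, g c ∈ M.gr c) (h : (f.sum fun _ y => y) = g.sum fun _ y => y) : f = g := by
  classical
  have hi := (iSupIndep_iff_finsetSum_eq_zero_imp_eq_zero _).1 M.indep
  have h0 : ((f - g).sum fun _ y => y) = 0 := by
    rw [Finsupp.sum_sub_index (fun _ _ _ => rfl), h, sub_self]
  refine sub_eq_zero.1 (Finsupp.ext fun c => ?_)
  by_contra hc
  exact hc (hi (f - g).support (f - g) (fun c _ => sub_mem (hf c) (hg c)) h0 c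
    (Finsupp.mem_support_iff.2 hc))

/-- The homogeneous components of an element of a graded module. -/
noncomputable def comp (M : GrMod.{uk, uR, uA, x} 𝓐) : M →ₗ[k] (A →₀ M) where
  toFun m := (M.exists_components m).choose
  map_add' m n := by
    have hm := (M.exists_components m).choose_spec
    have hn := (M.exists_components n).choose_spec
    have hmn := (M.exists_components (m + n)).choose_spec
    refine M.components_unique hmn.1 (fun c => add_mem (hm.1 c) (hn.1 c)) ?_
    rw [hmn.2, Finsupp.sum_add_index' (fun _ => rfl) (fun _ _ _ => rfl), hm.2, hn.2]
  map_smul' r m := by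
    have hm := (M.exists_components m).choose_spec
    have hrm := (M.exists_components (r • m)).choose_spec
    refine M.components_unique hrm.1 (fun c => Submodule.smul_mem _ r (hm.1 c)) ?_
    rw [hrm.2, RingHom.id_apply, Finsupp.sum_smul_index' (fun _ => rfl), ← Finsupp.smul_sum, hm.2]

lemma comp_mem (M : GrMod.{uk, uR, uA, x} 𝓐) (m : M) (c : A) : M.comp m c ∈ M.gr c :=
  (M.exists_components m).choose_spec.1 c

lemma sum_comp (M : GrMod.{uk, uR, uA, x} 𝓐) (m : M) : ((M.comp m).sum fun _ y => y) = m :=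
  (M.exists_components m).choose_spec.2

lemma comp_eq (M : GrMod.{uk, uR, uA, x} 𝓐) {m : M} {f : A →₀ M} (hf : ∀ c, f c ∈ M.gr c)
    (h : (f.sum fun _ y => y) = m) : M.comp m = f :=
  M.components_unique (M.comp_mem m) hf ((M.sum_comp m).trans h.symm)

lemma comp_of_mem (M : GrMod.{uk, uR, uA, x} 𝓐) {m : M} {c : A} (hm : m ∈ M.gr c) :
    M.comp m = Finsupp.single c m := by
  classical
  refine M.comp_eq (fun d => ?_) (Finsupp.sum_single_index rfl)
  rw [Finsupp.single_apply]
  split_ifs with h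
  · exact h ▸ hm
  · exact zero_mem _

lemma comp_same (M : GrMod.{uk, uR, uA, x} 𝓐) {m : M} {c : A} (hm : m ∈ M.gr c) :
    M.comp m c = m := by
  rw [M.comp_of_mem hm, Finsupp.single_eq_same]

lemma comp_of_ne (M : GrMod.{uk, uR, uA, x} 𝓐) {m : M} {c d : A} (hm : m ∈ M.gr c) (h : d ≠ c) :
    M.comp m d = 0 := by
  rw [M.comp_of_mem hm, Finsupp.single_eq_of_ne h]

/-- Induction over homogeneous elements. -/
lemma homog_induction (M : GrMod.{uk, uR, uA, x} 𝓐) {P : M → Prop} (m : M)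
    (h : ∀ c, ∀ y ∈ M.gr c, P y) (h₀ : P 0) (hadd : ∀ y z, P y → P z → P (y + z)) : P m := by
  have hm : m ∈ ⨆ c, M.gr c := by
    rw [M.iSup_gr]
    exact Submodule.mem_top
  exact Submodule.iSup_induction _ (motive := P) hm h h₀ hadd

/-- Both sides are additive in m, so m may be taken homogeneous; there the claim says that
translation by d is injective on degrees. -/
lemma comp_map {M N : GrMod.{uk, uR, uA, x} 𝓐} (f : M →ₗ[R] N) (d : A)
    (hf : ∀ c, ∀ m ∈ M.gr c, f m ∈ N.gr (c + d)) (m : M) (c : A) :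
    N.comp (f m) (c + d) = f (M.comp m c) := by
  induction m using M.homog_induction with
  | h₀ => simp
  | hadd y z hy hz => simp only [map_add, Finsupp.add_apply, hy, hz]
  | h b y hy =>
    by_cases h : c = b
    · subst h
      rw [N.comp_same (hf _ _ hy), M.comp_same hy]
    · rw [N.comp_of_ne (hf _ _ hy) (fun e => h (add_right_cancel e)), M.comp_of_ne hy h, map_zero]

lemma comp_smul (M : GrMod.{uk, uR, uA, x} 𝓐) {d : A} {r : R} (hr : r ∈ 𝓐 d) (m : M) (c : A) :
    M.comp (r • m) (c + d) = r • M.comp m c :=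
  comp_map (LinearMap.lsmul R M r) d
    (fun c m hm => by rw [add_comm]; exact M.smul_mem hr hm) m c

lemma comp_smul' (M : GrMod.{uk, uR, uA, x} 𝓐) {d : A} {r : R} (hr : r ∈ 𝓐 d) (m : M) (c : A) :
    M.comp (r • m) c = r • M.comp m (c - d) := by
  rw [← M.comp_smul hr, sub_add_cancel]

/-- Components are chosen separately for each graded module, so those of the twist have to be
compared with the shifted ones on homogeneous elements. -/
lemma comp_tw (M : GrMod.{uk, uR, uA, x} 𝓐) (d : A) (m : M) (c : A) :
    (M.tw d).comp m c = M.comp m (c + d) := by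
  induction m using M.homog_induction with
  | h₀ => rw [map_zero, map_zero]; rfl
  | hadd y z hy hz =>
    exact (DFunLike.congr_fun (map_add (M.tw d).comp y z) c).trans ((congrArg₂ (· + ·) hy hz).trans
      (DFunLike.congr_fun (map_add M.comp y z) (c + d)).symm)
  | h b y hy =>
    have hy' : y ∈ (M.tw d).gr (b - d) := by
      change y ∈ M.gr (b - d + d)
      rwa [sub_add_cancel]
    by_cases h : c + d = b
    · subst h
      rw [M.comp_same hy]
      refine (M.tw d).comp_same ?_
      exact hy
    · rw [M.comp_of_ne hy h]
      exact (M.tw d).comp_of_ne hy' (fun e => h (by rw [e, sub_add_cancel]))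

end GrMod

end Components

/-! ### Induction of graded modules along a homomorphism with finite kernel -/

section Induction

variable {k : Type uk} [CommRing k] {R : Type uR} [CommRing R] [Algebra k R]
  {A : Type uA} [AddCommGroup A] {B : Type uB} [AddCommGroup B]

lemma iSup_grading (𝓐 : A → Submodule k R) [DecidableEq A] [GradedAlgebra 𝓐] : ⨆ c, 𝓐 c = ⊤ :=
  (DirectSum.Decomposition.isInternal 𝓐).submodule_iSup_eq_top

namespace GrMod

variable {𝓐 : A → Submodule k R} {π : A →+ B}

/-- The finitely supported families `f` on `A` with `f c` homogeneous of degree `π c`. -/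
def indSub (π : A →+ B) {𝓑 : B → Submodule k R} (M : GrMod.{uk, uR, uB, x} 𝓑) :
    Submodule k (A →₀ M) where
  carrier := {f | ∀ c, f c ∈ M.gr (π c)}
  add_mem' hf hg c := add_mem (hf c) (hg c)
  zero_mem' _ := zero_mem _
  smul_mem' r _ hf c := Submodule.smul_mem _ r (hf c)

/-- A linear map of degree `d` shifts and maps the families. -/
noncomputable def indMapₗ {𝓑 : B → Submodule k R} {M N : GrMod.{uk, uR, uB, x} 𝓑} (d : A)
    (f : M →ₗ[R] N) (hf : ∀ c, ∀ m ∈ M.gr c, f m ∈ N.gr (c + π d)) :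
    indSub π M →ₗ[k] indSub π N :=
  LinearMap.restrict
    ((Finsupp.mapRange.linearMap (f.restrictScalars k)).comp
      (Finsupp.domLCongr (R := k) (M := M) (Equiv.addRight d)).toLinearMap)
    -- The entry that arrives at c comes from c - d, and π (c - d) + π d = π c.
    (fun x hx c => by
      have := hf _ _ (hx (c - d))
      rw [← map_add, sub_add_cancel] at this
      simpa [sub_eq_add_neg] using this)

lemma indMapₗ_apply {𝓑 : B → Submodule k R} {M N : GrMod.{uk, uR, uB, x} 𝓑} (d : A)
    (f : M →ₗ[R] N) (hf : ∀ c, ∀ m ∈ M.gr c, f m ∈ N.gr (c + π d)) (y : indSub π M) (c : A) :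
    (indMapₗ d f hf y).1 c = f (y.1 (c - d)) := by
  change f (Finsupp.domLCongr (R := k) (M := M) (Equiv.addRight d) y.1 c) = _
  simp [sub_eq_add_neg]

lemma smul_mem_coarse (M : GrMod.{uk, uR, uB, x} (coarse π 𝓐)) {d : A} {r : R} (hr : r ∈ 𝓐 d)
    (c : B) (m : M) (hm : m ∈ M.gr c) : r • m ∈ M.gr (c + π d) := by
  rw [add_comm]
  exact M.smul_mem (le_coarse π 𝓐 d hr) hm

/-- The action of homogeneous ring elements on the families. -/
noncomputable def indSMul (M : GrMod.{uk, uR, uB, x} (coarse π 𝓐)) (d : A) :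
    𝓐 d →ₗ[k] Module.End k (indSub π M) where
  toFun r := indMapₗ d (LinearMap.lsmul R M r.1) (smul_mem_coarse M r.2)
  map_add' r s := LinearMap.ext fun y => Subtype.ext <| Finsupp.ext fun c => by
    refine (indMapₗ_apply _ _ _ _ _).trans ((add_smul r.1 s.1 _).trans ?_)
    exact congrArg₂ (· + ·) (indMapₗ_apply d (LinearMap.lsmul R M r.1) (smul_mem_coarse M r.2)
      y c).symm
      (indMapₗ_apply d (LinearMap.lsmul R M s.1) (smul_mem_coarse M s.2) y c).symm
  map_smul' r s := LinearMap.ext fun y => Subtype.ext <| Finsupp.ext fun c => by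
    refine (indMapₗ_apply _ _ _ _ _).trans ((smul_assoc r s.1 _).trans ?_)
    exact congrArg (r • ·)
      (indMapₗ_apply d (LinearMap.lsmul R M s.1) (smul_mem_coarse M s.2) y c).symm

/-- The action is not entrywise: a homogeneous element also moves entries by its degree. It is
therefore defined degree by degree and extended to R through the decomposition of ring elements. -/
lemma indSMul_apply (M : GrMod.{uk, uR, uB, x} (coarse π 𝓐)) {d : A} (r : 𝓐 d) (y : indSub π M)
    (c : A) : (indSMul M d r y).1 c = r.1 • y.1 (c - d) :=
  indMapₗ_apply _ _ (smul_mem_coarse M r.2) _ _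

/-- A fibre is empty or a coset of the kernel. -/
lemma finite_fiber [Finite π.ker] (b : B) : {c | π c = b}.Finite := by
  by_cases h : ∃ c₀, π c₀ = b
  · obtain ⟨c₀, rfl⟩ := h
    refine ((Set.toFinite (π.ker : Set A)).image (· + c₀)).subset fun c hc => ?_
    refine ⟨c - c₀, ?_, sub_add_cancel _ _⟩
    change π (c - c₀) = 0
    rw [map_sub, (show π c = π c₀ from hc), sub_self]
  · refine Set.Finite.subset Set.finite_empty fun c hc => (h ⟨c, hc⟩).elim

variable [DecidableEq A]

/-- The family with a single nonzero entry. -/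
noncomputable def indSingle (M : GrMod.{uk, uR, uB, x} (coarse π 𝓐)) (c : A) (m : M)
    (hm : m ∈ M.gr (π c)) : indSub π M :=
  ⟨Finsupp.single c m, fun d => by
    rw [Finsupp.single_apply]
    split_ifs with h
    · exact h ▸ hm
    · exact zero_mem _⟩

/-- One entry is split off at a time. What remains still has entries of the right degrees, because
its entry at the removed index is zero. -/
lemma indSub_induction (M : GrMod.{uk, uR, uB, x} (coarse π 𝓐)) {P : indSub π M → Prop}
    (y : indSub π M) (h : ∀ c m hm, P (indSingle M c m hm)) (h₀ : P 0)
    (hadd : ∀ y z, P y → P z → P (y + z)) : P y := by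
  obtain ⟨f, hf⟩ := y
  induction f using Finsupp.induction with
  | zero => exact h₀
  | single_add c m f hc hm ih =>
    have h₁ (d : A) (hd : d ≠ c) : Finsupp.single c m d = 0 := Finsupp.single_eq_of_ne hd
    have h₂ : m ∈ M.gr (π c) := by
      have := hf c
      rwa [Finsupp.add_apply, Finsupp.single_eq_same, Finsupp.notMem_support_iff.1 hc,
        add_zero] at this
    have h₃ (d : A) : f d ∈ M.gr (π d) := by
      by_cases hd : d = c
      · rw [hd, Finsupp.notMem_support_iff.1 hc]
        exact zero_mem _
      · have := hf d
        rwa [Finsupp.add_apply, h₁ d hd, zero_add] at this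
    exact hadd _ _ (h c m h₂) (ih h₃)

variable [GradedAlgebra 𝓐]

/-- With `indSMul_mul`, this is the multiplicativity needed to assemble the graded pieces of the
action into an algebra homomorphism. -/
lemma indSMul_one (M : GrMod.{uk, uR, uB, x} (coarse π 𝓐)) :
    indSMul M 0 (GradedMonoid.GOne.one (A := fun c => 𝓐 c)) = 1 :=
  LinearMap.ext fun y => Subtype.ext <| Finsupp.ext fun c => by
    rw [indSMul_apply, sub_zero]
    exact one_smul R _

lemma indSMul_mul (M : GrMod.{uk, uR, uB, x} (coarse π 𝓐)) {i j : A} (r : 𝓐 i) (s : 𝓐 j) :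
    indSMul M (i + j) (GradedMonoid.GMul.mul (A := fun c => 𝓐 c) r s) =
      indSMul M i r * indSMul M j s :=
  LinearMap.ext fun y => Subtype.ext <| Finsupp.ext fun c => by
    rw [Module.End.mul_apply, indSMul_apply, indSMul_apply, indSMul_apply, ← sub_sub]
    exact mul_smul r.1 s.1 _

/-- The action of the ring on the families, as an algebra homomorphism. -/
noncomputable def indAct (M : GrMod.{uk, uR, uB, x} (coarse π 𝓐)) :
    R →ₐ[k] Module.End k (indSub π M) :=
  (DirectSum.toAlgebra k (fun c => 𝓐 c) (indSMul M) (indSMul_one M) (indSMul_mul M)).comp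
    (DirectSum.decomposeAlgEquiv 𝓐).toAlgHom

lemma indAct_apply (M : GrMod.{uk, uR, uB, x} (coarse π 𝓐)) {d : A} {r : R} (hr : r ∈ 𝓐 d)
    (y : indSub π M) (c : A) : (indAct M r y).1 c = r • y.1 (c - d) := by
  have : indAct M r = indSMul M d ⟨r, hr⟩ := by
    change DirectSum.toAlgebra k (fun c => 𝓐 c) (indSMul M) (indSMul_one M) (indSMul_mul M)
      (DirectSum.decompose 𝓐 r) = _
    rw [DirectSum.decompose_of_mem 𝓐 hr]
    exact DirectSum.toSemiring_of (fun c => (indSMul M c).toAddMonoidHom) (indSMul_one M)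
      (indSMul_mul M) _ _
  rw [this, indSMul_apply]

/-- The action of the ring on the families. -/
noncomputable abbrev indModule (M : GrMod.{uk, uR, uB, x} (coarse π 𝓐)) :
    Module R (indSub π M) :=
  Module.compHom _ (indAct M).toRingHom

/-- The homogeneous families. -/
def indGr (M : GrMod.{uk, uR, uB, x} (coarse π 𝓐)) (c : A) : Submodule k (indSub π M) where
  carrier := {y | ∀ d, d ≠ c → y.1 d = 0}
  add_mem' {y z} hy hz d hd := by
    change y.1 d + z.1 d = 0
    rw [hy d hd, hz d hd, add_zero]
  zero_mem' _ _ := rfl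
  smul_mem' r y hy d hd := by
    change r • y.1 d = 0
    rw [hy d hd, smul_zero]

lemma indAct_single (M : GrMod.{uk, uR, uB, x} (coarse π 𝓐)) {d : A} {r : R} (hr : r ∈ 𝓐 d)
    (c : A) (m : M) (hm : m ∈ M.gr (π c)) (h) :
    indAct M r (indSingle M c m hm) = indSingle M (c + d) (r • m) h := by
  refine Subtype.ext (Finsupp.ext fun e => ?_)
  rw [indAct_apply M hr]
  change r • Finsupp.single c m _ = Finsupp.single (c + d) (r • m) e
  by_cases he : e = c + d
  · subst he
    rw [add_sub_cancel_right, Finsupp.single_eq_same, Finsupp.single_eq_same]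
  · rw [Finsupp.single_eq_of_ne he, Finsupp.single_eq_of_ne, smul_zero]
    rintro rfl
    exact he (sub_add_cancel _ _).symm

/-- Take finitely many generators g of M, split them into homogeneous components, and place the
component of degree b at every index c over b. The fibres of π are finite, so this is a finite set,
and it generates. -/
lemma indModule_finite [Finite π.ker] (M : GrMod.{uk, uR, uB, x} (coarse π 𝓐)) :
    @Module.Finite R (indSub π M) _ _ (indModule M) := by
  let := indModule M
  obtain ⟨s, hs⟩ := M.finite
  let t : Set (indSub π M) := {y | ∃ g ∈ s, ∃ c, π c ∈ (M.comp g).support ∧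
    y = indSingle M c (M.comp g (π c)) (M.comp_mem g _)}
  have ht : t.Finite := by
    have : t ⊆ ⋃ g ∈ s, ⋃ b ∈ (M.comp g).support,
        (fun c => indSingle M c (M.comp g (π c)) (M.comp_mem g _)) '' {c | π c = b} := by
      rintro y ⟨g, hg, c, hc, rfl⟩
      simp only [Set.mem_iUnion]
      exact ⟨g, hg, π c, hc, c, rfl, rfl⟩
    refine Set.Finite.subset ?_ this
    exact s.finite_toSet.biUnion fun g _ =>
      (M.comp g).support.finite_toSet.biUnion fun b _ => (finite_fiber b).image _
  -- The index c is quantified inside the induction, since multiplication by an element of degree d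
  -- relates the index c to c - d.
  have key (m : M) : ∀ c, indSingle M c (M.comp m (π c)) (M.comp_mem m _) ∈ Submodule.span R t := by
    have hm : m ∈ Submodule.span R (s : Set M) := by
      rw [hs]
      exact Submodule.mem_top
    induction hm using Submodule.span_induction with
    | mem g hg =>
      intro c
      by_cases hc : π c ∈ (M.comp g).support
      · exact Submodule.subset_span ⟨g, hg, c, hc, rfl⟩
      · convert zero_mem (Submodule.span R t)
        refine Subtype.ext ?_
        change Finsupp.single c _ = 0
        rw [Finsupp.notMem_support_iff.1 hc, Finsupp.single_zero]
    | zero =>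
      intro c
      convert zero_mem (Submodule.span R t)
      refine Subtype.ext ?_
      change Finsupp.single c _ = 0
      rw [map_zero, Finsupp.zero_apply, Finsupp.single_zero]
    | add m n _ _ hm hn =>
      intro c
      convert add_mem (hm c) (hn c)
      refine Subtype.ext ?_
      change Finsupp.single c _ = Finsupp.single c _ + Finsupp.single c _
      rw [map_add, Finsupp.add_apply, Finsupp.single_add]
    | smul r m _ hm =>
      intro c
      have hr : r ∈ ⨆ d, 𝓐 d := by
        rw [iSup_grading]
        exact Submodule.mem_top
      -- Reduction to r homogeneous of degree d: then the family at c built from r • m is r times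
      -- the family at c - d built from m.
      refine Submodule.iSup_induction _ (motive := fun r =>
        indSingle M c (M.comp (r • m) (π c)) (M.comp_mem _ _) ∈ Submodule.span R t) hr ?_ ?_ ?_
      · intro d r hr
        convert Submodule.smul_mem _ r (hm (c - d))
        change _ = indAct M r _
        rw [indAct_single M hr _ _ _ (by
          have := smul_mem_coarse M hr _ _ (M.comp_mem m (π (c - d)))
          rwa [← map_add] at this)]
        refine Subtype.ext ?_
        change Finsupp.single c _ = Finsupp.single (c - d + d) _
        rw [sub_add_cancel, map_sub, M.comp_smul' (le_coarse π 𝓐 d hr)]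
      · convert zero_mem (Submodule.span R t)
        refine Subtype.ext ?_
        change Finsupp.single c _ = 0
        rw [zero_smul, map_zero, Finsupp.zero_apply, Finsupp.single_zero]
      · intro r r' h h'
        convert add_mem h h'
        refine Subtype.ext ?_
        change Finsupp.single c _ = Finsupp.single c _ + Finsupp.single c _
        rw [add_smul, map_add, Finsupp.add_apply, Finsupp.single_add]
  refine ⟨ht.toFinset, ?_⟩
  rw [ht.coe_toFinset, eq_top_iff]
  rintro y -
  induction y using indSub_induction with
  | h c m hm =>
    -- An element of degree π c is its own component in that degree.
    convert key m c
    exact (M.comp_same hm).symm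
  | h₀ => exact zero_mem _
  | hadd y z hy hz => exact add_mem hy hz

variable (π) in
/-- The right adjoint of the restriction of gradings: `(ind M)_c = M_{π c}`. -/
noncomputable def ind [Finite π.ker] (M : GrMod.{uk, uR, uB, max uk uA} (coarse π 𝓐)) :
    GrMod.{uk, uR, uA, max uk uA} 𝓐 :=
  letI := indModule M
  { carrier := indSub π M
    tower := ⟨fun r s y => by
      change indAct M (r • s) y = r • indAct M s y
      rw [map_smul, LinearMap.smul_apply]⟩
    gr := indGr M
    indep := by
      rw [iSupIndep_iff_finsetSum_eq_zero_imp_eq_zero]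
      intro s v hv h i hi
      refine Subtype.ext (Finsupp.ext fun c => ?_)
      by_cases hc : c = i
      · subst hc
        have h' : (∑ j ∈ s, (v j).1) c = 0 := by
          rw [← Submodule.coe_sum, h]
          rfl
        rwa [Finsupp.finsetSum_apply, Finset.sum_eq_single c
          (fun j hj hjc => hv j hj c (Ne.symm hjc)) (fun h => (h hi).elim)] at h'
      · exact hv i hi c hc
    iSup_gr := by
      rw [eq_top_iff]
      rintro y -
      induction y using indSub_induction with
      | h c m hm =>
        refine Submodule.mem_iSup_of_mem c fun d hd => ?_
        exact Finsupp.single_eq_of_ne hd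
      | h₀ => exact zero_mem _
      | hadd y z hy hz => exact add_mem hy hz
    smul_mem := fun {i j r y} hr hy d hd => by
      change (indAct M r y).1 d = 0
      rw [indAct_apply M hr, hy, smul_zero]
      rintro rfl
      exact hd (add_sub_cancel _ _).symm
    finite := indModule_finite M }

variable [Finite π.ker]

section

variable (M : GrMod.{uk, uR, uB, max uk uA} (coarse π 𝓐))

/-- The entries of an element of `ind M`. -/
noncomputable def val : M.ind π →ₗ[k] (A →₀ M) := (indSub π M).subtype

lemma val_mem (y : M.ind π) (c : A) : M.val y c ∈ M.gr (π c) := y.2 c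

variable {M} in
lemma ind_ext {y z : M.ind π} (h : ∀ c, M.val y c = M.val z c) : y = z :=
  Subtype.ext (Finsupp.ext h)

/-- The element of `ind M` with given entries. -/
def indMk (f : A →₀ M) (hf : ∀ c, f c ∈ M.gr (π c)) : M.ind π := ⟨f, hf⟩

lemma val_smul {d : A} {r : R} (hr : r ∈ 𝓐 d) (y : M.ind π) (c : A) :
    M.val (r • y) c = r • M.val y (c - d) :=
  indAct_apply M hr y c

lemma mem_ind_gr (y : M.ind π) (c : A) : y ∈ (M.ind π).gr c ↔ ∀ d, d ≠ c → M.val y d = 0 :=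
  Iff.rfl

/-- Evaluate at d the decomposition of y into its components: each component is supported at its own
index, so only the component of degree d contributes. -/
lemma comp_ind (y : M.ind π) (c d : A) :
    M.val ((M.ind π).comp y c) d = if d = c then M.val y d else 0 := by
  have e : y = M.indMk (M.val y) (M.val_mem y) := rfl
  split_ifs with h
  · subst h
    conv_rhs => rw [← (M.ind π).sum_comp y]
    rw [Finsupp.sum, map_sum, Finsupp.finsetSum_apply]
    rw [Finset.sum_eq_single d]
    · intro b _ hb
      exact (M.ind π).comp_mem y b d (Ne.symm hb)
    · intro h
      rw [Finsupp.notMem_support_iff.1 h, map_zero, Finsupp.zero_apply]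
  · exact (M.ind π).comp_mem y c d h

end

variable {M N P : GrMod.{uk, uR, uB, max uk uA} (coarse π 𝓐)}

variable (𝓐) in
/-- A `k`-linear map that is compatible with the action of homogeneous elements is linear. -/
def linearOfHomog {X Y : Type*} [AddCommGroup X] [Module R X] [Module k X] [IsScalarTower k R X]
    [AddCommGroup Y] [Module R Y] [Module k Y] [IsScalarTower k R Y] (g : X →ₗ[k] Y)
    (h : ∀ (d : A) (r : R), r ∈ 𝓐 d → ∀ y, g (r • y) = r • g y) : X →ₗ[R] Y where
  toFun := g
  map_add' := map_add g
  map_smul' r y := by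
    have hr : r ∈ ⨆ d, 𝓐 d := by
      rw [iSup_grading]
      exact Submodule.mem_top
    refine Submodule.iSup_induction _ (motive := fun r => g (r • y) = r • g y) hr ?_ ?_ ?_
    · exact fun d r hr => h d r hr y
    · rw [zero_smul, zero_smul, map_zero]
    · intro r s hr hs
      rw [add_smul, add_smul, map_add, hr, hs]

/-- The map `ind M → ind N` of degree `d` given by a map `M → N` of degree `π d`. -/
noncomputable def indMap (d : A) (f : M →ₗ[R] N) (hf : ∀ c, ∀ m ∈ M.gr c, f m ∈ N.gr (c + π d)) :
    M.ind π →ₗ[R] N.ind π :=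
  linearOfHomog 𝓐 (X := M.ind π) (Y := N.ind π) (indMapₗ d f hf) fun e r hr y =>
    ind_ext fun c => by
      refine (indMapₗ_apply d f hf _ c).trans ?_
      refine (congrArg f (M.val_smul hr y (c - d))).trans ?_
      rw [map_smul, N.val_smul hr, sub_right_comm]
      exact congrArg (r • ·) (indMapₗ_apply d f hf y (c - e)).symm

/-- With `ind_ext`, this formula reduces identities between induced maps to identities of entries.
The shift depends on d itself and not only on π d, so a lift of the degree to A is part of the data.
-/
lemma val_indMap (d : A) (f : M →ₗ[R] N) (hf : ∀ c, ∀ m ∈ M.gr c, f m ∈ N.gr (c + π d))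
    (y : M.ind π) (c : A) : N.val (indMap d f hf y) c = f (M.val y (c - d)) :=
  indMapₗ_apply d f hf y c

lemma indMap_mem (d : A) (f : M →ₗ[R] N) (hf : ∀ c, ∀ m ∈ M.gr c, f m ∈ N.gr (c + π d)) {c : A}
    {y : M.ind π} (hy : y ∈ (M.ind π).gr c) : indMap d f hf y ∈ (N.ind π).gr (c + d) := by
  rw [mem_ind_gr] at hy ⊢
  intro e he
  rw [val_indMap, hy, map_zero]
  rintro rfl
  exact he (sub_add_cancel _ _).symm

/-- The map `ind M → ind N` given by a homogeneous map `M → N`. -/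
noncomputable def indMap₀ (f : M →ₗ[R] N) (hf : IsHomog M N f) : M.ind π →ₗ[R] N.ind π :=
  indMap 0 f fun c m hm => by
    rw [map_zero, add_zero]
    exact hf c m hm

lemma val_indMap₀ (f : M →ₗ[R] N) (hf : IsHomog M N f) (y : M.ind π) (c : A) :
    N.val (indMap₀ f hf y) c = f (M.val y c) := by
  rw [indMap₀, val_indMap, sub_zero]

lemma indMap₀_mem (f : M →ₗ[R] N) (hf : IsHomog M N f) {c : A} {y : M.ind π}
    (hy : y ∈ (M.ind π).gr c) : indMap₀ f hf y ∈ (N.ind π).gr c := by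
  have := indMap_mem 0 f (fun c m hm => by rw [map_zero, add_zero]; exact hf c m hm) hy
  rwa [add_zero] at this

end GrMod

end Induction

/-! ### Unit, counit, diagonal and projections on graded modules -/

section InductionMaps

variable {k : Type uk} [CommRing k] {R : Type uR} [CommRing R] [Algebra k R]
  {A : Type uA} [AddCommGroup A] {B : Type uB} [AddCommGroup B]
  {𝓐 : A → Submodule k R} {π : A →+ B}

namespace GrMod

/-- This turns membership in a sum over a fibre into a vanishing condition on fine components, which
can be tested entrywise in an induced module. -/
lemma mem_coarse_iff (M : GrMod.{uk, uR, uA, x} 𝓐) (m : M) (b : B) :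
    m ∈ coarse π M.gr b ↔ ∀ c, π c ≠ b → M.comp m c = 0 := by
  constructor
  · intro hm c hc
    refine coarse_induction (P := fun m => M.comp m c = 0) hm ?_ ?_ ?_
    · intro d hd y hy
      exact M.comp_of_ne hy fun h => hc (h ▸ hd)
    · rw [map_zero, Finsupp.zero_apply]
    · intro y z hy hz
      rw [map_add, Finsupp.add_apply, hy, hz, add_zero]
  · intro h
    rw [← M.sum_comp m]
    refine sum_mem fun c hc => ?_
    by_cases hb : π c = b
    · exact hb ▸ le_coarse π M.gr c (M.comp_mem m c)
    · rw [h c hb]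
      exact zero_mem _

/-- Only finitely many coarse degrees occur in m and each has a finite fibre; this makes repeating
the components along fibres a finitely supported family. -/
lemma finite_support_comp (π : A →+ B) [Finite π.ker]
    (N : GrMod.{uk, uR, uB, max uk uA} (coarse π 𝓐)) (m : N) :
    (Function.support fun c => N.comp m (π c)).Finite :=
  ((N.comp m).support.finite_toSet.biUnion fun b _ => finite_fiber (π := π) b).subset fun c hc => by
    simp only [Set.mem_iUnion]
    exact ⟨π c, Finsupp.mem_support_iff.2 hc, rfl⟩

variable [DecidableEq A] [GradedAlgebra 𝓐]

/-- A `k`-linear map on a graded module that is compatible with the action of homogeneous elements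
on homogeneous elements is linear. -/
def linearOfHomog' (X : GrMod.{uk, uR, uA, x} 𝓐) {Y : Type*} [AddCommGroup Y] [Module R Y]
    [Module k Y] [IsScalarTower k R Y] (g : X →ₗ[k] Y)
    (h : ∀ (d : A) (r : R), r ∈ 𝓐 d → ∀ c, ∀ y ∈ X.gr c, g (r • y) = r • g y) : X →ₗ[R] Y :=
  linearOfHomog 𝓐 g fun d r hr y => by
    induction y using X.homog_induction with
    | h c y hy => exact h d r hr c y hy
    | h₀ => rw [smul_zero, map_zero, smul_zero]
    | hadd y z hy hz => rw [smul_add, map_add, map_add, hy, hz, smul_add]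

variable [Finite π.ker]

lemma val_of_mem (N : GrMod.{uk, uR, uB, max uk uA} (coarse π 𝓐)) {c : A} {y : N.ind π}
    (hy : y ∈ (N.ind π).gr c) : N.val y = Finsupp.single c (N.val y c) := by
  ext d
  by_cases h : d = c
  · rw [h, Finsupp.single_eq_same]
  · rw [Finsupp.single_eq_of_ne h, (N.mem_ind_gr y c).1 hy d h]

lemma val_smul_of_mem (N : GrMod.{uk, uR, uB, max uk uA} (coarse π 𝓐)) {c d : A} {y : N.ind π}
    (hy : y ∈ (N.ind π).gr c) {r : R} (hr : r ∈ 𝓐 d) :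
    N.val (r • y) = Finsupp.single (d + c) (r • N.val y c) := by
  rw [N.val_of_mem ((N.ind π).smul_mem hr hy), N.val_smul hr, add_sub_cancel_left]

variable (π)

/-- The unit `M → ind (res M)`, which lists the homogeneous components. -/
noncomputable def unit (a : A) (M : GrMod.{uk, uR, uA, max uk uA} 𝓐) :
    M →ₗ[R] ((coarsen 𝓐 a π).mod M).ind π :=
  linearOfHomog 𝓐
    { toFun := fun m => indMk ((coarsen 𝓐 a π).mod M) (M.comp m)
        (fun c => le_coarse π M.gr c (M.comp_mem m c))
      map_add' := fun m n => Subtype.ext (map_add M.comp m n)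
      map_smul' := fun r m => Subtype.ext (map_smul M.comp r m) }
    (fun d r hr m => ind_ext fun c => by
      rw [val_smul _ hr]
      exact M.comp_smul' hr m c)

lemma val_unit (a : A) (M : GrMod.{uk, uR, uA, max uk uA} 𝓐) (m : M) :
    ((coarsen 𝓐 a π).mod M).val (M.unit π a m) = M.comp m := rfl

lemma unit_mem (a : A) (M : GrMod.{uk, uR, uA, max uk uA} 𝓐) {c : A} {m : M} (hm : m ∈ M.gr c) :
    M.unit π a m ∈ (((coarsen 𝓐 a π).mod M).ind π).gr c := by
  rw [mem_ind_gr]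
  intro d hd
  rw [val_unit]
  exact M.comp_of_ne hm hd

/-- The counit `res (ind N) → N`, which adds the entries. -/
noncomputable def counit (a : A) (N : GrMod.{uk, uR, uB, max uk uA} (coarse π 𝓐)) :
    (coarsen 𝓐 a π).mod (N.ind π) →ₗ[R] N :=
  linearOfHomog' (N.ind π) ((Finsupp.lsum k fun _ => LinearMap.id).comp N.val)
    (fun d r hr c y hy => by
      change (N.val (r • y)).sum (fun _ y => y) = r • (N.val y).sum (fun _ y => y)
      rw [N.val_smul_of_mem hy hr, N.val_of_mem hy, Finsupp.sum_single_index rfl,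
        Finsupp.sum_single_index rfl, Finsupp.single_eq_same])

lemma counit_apply (a : A) (N : GrMod.{uk, uR, uB, max uk uA} (coarse π 𝓐)) (y : N.ind π) :
    N.counit π a y = (N.val y).sum fun _ y => y := rfl

lemma counit_of_mem (a : A) (N : GrMod.{uk, uR, uB, max uk uA} (coarse π 𝓐)) {y : N.ind π} {c : A}
    (hy : y ∈ (N.ind π).gr c) : N.counit π a y = N.val y c := by
  rw [counit_apply, N.val_of_mem hy, Finsupp.sum_single_index rfl, Finsupp.single_eq_same]

lemma counit_mem (a : A) (N : GrMod.{uk, uR, uB, max uk uA} (coarse π 𝓐)) :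
    IsHomog ((coarsen 𝓐 a π).mod (N.ind π)) N (N.counit π a) := by
  intro b y hy
  refine coarse_induction (P := fun y => N.counit π a y ∈ N.gr b) hy ?_ ?_ ?_
  · rintro c rfl y hy
    rw [counit_of_mem π a N hy]
    exact N.val_mem y c
  · rw [map_zero]
    exact zero_mem _
  · intro y z hy hz
    exact (map_add (N.counit π a) y z).symm ▸ add_mem hy hz

/-- The map `N → res (ind N)` that repeats the homogeneous components. -/
noncomputable def diag (a : A) (N : GrMod.{uk, uR, uB, max uk uA} (coarse π 𝓐)) :
    N →ₗ[R] (coarsen 𝓐 a π).mod (N.ind π) :=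
  linearOfHomog 𝓐 (Y := (coarsen 𝓐 a π).mod (N.ind π))
    { toFun := fun m => N.indMk
        (Finsupp.ofSupportFinite (fun c => N.comp m (π c)) (N.finite_support_comp π m))
        (fun c => N.comp_mem m (π c))
      map_add' := fun m n => Subtype.ext <| Finsupp.ext fun c => DFunLike.congr_fun
        (map_add N.comp m n) (π c)
      map_smul' := fun r m => Subtype.ext <| Finsupp.ext fun c => DFunLike.congr_fun
        (map_smul N.comp r m) (π c) }
    (fun d r hr m => ind_ext fun c => by
      refine Eq.trans ?_ (N.val_smul hr _ c).symm
      change N.comp (r • m) (π c) = r • N.comp m (π (c - d))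
      rw [N.comp_smul' (le_coarse π 𝓐 d hr), map_sub π])

lemma val_diag (a : A) (N : GrMod.{uk, uR, uB, max uk uA} (coarse π 𝓐)) (m : N) (c : A) :
    N.val (N.diag π a m) c = N.comp m (π c) := rfl

/-- The fine component at c of the repeated family is the single entry of coarse degree π c, which
vanishes for m of degree b unless π c = b. -/
lemma diag_mem (a : A) (N : GrMod.{uk, uR, uB, max uk uA} (coarse π 𝓐)) :
    IsHomog N ((coarsen 𝓐 a π).mod (N.ind π)) (N.diag π a) := by
  intro b m hm
  refine ((N.ind π).mem_coarse_iff _ b).2 fun c hc => ind_ext fun d => ?_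
  rw [comp_ind, map_zero, Finsupp.zero_apply]
  split_ifs with h
  · subst h
    rw [val_diag, N.comp_of_ne hm hc]
  · rfl

/-- Surjectivity makes every fibre a coset of the kernel rather than possibly empty. -/
lemma ncard_fiber (hπ : Function.Surjective π) (b : B) :
    (finite_fiber (π := π) b).toFinset.card = Nat.card π.ker := by
  obtain ⟨c₀, rfl⟩ := hπ b
  have : {c | π c = π c₀} = (· + c₀) '' (π.ker : Set A) := by
    ext c
    refine ⟨fun hc => ⟨c - c₀, ?_, sub_add_cancel _ _⟩, ?_⟩
    · change π (c - c₀) = 0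
      rw [map_sub, (show π c = π c₀ from hc), sub_self]
    · rintro ⟨d, hd, rfl⟩
      change π (d + c₀) = π c₀
      rw [map_add, (show π d = 0 from hd), zero_add]
  rw [← Set.ncard_eq_toFinset_card _ (finite_fiber (π := π) (π c₀)), this,
    Set.ncard_image_of_injective _ (add_left_injective c₀)]
  rfl

/-- A homogeneous m of degree b is repeated once at each index over b, and the counit adds these
copies. -/
lemma counit_diag (hπ : Function.Surjective π) (a : A)
    (N : GrMod.{uk, uR, uB, max uk uA} (coarse π 𝓐)) (m : N) :
    N.counit π a (N.diag π a m) = Nat.card π.ker • m := by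
  induction m using N.homog_induction with
  | h₀ => rw [map_zero, map_zero, smul_zero]
  | hadd y z hy hz => rw [map_add, map_add, hy, hz, smul_add]
  | h b m hm =>
    -- The sum is taken over the whole fibre instead of the support, which is smaller when m = 0.
    rw [counit_apply, Finsupp.sum_of_support_subset (s := (finite_fiber (π := π) b).toFinset) _
      (fun c hc => ?_) _ (fun _ _ => rfl), Finset.sum_congr rfl (g := fun _ => m) (fun c hc => ?_),
      Finset.sum_const, ncard_fiber π hπ]
    · have hc : π c = b := by simpa using hc
      rw [val_diag, hc, N.comp_same hm]
    · rw [Set.Finite.mem_toFinset]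
      by_contra h
      exact Finsupp.mem_support_iff.1 hc (N.comp_of_ne hm h)

/-- The projection `ind (res M) → M(γ)`. -/
noncomputable def proj (a γ : A) (M : GrMod.{uk, uR, uA, max uk uA} 𝓐) :
    ((coarsen 𝓐 a π).mod M).ind π →ₗ[R] M.tw γ :=
  linearOfHomog' (((coarsen 𝓐 a π).mod M).ind π)
    ((Finsupp.lsum k fun c => (Finsupp.lapply (c + γ)).comp M.comp).comp
      ((coarsen 𝓐 a π).mod M).val)
    (fun d r hr c y hy => by
      change (((coarsen 𝓐 a π).mod M).val (r • y)).sum (fun c y => M.comp y (c + γ)) =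
        r • (((coarsen 𝓐 a π).mod M).val y).sum (fun c y => M.comp y (c + γ))
      have h (c : A) : M.comp 0 (c + γ) = 0 := by rw [map_zero, Finsupp.zero_apply]
      rw [val_smul_of_mem _ hy hr, val_of_mem _ hy, Finsupp.sum_single_index (h _),
        Finsupp.sum_single_index (h _), Finsupp.single_eq_same, M.comp_smul' hr]
      congr 2
      abel)

lemma proj_of_mem (a γ : A) (M : GrMod.{uk, uR, uA, max uk uA} 𝓐) {c : A}
    {y : ((coarsen 𝓐 a π).mod M).ind π} (hy : y ∈ (((coarsen 𝓐 a π).mod M).ind π).gr c) :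
    M.proj π a γ y = M.comp (((coarsen 𝓐 a π).mod M).val y c) (c + γ) := by
  change (((coarsen 𝓐 a π).mod M).val y).sum (fun c y => M.comp y (c + γ)) = _
  have h (c : A) : M.comp 0 (c + γ) = 0 := by rw [map_zero, Finsupp.zero_apply]
  rw [val_of_mem _ hy, Finsupp.sum_single_index (h _), Finsupp.single_eq_same]

lemma proj_mem (a γ : A) (M : GrMod.{uk, uR, uA, max uk uA} 𝓐) :
    IsHomog (((coarsen 𝓐 a π).mod M).ind π) (M.tw γ) (M.proj π a γ) := by
  intro c y hy
  rw [proj_of_mem π a γ M hy]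
  exact M.comp_mem _ _

section Naturality

variable {π}

section

variable {M N M' N' : GrMod.{uk, uR, uB, max uk uA} (coarse π 𝓐)}

lemma indMap₀_indMap₀ {f : M →ₗ[R] N} {g : N →ₗ[R] N'} {f' : M →ₗ[R] M'} {g' : M' →ₗ[R] N'}
    (hf : IsHomog M N f) (hg : IsHomog N N' g) (hf' : IsHomog M M' f') (hg' : IsHomog M' N' g')
    (h : ∀ m, g (f m) = g' (f' m)) (y : M.ind π) :
    indMap₀ g hg (indMap₀ f hf y) = indMap₀ g' hg' (indMap₀ f' hf' y) :=
  ind_ext fun c => by rw [val_indMap₀, val_indMap₀, val_indMap₀, val_indMap₀, h]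

lemma indMap₀_indMap {d : A} {f : M →ₗ[R] N} {g : N →ₗ[R] N'} {f' : M →ₗ[R] M'} {g' : M' →ₗ[R] N'}
    (hf : ∀ c, ∀ m ∈ M.gr c, f m ∈ N.gr (c + π d)) (hg : IsHomog N N' g) (hf' : IsHomog M M' f')
    (hg' : ∀ c, ∀ m ∈ M'.gr c, g' m ∈ N'.gr (c + π d))
    (h : ∀ m, g (f m) = g' (f' m)) (y : M.ind π) :
    indMap₀ g hg (indMap d f hf y) = indMap d g' hg' (indMap₀ f' hf' y) :=
  ind_ext fun c => by rw [val_indMap₀, val_indMap, val_indMap, val_indMap₀, h]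

lemma indMap₀_id (y : M.ind π) (h : IsHomog M M LinearMap.id) : indMap₀ LinearMap.id h y = y :=
  ind_ext fun c => by rw [val_indMap₀, LinearMap.id_apply]

lemma indMap₀_comp {f : M →ₗ[R] N} {g : N →ₗ[R] N'} (hf : IsHomog M N f) (hg : IsHomog N N' g)
    (h : IsHomog M N' (g ∘ₗ f)) (y : M.ind π) :
    indMap₀ (g ∘ₗ f) h y = indMap₀ g hg (indMap₀ f hf y) :=
  ind_ext fun c => by rw [val_indMap₀, val_indMap₀, val_indMap₀, LinearMap.comp_apply]

lemma counit_indMap (a d : A) {f : M →ₗ[R] N} (hf : ∀ c, ∀ m ∈ M.gr c, f m ∈ N.gr (c + π d))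
    (y : M.ind π) : N.counit π a (indMap d f hf y) = f (M.counit π a y) := by
  induction y using (M.ind π).homog_induction with
  | h c y hy =>
    rw [N.counit_of_mem π a (indMap_mem d f hf hy), val_indMap, M.counit_of_mem π a hy,
      add_sub_cancel_right]
  | h₀ => simp only [map_zero]
  | hadd y z hy hz => simp only [map_add, hy, hz]

lemma counit_indMap₀ (a : A) {f : M →ₗ[R] N} (hf : IsHomog M N f) (y : M.ind π) :
    N.counit π a (indMap₀ f hf y) = f (M.counit π a y) :=
  counit_indMap a 0 _ y

lemma indMap_diag (a d : A) {f : M →ₗ[R] N} (hf : ∀ c, ∀ m ∈ M.gr c, f m ∈ N.gr (c + π d))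
    (m : M) : indMap d f hf (M.diag π a m) = N.diag π a (f m) :=
  ind_ext fun c => by
    rw [val_indMap, val_diag, val_diag, ← comp_map f (π d) hf, ← map_add π, sub_add_cancel]

lemma indMap₀_diag (a : A) {f : M →ₗ[R] N} (hf : IsHomog M N f) (m : M) :
    indMap₀ f hf (M.diag π a m) = N.diag π a (f m) :=
  indMap_diag a 0 _ m

/-- A triangle identity: the unit lists the components of a family, each of which has one entry, and
the counit returns that entry. -/
lemma indMap₀_counit_unit (a : A) (y : M.ind π) :
    indMap₀ (M.counit π a) (M.counit_mem π a) ((M.ind π).unit π a y) = y :=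
  ind_ext fun c => by
    rw [val_indMap₀]
    refine (M.counit_of_mem π a ((M.ind π).comp_mem y c)).trans ?_
    rw [comp_ind, if_pos rfl]

end

variable {M N : GrMod.{uk, uR, uA, max uk uA} 𝓐}

/-- The other triangle identity: an element is the sum of its homogeneous components. -/
lemma counit_unit (a : A) (m : M) : ((coarsen 𝓐 a π).mod M).counit π a (M.unit π a m) = m :=
  M.sum_comp m

lemma indMap_unit (a d : A) {f : M →ₗ[R] N} (hf : ∀ c, ∀ m ∈ M.gr c, f m ∈ N.gr (c + d)) (h)
    (m : M) : indMap (M := (coarsen 𝓐 a π).mod M) (N := (coarsen 𝓐 a π).mod N) d f h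
      (M.unit π a m) = N.unit π a (f m) :=
  ind_ext fun c => by
    rw [val_indMap, val_unit, val_unit, ← comp_map f d hf, sub_add_cancel]

lemma indMap₀_unit (a : A) {f : M →ₗ[R] N} (hf : IsHomog M N f) (h) (m : M) :
    indMap₀ (M := (coarsen 𝓐 a π).mod M) (N := (coarsen 𝓐 a π).mod N) f h
      (M.unit π a m) = N.unit π a (f m) :=
  indMap_unit a 0 (fun c m hm => by rw [add_zero]; exact hf c m hm) _ m

lemma proj_indMap (a γ d : A) {f : M →ₗ[R] N} (hf : ∀ c, ∀ m ∈ M.gr c, f m ∈ N.gr (c + d)) (h)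
    (y : ((coarsen 𝓐 a π).mod M).ind π) :
    N.proj π a γ (indMap (M := (coarsen 𝓐 a π).mod M) (N := (coarsen 𝓐 a π).mod N) d f h y) =
      f (M.proj π a γ y) := by
  induction y using (((coarsen 𝓐 a π).mod M).ind π).homog_induction with
  | h c y hy =>
    rw [N.proj_of_mem π a γ (indMap_mem d f h hy), val_indMap, M.proj_of_mem π a γ hy,
      add_sub_cancel_right, add_right_comm]
    exact comp_map f d hf _ _
  | h₀ => simp only [map_zero]
  | hadd y z hy hz => simp only [map_add, hy, hz]

lemma proj_indMap₀ (a γ : A) {f : M →ₗ[R] N} (hf : IsHomog M N f) (h)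
    (y : ((coarsen 𝓐 a π).mod M).ind π) :
    N.proj π a γ (indMap₀ (M := (coarsen 𝓐 a π).mod M) (N := (coarsen 𝓐 a π).mod N) f h y) =
      f (M.proj π a γ y) :=
  proj_indMap a γ 0 (fun c m hm => by rw [add_zero]; exact hf c m hm) _ y

end Naturality

end GrMod

end InductionMaps

/-! ### Induction of factorizations and its adjunction with restriction -/

section InducedFactorizations

variable {k : Type uk} [CommRing k] {R : Type uR} [CommRing R] [Algebra k R]
  {A : Type uA} [AddCommGroup A] [DecidableEq A] {B : Type uB} [AddCommGroup B]
  {𝓐 : A → Submodule k R} [GradedAlgebra 𝓐] {π : A →+ B} [Finite π.ker] {a : A} {W : R}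

open GrMod Fac

namespace Fac

lemma homog₁_tw {E : Fac.{uk, uR, uB, x} (coarse π 𝓐) (π a) W} (c : B) (m : E.X₀)
    (hm : m ∈ E.X₀.gr c) : E.φ₁ m ∈ E.X₁.gr (c + π a) := E.homog₁ c m hm

/-- The factorization induced from a factorization of coarser grading. -/
noncomputable abbrev indObj (hW : W ∈ 𝓐 a) (E : Fac.{uk, uR, uB, max uk uA} (coarse π 𝓐) (π a) W) :
    Fac.{uk, uR, uA, max uk uA} 𝓐 a W where
  X₁ := E.X₁.ind π
  X₀ := E.X₀.ind π
  φ₀ := indMap₀ E.φ₀ E.homog₀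
  φ₁ := indMap a E.φ₁ homog₁_tw
  homog₀ _ _ hm := indMap₀_mem E.φ₀ E.homog₀ hm
  homog₁ _ _ hm := indMap_mem a E.φ₁ homog₁_tw hm
  -- The entry at c on either side is w times the entry of m at c - a. Here w must be homogeneous of
  -- degree a for the fine grading, so that its action shifts entries by the same amount as the
  -- induced `φ₁`.
  φ₁_φ₀ m := ind_ext fun c => by
    rw [val_indMap, val_indMap₀, E.φ₁_φ₀, val_smul _ hW]
  φ₀_φ₁ m := ind_ext fun c => by
    rw [val_indMap₀, val_indMap, E.φ₀_φ₁, val_smul _ hW]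

variable (π) in
/-- The functor that induces factorizations from factorizations of coarser grading. -/
noncomputable def ind (hW : W ∈ 𝓐 a) :
    Fac.{uk, uR, uB, max uk uA} (coarse π 𝓐) (π a) W ⥤ Fac.{uk, uR, uA, max uk uA} 𝓐 a W where
  obj E := indObj hW E
  map {E F} f := homMk (E := indObj hW E) (F := indObj hW F)
    (indMap₀ (f₁ f) f.2.1) (indMap₀ (f₀ f) f.2.2.1)
    (fun _ _ hm => indMap₀_mem _ _ hm) (fun _ _ hm => indMap₀_mem _ _ hm)
    (indMap₀_indMap₀ E.homog₀ f.2.2.1 f.2.1 F.homog₀ (f₀_φ₀ f))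
    (indMap₀_indMap homog₁_tw f.2.1 f.2.2.1 homog₁_tw (f₁_φ₁ f))
  map_id E := hom_ext (fun m => indMap₀_id m (𝟙 E : E ⟶ E).2.1)
    (fun m => indMap₀_id m (𝟙 E : E ⟶ E).2.2.1)
  map_comp f g := hom_ext (fun m => indMap₀_comp f.2.1 g.2.1 (f ≫ g).2.1 m)
    (fun m => indMap₀_comp f.2.2.1 g.2.2.1 (f ≫ g).2.2.1 m)

variable (hW : W ∈ 𝓐 a)

variable (π) in
/-- The unit of the adjunction between restriction and induction. -/
noncomputable def unitApp (E : Fac.{uk, uR, uA, max uk uA} 𝓐 a W) :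
    E ⟶ (ind π hW).obj (((coarsen 𝓐 a π).fac W).obj E) :=
  homMk (E := E) (F := indObj hW ((coarsen 𝓐 a π).facObj E))
    (E.X₁.unit π a) (E.X₀.unit π a)
    (fun _ _ hm => E.X₁.unit_mem π a hm) (fun _ _ hm => E.X₀.unit_mem π a hm)
    (fun m => (indMap₀_unit a E.homog₀ ((coarsen 𝓐 a π).facObj E).homog₀ m).symm)
    (fun m => (indMap_unit a a E.homog₁ _ m).symm)

variable (π) in
/-- The counit of the adjunction between restriction and induction. -/
noncomputable def counitApp (F : Fac.{uk, uR, uB, max uk uA} (coarse π 𝓐) (π a) W) :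
    ((coarsen 𝓐 a π).fac W).obj ((ind π hW).obj F) ⟶ F :=
  homMk (E := (coarsen 𝓐 a π).facObj (indObj hW F)) (F := F)
    (F.X₁.counit π a) (F.X₀.counit π a) (F.X₁.counit_mem π a) (F.X₀.counit_mem π a)
    (fun m => counit_indMap₀ a F.homog₀ m) (fun m => counit_indMap a a homog₁_tw m)

lemma unitApp_naturality {E F : Fac.{uk, uR, uA, max uk uA} 𝓐 a W} (f : E ⟶ F) :
    f ≫ unitApp π hW F = unitApp π hW E ≫ (ind π hW).map (((coarsen 𝓐 a π).fac W).map f) :=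
  hom_ext
    (fun m => (indMap₀_unit a f.2.1 (((coarsen 𝓐 a π).fac W).map f).2.1 m).symm)
    (fun m => (indMap₀_unit a f.2.2.1 (((coarsen 𝓐 a π).fac W).map f).2.2.1 m).symm)

lemma counitApp_naturality {E F : Fac.{uk, uR, uB, max uk uA} (coarse π 𝓐) (π a) W} (f : E ⟶ F) :
    ((coarsen 𝓐 a π).fac W).map ((ind π hW).map f) ≫ counitApp π hW F = counitApp π hW E ≫ f :=
  hom_ext (fun m => counit_indMap₀ a f.2.1 m) (fun m => counit_indMap₀ a f.2.2.1 m)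

/-- The triangle identities hold strictly for factorizations, hence in every quotient and
localization that follows. -/
lemma unitApp_counitApp (E : Fac.{uk, uR, uA, max uk uA} 𝓐 a W) :
    ((coarsen 𝓐 a π).fac W).map (unitApp π hW E) ≫ counitApp π hW (((coarsen 𝓐 a π).fac W).obj E) =
      𝟙 _ :=
  hom_ext (fun m => counit_unit (M := E.X₁) a m) (fun m => counit_unit (M := E.X₀) a m)

lemma unitApp_ind_counitApp (F : Fac.{uk, uR, uB, max uk uA} (coarse π 𝓐) (π a) W) :
    unitApp π hW ((ind π hW).obj F) ≫ (ind π hW).map (counitApp π hW F) = 𝟙 _ :=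
  hom_ext (fun m => indMap₀_counit_unit (M := F.X₁) a m)
    (fun m => indMap₀_counit_unit (M := F.X₀) a m)

variable (π) in
/-- The map from a factorization to the restriction of the induced factorization that repeats the
homogeneous components. -/
noncomputable def diag (F : Fac.{uk, uR, uB, max uk uA} (coarse π 𝓐) (π a) W) :
    F ⟶ ((coarsen 𝓐 a π).fac W).obj ((ind π hW).obj F) :=
  homMk (E := F) (F := (coarsen 𝓐 a π).facObj (indObj hW F))
    (F.X₁.diag π a) (F.X₀.diag π a) (F.X₁.diag_mem π a) (F.X₀.diag_mem π a)
    (fun m => (indMap₀_diag a F.homog₀ m).symm) (fun m => (indMap_diag a a homog₁_tw m).symm)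

/-- An averaging argument: once the order of the kernel is invertible, this exhibits F as a direct
summand of a restriction. -/
lemma diag_counitApp (hπ : Function.Surjective π)
    (F : Fac.{uk, uR, uB, max uk uA} (coarse π 𝓐) (π a) W) :
    diag π hW F ≫ counitApp π hW F = (Nat.card π.ker : k) • 𝟙 F :=
  hom_ext (fun m => (F.X₁.counit_diag π hπ a m).trans (Nat.cast_smul_eq_nsmul k _ _).symm)
    (fun m => (F.X₀.counit_diag π hπ a m).trans (Nat.cast_smul_eq_nsmul k _ _).symm)

variable (π) in
/-- The projection from `ind (res E)` to the twist `E(γ)`. -/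
noncomputable def proj (γ : A) (E : Fac.{uk, uR, uA, max uk uA} 𝓐 a W) :
    (ind π hW).obj (((coarsen 𝓐 a π).fac W).obj E) ⟶ ((twist 𝓐 a γ).fac W).obj E :=
  homMk (E := indObj hW ((coarsen 𝓐 a π).facObj E)) (F := (twist 𝓐 a γ).facObj E)
    (E.X₁.proj π a γ) (E.X₀.proj π a γ) (E.X₁.proj_mem π a γ) (E.X₀.proj_mem π a γ)
    (fun m => proj_indMap₀ a γ E.homog₀ ((coarsen 𝓐 a π).facObj E).homog₀ m)
    (fun m => proj_indMap a γ a E.homog₁ _ m)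

end Fac

end InducedFactorizations

/-! ### Exactness of induction and its compatibility with direct sums -/

section InducedMapsExact

variable {k : Type uk} [CommRing k] {R : Type uR} [CommRing R] [Algebra k R]
  {A : Type uA} [AddCommGroup A] [DecidableEq A] {B : Type uB} [AddCommGroup B]
  {𝓐 : A → Submodule k R} [GradedAlgebra 𝓐] {π : A →+ B} [Finite π.ker]

namespace GrMod

variable {M N P M' N' P' : GrMod.{uk, uR, uB, max uk uA} (coarse π 𝓐)}

/-- The shape of the homotopy equations: one term passes through maps of degree 0, the other through
maps of opposite degrees d and d', whose shifts of the entries cancel. It is used with the degrees a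
and -a. -/
lemma indMap₀_eq_add {d d' : A} (hd : d + d' = 0) {u : M →ₗ[R] N} {f : M →ₗ[R] M'}
    {g : M' →ₗ[R] N} {f' : M →ₗ[R] N'} {g' : N' →ₗ[R] N} (hu : IsHomog M N u)
    (hf : IsHomog M M' f) (hg : IsHomog M' N g)
    (hf' : ∀ c, ∀ m ∈ M.gr c, f' m ∈ N'.gr (c + π d))
    (hg' : ∀ c, ∀ m ∈ N'.gr c, g' m ∈ N.gr (c + π d'))
    (h : ∀ m, u m = g (f m) + g' (f' m)) (y : M.ind π) :
    indMap₀ u hu y = indMap₀ g hg (indMap₀ f hf y) + indMap d' g' hg' (indMap d f' hf' y) :=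
  ind_ext fun c => by
    have e : c - d' - d = c := by rw [sub_sub, add_comm d', hd, sub_zero]
    rw [map_add, Finsupp.add_apply, val_indMap₀, val_indMap₀, val_indMap₀, val_indMap, val_indMap,
      e, h]

/-- A preimage is built entry by entry, from homogeneous preimages of the entries of z. -/
lemma range_indMap₀ {f : M →ₗ[R] N} (hf : IsHomog M N f) (z : N.ind π)
    (h : ∀ c, ∃ m, f m = N.val z c) : ∃ y, indMap₀ f hf y = z := by
  -- The last condition, preimage 0 for entry 0, keeps the chosen family finitely supported.
  have key (c : A) : ∃ m ∈ M.gr (π c), f m = N.val z c ∧ (N.val z c = 0 → m = 0) := by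
    by_cases h₀ : N.val z c = 0
    · exact ⟨0, zero_mem _, by rw [map_zero, h₀], fun _ => rfl⟩
    · obtain ⟨m, hm⟩ := h c
      -- An arbitrary preimage need not be homogeneous; its component of degree π c is, and still
      -- maps to the entry.
      refine ⟨M.comp m (π c), M.comp_mem m _, ?_, fun h => (h₀ h).elim⟩
      have := comp_map (M := M) (N := N) f 0 (fun c m hm => by rw [add_zero]; exact hf c m hm) m
        (π c)
      rw [add_zero, hm] at this
      rw [← this]
      exact N.comp_same (N.val_mem z c)
  choose m hm h₁ h₂ using key
  refine ⟨M.indMk (Finsupp.onFinset (N.val z).support m fun c hc => ?_) hm, ind_ext fun c => ?_⟩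
  · exact Finsupp.mem_support_iff.2 fun h => hc (h₂ c h)
  · rw [val_indMap₀]
    exact h₁ c

lemma indMap₀_surjective {f : M →ₗ[R] N} (hf : IsHomog M N f) (h : Function.Surjective f) :
    Function.Surjective (indMap₀ (π := π) f hf) :=
  fun z => range_indMap₀ hf z fun _ => h _

lemma indMap₀_injective {f : M →ₗ[R] N} (hf : IsHomog M N f) (h : Function.Injective f) :
    Function.Injective (indMap₀ (π := π) f hf) :=
  fun y z hyz => ind_ext fun c => h (by
    rw [← val_indMap₀ f hf, ← val_indMap₀ f hf, hyz])

/-- Vanishing is tested on entries, and `range_indMap₀` assembles preimages of the entries into a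
family. -/
lemma indMap₀_exact {f : M →ₗ[R] N} {g : N →ₗ[R] P} (hf : IsHomog M N f) (hg : IsHomog N P g)
    (h : Function.Exact f g) :
    Function.Exact (indMap₀ (π := π) f hf) (indMap₀ (π := π) g hg) := by
  refine fun z => ⟨fun hz => range_indMap₀ hf z fun c => ?_, ?_⟩
  · refine (h _).1 ?_
    rw [← val_indMap₀ g hg, hz, map_zero, Finsupp.zero_apply]
  · rintro ⟨y, rfl⟩
    refine ind_ext fun c => ?_
    rw [val_indMap₀, val_indMap₀, map_zero, Finsupp.zero_apply]
    exact (h _).2 ⟨_, rfl⟩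

section Prod

variable (d : A) (q : P ≃ₗ[R] M × N)
  (hq : ∀ c p, p ∈ P.gr c ↔ (q p).1 ∈ M.gr c ∧ (q p).2 ∈ N.gr (c + π d))

/-- Induction commutes with direct sums. -/
noncomputable def indProd : P.ind π →ₗ[R] M.ind π × N.ind π :=
  (indMap₀ (LinearMap.fst R M N ∘ₗ q.toLinearMap) fun c p hp => ((hq c p).1 hp).1).prod
    (indMap d (LinearMap.snd R M N ∘ₗ q.toLinearMap) fun c p hp => ((hq c p).1 hp).2)

lemma val_indProd_fst (y : P.ind π) (c : A) :
    M.val (indProd d q hq y).1 c = (q (P.val y c)).1 :=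
  val_indMap₀ (LinearMap.fst R M N ∘ₗ q.toLinearMap) (fun c p hp => ((hq c p).1 hp).1) y c

lemma val_indProd_snd (y : P.ind π) (c : A) :
    N.val (indProd d q hq y).2 c = (q (P.val y (c - d))).2 :=
  val_indMap d (LinearMap.snd R M N ∘ₗ q.toLinearMap) (fun c p hp => ((hq c p).1 hp).2) y c

lemma indProd_mem_fst {y : P.ind π} {c : A} (hy : y ∈ (P.ind π).gr c) :
    (indProd d q hq y).1 ∈ (M.ind π).gr c :=
  indMap₀_mem _ (fun c p hp => ((hq c p).1 hp).1) hy

lemma indProd_mem_snd {y : P.ind π} {c : A} (hy : y ∈ (P.ind π).gr c) :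
    (indProd d q hq y).2 ∈ (N.ind π).gr (c + d) :=
  indMap_mem d _ (fun c p hp => ((hq c p).1 hp).2) hy

/-- The first summand is read at the index c and the second at c + d; the inverse adds the induced
inclusions, of degrees 0 and -d. Allowing the shift d covers both components of a cone: d = 0 for
F₋₁ ⊕ E₀ and d = a for F₀ ⊕ E₋₁(a). -/
lemma indProd_bijective : Function.Bijective (indProd d q hq) := by
  constructor
  · intro y z h
    refine ind_ext fun c => q.injective (Prod.ext ?_ ?_)
    · rw [← val_indProd_fst d q hq, ← val_indProd_fst d q hq, h]
    · have h' := congrArg (fun t => N.val t.2 (c + d)) h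
      simp only [val_indProd_snd, add_sub_cancel_right] at h'
      exact h'
  · rintro ⟨y, z⟩
    have h₁ : IsHomog M P (q.symm.toLinearMap ∘ₗ LinearMap.inl R M N) := fun c m hm => by
      refine (hq c _).2 ?_
      simpa using hm
    have h₂ : ∀ c, ∀ m ∈ N.gr c, (q.symm.toLinearMap ∘ₗ LinearMap.inr R M N) m ∈
        P.gr (c + π (-d)) := fun c m hm => by
      refine (hq _ _).2 ?_
      simpa using hm
    refine ⟨indMap₀ _ h₁ y + indMap (-d) _ h₂ z, Prod.ext (ind_ext fun c => ?_)
      (ind_ext fun c => ?_)⟩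
    · rw [val_indProd_fst, map_add, Finsupp.add_apply, val_indMap₀, val_indMap]
      simp
    · rw [val_indProd_snd, map_add, Finsupp.add_apply, val_indMap₀, val_indMap]
      simp

/-- Intended for the map out of a cone given by a zero null-homotopy, which factors through the
first summand. -/
lemma indMap₀_eq_indProd {u : P →ₗ[R] N'} {v : M →ₗ[R] N'} (hu : IsHomog P N' u)
    (hv : IsHomog M N' v) (h : ∀ p, u p = v (q p).1) (y : P.ind π) :
    indMap₀ u hu y = indMap₀ v hv (indProd d q hq y).1 :=
  ind_ext fun c => by rw [val_indMap₀, val_indMap₀, val_indProd_fst, h]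

variable {d' : A} {q' : P' ≃ₗ[R] M' × N'}
  (hq' : ∀ c p, p ∈ P'.gr c ↔ (q' p).1 ∈ M'.gr c ∧ (q' p).2 ∈ N'.gr (c + π d'))

lemma indProd_indMap {e s t : A} {Φ : P →ₗ[R] P'} {φ : M →ₗ[R] M'} {ψ : N →ₗ[R] M'}
    {θ : N →ₗ[R] N'} (hΦ : ∀ c, ∀ m ∈ P.gr c, Φ m ∈ P'.gr (c + π e))
    (hφ : ∀ c, ∀ m ∈ M.gr c, φ m ∈ M'.gr (c + π e)) (hψ : ∀ c, ∀ m ∈ N.gr c, ψ m ∈ M'.gr (c + π s))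
    (hθ : ∀ c, ∀ m ∈ N.gr c, θ m ∈ N'.gr (c + π t)) (hs : d + s = e) (ht : d + t = e + d')
    (h₁ : ∀ p, (q' (Φ p)).1 = φ (q p).1 + ψ (q p).2) (h₂ : ∀ p, (q' (Φ p)).2 = -θ (q p).2)
    (y : P.ind π) :
    indProd d' q' hq' (indMap e Φ hΦ y) =
      (indMap e φ hφ (indProd d q hq y).1 + indMap s ψ hψ (indProd d q hq y).2,
        -indMap t θ hθ (indProd d q hq y).2) :=
  Prod.ext (ind_ext fun c => by
    have e₁ : c - s - d = c - e := by rw [sub_sub, add_comm, hs]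
    rw [val_indProd_fst, map_add, Finsupp.add_apply, val_indMap, val_indMap, val_indMap,
      val_indProd_fst, val_indProd_snd, h₁, e₁])
  (ind_ext fun c => by
    have e₁ : c - t - d = c - d' - e := by rw [sub_sub, sub_sub, add_comm, ht, add_comm]
    rw [val_indProd_snd, map_neg, Finsupp.neg_apply, val_indMap, val_indMap,
      val_indProd_snd, h₂, e₁])

end Prod

end GrMod

end InducedMapsExact

/-! ### Induction of null-homotopies, cones and totalizations -/

section InducedHomotopies

variable {k : Type uk} [CommRing k] {R : Type uR} [CommRing R] [Algebra k R]
  {A : Type uA} [AddCommGroup A]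

open GrMod Fac

namespace Fac

section Iso

variable {𝓐 : A → Submodule k R} {a : A} {W : R}

/-- Cones of isomorphic morphisms are isomorphic. -/
def coneIsoOfIso {E E' F : Fac.{uk, uR, uA, x} 𝓐 a W} {h : E ⟶ F} {h' : E' ⟶ F} (u : E ≅ E')
    (w : h = u.hom ≫ h') : cone h ≅ cone h' where
  hom := coneMap h h' u.hom (𝟙 F) (.ofEq ((Category.comp_id h).trans w))
  inv := coneMap h' h u.inv (𝟙 F) (.ofEq ((Category.comp_id h').trans
    (by rw [w, Iso.inv_hom_id_assoc])))
  hom_inv_id := hom_ext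
    (fun m => Prod.ext ((add_zero _).trans (add_zero m.1))
      (DFunLike.congr_fun (congrArg f₀ u.hom_inv_id) m.2))
    (fun m => Prod.ext ((add_zero _).trans (add_zero m.1))
      (DFunLike.congr_fun (congrArg f₁ u.hom_inv_id) m.2))
  inv_hom_id := hom_ext
    (fun m => Prod.ext ((add_zero _).trans (add_zero m.1))
      (DFunLike.congr_fun (congrArg f₀ u.inv_hom_id) m.2))
    (fun m => Prod.ext ((add_zero _).trans (add_zero m.1))
      (DFunLike.congr_fun (congrArg f₁ u.inv_hom_id) m.2))

/-- Since f commutes with taking components, m and its component of degree c have the same image.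
This makes the inverse of a bijective homogeneous map homogeneous. -/
lemma mem_gr_of_injective {M N : GrMod.{uk, uR, uA, x} 𝓐} {f : M →ₗ[R] N} (hf : IsHomog M N f)
    (h : Function.Injective f) {c : A} {m : M} (hm : f m ∈ N.gr c) : m ∈ M.gr c := by
  have := comp_map (M := M) (N := N) f 0 (fun c m hm => by rw [add_zero]; exact hf c m hm) m c
  rw [add_zero, N.comp_same hm] at this
  rw [h this]
  exact M.comp_mem m c

/-- A bijective morphism of factorizations is an isomorphism. -/
noncomputable def isoOfBijective {E F : Fac.{uk, uR, uA, x} 𝓐 a W} (f : E ⟶ F)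
    (h₁ : Function.Bijective (f₁ f)) (h₀ : Function.Bijective (f₀ f)) : E ≅ F where
  hom := f
  inv := homMk (E := F) (F := E) (LinearEquiv.ofBijective (f₁ f) h₁).symm.toLinearMap
    (LinearEquiv.ofBijective (f₀ f) h₀).symm.toLinearMap
    (fun c m hm => mem_gr_of_injective f.2.1 h₁.1 (by
      rwa [← (LinearEquiv.ofBijective (f₁ f) h₁).apply_symm_apply m] at hm))
    (fun c m hm => mem_gr_of_injective f.2.2.1 h₀.1 (by
      rwa [← (LinearEquiv.ofBijective (f₀ f) h₀).apply_symm_apply m] at hm))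
    (fun m => h₀.1 (((LinearEquiv.ofBijective (f₀ f) h₀).apply_symm_apply _).trans (by
      rw [f₀_φ₀]
      exact congrArg F.φ₀ ((LinearEquiv.ofBijective (f₁ f) h₁).apply_symm_apply m).symm)))
    (fun m => h₁.1 (((LinearEquiv.ofBijective (f₁ f) h₁).apply_symm_apply _).trans (by
      rw [f₁_φ₁]
      exact congrArg F.φ₁ ((LinearEquiv.ofBijective (f₀ f) h₀).apply_symm_apply m).symm)))
  hom_inv_id := hom_ext (fun m => (LinearEquiv.ofBijective (f₁ f) h₁).symm_apply_apply m)
    (fun m => (LinearEquiv.ofBijective (f₀ f) h₀).symm_apply_apply m)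
  inv_hom_id := hom_ext (fun m => (LinearEquiv.ofBijective (f₁ f) h₁).apply_symm_apply m)
    (fun m => (LinearEquiv.ofBijective (f₀ f) h₀).apply_symm_apply m)

end Iso

variable [DecidableEq A] {B : Type uB} [AddCommGroup B]
  {𝓐 : A → Submodule k R} [GradedAlgebra 𝓐] {π : A →+ B} [Finite π.ker] {a : A} {W : R}
  (hW : W ∈ 𝓐 a)

lemma NullHomotopy.homog₁_tw {E F : Fac.{uk, uR, uB, x} (coarse π 𝓐) (π a) W} {f : E ⟶ F}
    (h : NullHomotopy f) (c : B) (m : E.X₁) (hm : m ∈ E.X₁.gr c) :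
    h.h₁ m ∈ F.X₀.gr (c + π (-a)) := by
  rw [map_neg]
  exact h.homog₁ c m hm

/-- The null-homotopy induced from a null-homotopy. -/
noncomputable def indNullHomotopy {E F : Fac.{uk, uR, uB, max uk uA} (coarse π 𝓐) (π a) W}
    {f : E ⟶ F} (h : NullHomotopy f) : NullHomotopy ((ind π hW).map f) where
  h₁ := indMap (-a) h.h₁ h.homog₁_tw
  h₀ := indMap₀ h.h₀ h.homog₀
  homog₁ _ _ hm := indMap_mem _ _ _ hm
  homog₀ _ _ hm := indMap₀_mem _ _ hm
  eq₁ m := indMap₀_eq_add (neg_add_cancel a) f.2.1 E.homog₀ h.homog₀ h.homog₁_tw homog₁_tw h.eq₁ m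
  eq₀ m := (indMap₀_eq_add (add_neg_cancel a) f.2.2.1 h.homog₀ F.homog₀ homog₁_tw h.homog₁_tw
    (fun m => (h.eq₀ m).trans (add_comm _ _)) m).trans (add_comm _ _)

section Cone

variable {E F G : Fac.{uk, uR, uB, max uk uA} (coarse π 𝓐) (π a) W} (f : E ⟶ F)

lemma mem_cone₁ (c : B) (p : (cone f).X₁) :
    p ∈ (cone f).X₁.gr c ↔ p.1 ∈ F.X₁.gr c ∧ p.2 ∈ E.X₀.gr (c + π 0) := by
  rw [map_zero, add_zero]
  exact Iff.rfl

lemma degree_zero {M N : GrMod.{uk, uR, uB, max uk uA} (coarse π 𝓐)} {g : M →ₗ[R] N}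
    (hg : IsHomog M N g) : ∀ c, ∀ m ∈ M.gr c, g m ∈ N.gr (c + π 0) := fun c m hm => by
  rw [map_zero, add_zero]
  exact hg c m hm

/-- The comparison morphism between induction of a cone and the cone of the induced morphism. -/
noncomputable def indCone : (ind π hW).obj (cone f) ⟶ cone ((ind π hW).map f) :=
  homMk (E := indObj hW (cone f)) (F := cone ((ind π hW).map f))
    (indProd (M := F.X₁) (N := E.X₀) (P := (cone f).X₁) 0 (LinearEquiv.refl R _) (mem_cone₁ f))
    (indProd (M := F.X₀) (N := E.X₁) (P := (cone f).X₀) a (LinearEquiv.refl R _)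
      (fun _ _ => Iff.rfl))
    (fun c m hm => ⟨indProd_mem_fst _ _ (mem_cone₁ f) hm, by
      have := indProd_mem_snd (M := F.X₁) (N := E.X₀) (P := (cone f).X₁) 0 (LinearEquiv.refl R _)
        (mem_cone₁ f) hm
      rwa [add_zero] at this⟩)
    (fun _ _ hm => ⟨indProd_mem_fst (M := F.X₀) (N := E.X₁) (P := (cone f).X₀) a
        (LinearEquiv.refl R _) (fun _ _ => Iff.rfl) hm,
      indProd_mem_snd (M := F.X₀) (N := E.X₁) (P := (cone f).X₀) a
        (LinearEquiv.refl R _) (fun _ _ => Iff.rfl) hm⟩)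
    (fun m => indProd_indMap (M := F.X₁) (N := E.X₀) (P := (cone f).X₁)
      (M' := F.X₀) (N' := E.X₁) (P' := (cone f).X₀) 0 (LinearEquiv.refl R _) (mem_cone₁ f)
      (q' := LinearEquiv.refl R _) (fun _ _ => Iff.rfl) (degree_zero (cone f).homog₀)
      (degree_zero F.homog₀) (degree_zero f.2.2.1) homog₁_tw (add_zero 0) rfl
      (fun _ => rfl) (fun _ => rfl) m)
    (fun m => indProd_indMap (M := F.X₀) (N := E.X₁) (P := (cone f).X₀)
      (M' := F.X₁) (N' := E.X₀) (P' := (cone f).X₁) a (LinearEquiv.refl R _) (fun _ _ => Iff.rfl)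
      (q' := LinearEquiv.refl R _) (mem_cone₁ f) homog₁_tw homog₁_tw
      (degree_zero f.2.1) (degree_zero E.homog₀) (add_zero a) rfl
      (fun _ => rfl) (fun _ => rfl) m)

/-- Induction commutes with cones. -/
noncomputable def indConeIso : (ind π hW).obj (cone f) ≅ cone ((ind π hW).map f) :=
  isoOfBijective (indCone hW f)
    (indProd_bijective (M := F.X₁) (N := E.X₀) (P := (cone f).X₁) 0 (LinearEquiv.refl R _)
      (mem_cone₁ f))
    (indProd_bijective (M := F.X₀) (N := E.X₁) (P := (cone f).X₀) a (LinearEquiv.refl R _)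
      (fun _ _ => Iff.rfl))

/-- The null-homotopy is zero, so both sides only see the first summand of the cone, where they are
induced by g. -/
lemma indCone_coneDesc (g : F ⟶ G) (h : f ≫ g = 0)
    (h' : (ind π hW).map f ≫ (ind π hW).map g = 0) :
    (ind π hW).map (coneDesc f g (.ofEqZero h)) =
      (indConeIso hW f).hom ≫ coneDesc ((ind π hW).map f) ((ind π hW).map g) (.ofEqZero h') :=
  hom_ext
    (fun m => (indMap₀_eq_indProd (M := F.X₁) (N := E.X₀) (P := (cone f).X₁) (N' := G.X₁) 0
      (LinearEquiv.refl R _) (mem_cone₁ f) (coneDesc f g (.ofEqZero h)).2.1 g.2.1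
      (fun _ => add_zero _) m).trans (add_zero _).symm)
    (fun m => (indMap₀_eq_indProd (M := F.X₀) (N := E.X₁) (P := (cone f).X₀) (N' := G.X₀) a
      (LinearEquiv.refl R _) (fun _ _ => Iff.rfl) (coneDesc f g (.ofEqZero h)).2.2.1 g.2.2.1
      (fun _ => add_zero _) m).trans (add_zero _).symm)

/-- Induction commutes with totalizations. -/
noncomputable def indTotalIso (g : F ⟶ G) (h : f ≫ g = 0)
    (h' : (ind π hW).map f ≫ (ind π hW).map g = 0) :
    (ind π hW).obj (total f g h) ≅ total ((ind π hW).map f) ((ind π hW).map g) h' :=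
  indConeIso hW (coneDesc f g (.ofEqZero h)) ≪≫
    coneIsoOfIso (indConeIso hW f) (indCone_coneDesc hW f g h h')

lemma ind_map_zero : (ind π hW).map (0 : E ⟶ F) = 0 :=
  hom_ext (fun y => ind_ext fun c => val_indMap₀ _ (0 : E ⟶ F).2.1 y c)
    (fun y => ind_ext fun c => val_indMap₀ _ (0 : E ⟶ F).2.2.1 y c)

variable {f} in
-- Both components are exact sequences of graded modules, and induction preserves exactness of
-- these.
lemma ShortExact.ind {g : F ⟶ G} (h : ShortExact f g) :
    ShortExact ((ind π hW).map f) ((ind π hW).map g) where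
  comp_eq_zero := by rw [← Functor.map_comp, h.comp_eq_zero, ind_map_zero]
  injective₁ := indMap₀_injective f.2.1 h.injective₁
  injective₀ := indMap₀_injective f.2.2.1 h.injective₀
  exact₁ := indMap₀_exact f.2.1 g.2.1 h.exact₁
  exact₀ := indMap₀_exact f.2.2.1 g.2.2.1 h.exact₀
  surjective₁ := indMap₀_surjective g.2.1 h.surjective₁
  surjective₀ := indMap₀_surjective g.2.2.1 h.surjective₀

end Cone

end Fac

end InducedHomotopies

/-! ### Induction on the homotopy category and the absolute derived category -/

section InducedHomotopyCategory

variable {k : Type uk} [CommRing k] {R : Type uR} [CommRing R] [Algebra k R]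
  {A : Type uA} [AddCommGroup A] [DecidableEq A] {B : Type uB} [AddCommGroup B]
  {𝓐 : A → Submodule k R} [GradedAlgebra 𝓐] {π : A →+ B} [Finite π.ker] {a : A} {W : R}
  (hW : W ∈ 𝓐 a)

open GrMod Fac

lemma ind_map_sub {E F : Fac.{uk, uR, uB, max uk uA} (coarse π 𝓐) (π a) W} (f g : E ⟶ F) :
    (ind π hW).map f - (ind π hW).map g = (ind π hW).map (f - g) :=
  hom_ext
    (fun y => ind_ext fun c => (congrArg₂ (· - ·) (val_indMap₀ (f₁ f) f.2.1 y c)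
      (val_indMap₀ (f₁ g) g.2.1 y c)).trans (val_indMap₀ (f₁ (f - g)) (f - g).2.1 y c).symm)
    (fun y => ind_ext fun c => (congrArg₂ (· - ·) (val_indMap₀ (f₀ f) f.2.2.1 y c)
      (val_indMap₀ (f₀ g) g.2.2.1 y c)).trans (val_indMap₀ (f₀ (f - g)) (f - g).2.2.1 y c).symm)

variable (π) in
/-- The induction functor on the homotopy category. -/
noncomputable def indHo : HoFac.{uk, uR, uB, max uk uA} (coarse π 𝓐) (π a) W ⥤
    HoFac.{uk, uR, uA, max uk uA} 𝓐 a W :=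
  CategoryTheory.Quotient.lift _ (ind π hW ⋙ HoFac.quot 𝓐 a W)
    (fun _ _ f g ⟨h⟩ => HoFac.eq_of_nullHomotopy (by
      rw [ind_map_sub]
      exact indNullHomotopy hW h))

variable (π) in
/-- Restriction is left adjoint to induction on the homotopy category. -/
noncomputable def hoAdj : (coarsen 𝓐 a π).ho W ⊣ indHo π hW :=
  Adjunction.mkOfUnitCounit
    { unit := CategoryTheory.Quotient.natTransLift _
        { app := fun E => (HoFac.quot 𝓐 a W).map (unitApp π hW E)
          naturality := fun E F f =>
            (((HoFac.quot 𝓐 a W).map_comp _ _).symm.trans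
              (congrArg (HoFac.quot 𝓐 a W).map (unitApp_naturality hW f))).trans
              ((HoFac.quot 𝓐 a W).map_comp _ _) }
      counit := CategoryTheory.Quotient.natTransLift _
        { app := fun E => (HoFac.quot (coarse π 𝓐) (π a) W).map (counitApp π hW E)
          naturality := fun E F f =>
            (((HoFac.quot (coarse π 𝓐) (π a) W).map_comp _ _).symm.trans
              (congrArg (HoFac.quot (coarse π 𝓐) (π a) W).map (counitApp_naturality hW f))).trans
              ((HoFac.quot (coarse π 𝓐) (π a) W).map_comp _ _) }
      left_triangle := by
        ext ⟨E⟩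
        refine (congrArg (_ ≫ ·) (Category.id_comp _)).trans ?_
        refine ((HoFac.quot (coarse π 𝓐) (π a) W).map_comp _ _).symm.trans ?_
        exact (congrArg (HoFac.quot (coarse π 𝓐) (π a) W).map (unitApp_counitApp hW E)).trans
          ((HoFac.quot (coarse π 𝓐) (π a) W).map_id _)
      right_triangle := by
        ext ⟨E⟩
        refine (congrArg (_ ≫ ·) (Category.id_comp _)).trans ?_
        refine ((HoFac.quot 𝓐 a W).map_comp _ _).symm.trans ?_
        exact (congrArg (HoFac.quot 𝓐 a W).map (unitApp_ind_counitApp hW E)).trans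
          ((HoFac.quot 𝓐 a W).map_id _) }

/-- The compatibility of induction with the shift is transported from restriction through the
adjunction; exactness is then the general fact that the right adjoint of an exact functor is exact.
-/
noncomputable instance : (indHo π hW).CommShift ℤ := (hoAdj π hW).rightAdjointCommShift ℤ

instance : (hoAdj π hW).CommShift ℤ := (hoAdj π hW).commShift_of_leftAdjoint ℤ

instance : (indHo π hW).IsTriangulated := (hoAdj π hW).isTriangulated_rightAdjoint

/-- The inverse image of a thick subcategory under an exact functor is thick, so the generating
totalizations suffice. Induction maps these to totalizations of short exact sequences. -/
lemma ind_acyclic_le : acyclic.{uk, uR, uB, max uk uA} (coarse π 𝓐) (π a) W ≤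
    (acyclic 𝓐 a W).inverseImage (indHo π hW) := by
  have : ((acyclic 𝓐 a W).inverseImage (indHo π hW)).IsStableUnderRetracts :=
    ⟨fun i hY => (acyclic 𝓐 a W).prop_of_retract (i.map (indHo π hW)) hY⟩
  refine (ObjectProperty.triangEnvelope_le_iff _).2 ?_
  rintro _ ⟨E, F, G, f, g, h, rfl⟩
  refine (acyclic 𝓐 a W).prop_of_iso ((HoFac.quot 𝓐 a W).mapIso
    (indTotalIso hW f g h.comp_eq_zero (h.ind hW).comp_eq_zero)).symm ?_
  exact ObjectProperty.le_triangEnvelope _ _ ⟨_, _, _, _, _, h.ind hW, rfl⟩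

lemma ind_trW_map {E F : HoFac.{uk, uR, uB, max uk uA} (coarse π 𝓐) (π a) W} {f : E ⟶ F}
    (hf : (acyclic (coarse π 𝓐) (π a) W).trW f) : (acyclic 𝓐 a W).trW ((indHo π hW).map f) := by
  have := ObjectProperty.trW_monotone (ind_acyclic_le hW) _ hf
  rwa [ObjectProperty.inverseImage_trW_iff] at this

variable (π) in
/-- The induction functor on the absolute derived category. -/
noncomputable def indD : DAbs.{uk, uR, uB, max uk uA} (coarse π 𝓐) (π a) W ⥤
    DAbs.{uk, uR, uA, max uk uA} 𝓐 a W :=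
  Localization.lift (indHo π hW ⋙ loc 𝓐 a W)
    (fun _ _ _ hf => Localization.inverts (loc 𝓐 a W) _ _ (ind_trW_map hW hf))
    (loc (coarse π 𝓐) (π a) W)

/-- `indD` is induced by `indHo`. -/
noncomputable def indDIso : loc (coarse π 𝓐) (π a) W ⋙ indD π hW ≅ indHo π hW ⋙ loc 𝓐 a W :=
  Localization.fac _ _ _

end InducedHomotopyCategory

/-! ### Functors invariant under a group action, and their descent -/

section Invariance

variable {C D E C' : Type*} [Category* C] [Category* D] [Category* E] [Category* C']
  {Γ : Type*} [AddMonoid Γ] [HasShift C Γ] [HasShift C' Γ]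

variable (Γ) in
/-- A functor that is invariant under the action of `Γ` on the source. -/
structure Invariant (F : C ⥤ D) where
  iso (γ : Γ) : shiftFunctor C γ ⋙ F ≅ F
  iso_zero (X : C) : (iso 0).hom.app X = F.map ((shiftFunctorZero C Γ).hom.app X)
  iso_add (γ δ : Γ) (X : C) : (iso (γ + δ)).hom.app X =
    F.map ((shiftFunctorAdd C γ δ).hom.app X) ≫ (iso δ).hom.app (X⟦γ⟧) ≫ (iso γ).hom.app X

namespace Invariant

/-- The composition of an invariant functor with another functor. -/
def comp {F : C ⥤ D} (I : Invariant Γ F) (G : D ⥤ E) : Invariant Γ (F ⋙ G) where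
  iso γ := Functor.isoWhiskerRight (I.iso γ) G
  iso_zero X := congrArg G.map (I.iso_zero X)
  iso_add γ δ X := by
    refine (congrArg G.map (I.iso_add γ δ X)).trans ?_
    rw [G.map_comp, G.map_comp]
    rfl

/-- A functor that is isomorphic to an invariant functor is invariant. -/
def ofIso {F G : C ⥤ D} (I : Invariant Γ F) (e : F ≅ G) : Invariant Γ G where
  iso γ := Functor.isoWhiskerLeft _ e.symm ≪≫ I.iso γ ≪≫ e
  iso_zero X := by
    change e.inv.app _ ≫ (I.iso 0).hom.app X ≫ e.hom.app X = _
    rw [I.iso_zero]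
    exact (congrArg (e.inv.app _ ≫ ·) (e.hom.naturality ((shiftFunctorZero C Γ).hom.app X))).trans
      (e.inv_hom_id_app_assoc _ _)
  iso_add γ δ X := by
    change e.inv.app _ ≫ (I.iso (γ + δ)).hom.app X ≫ e.hom.app X =
      _ ≫ (e.inv.app _ ≫ (I.iso δ).hom.app _ ≫ e.hom.app _) ≫
        (e.inv.app _ ≫ (I.iso γ).hom.app X ≫ e.hom.app X)
    rw [I.iso_add]
    simp only [Category.assoc, Iso.hom_inv_id_app_assoc]
    rw [← e.inv.naturality_assoc]
    rfl

section OfComp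

variable {L : C ⥤ C'} [L.CommShift Γ] {G : C' ⥤ D} (I : Invariant Γ (L ⋙ G))
  [((Functor.whiskeringLeft C C' D).obj L).Full]
  [((Functor.whiskeringLeft C C' D).obj L).Faithful]

/-- The isomorphisms of `Invariant.ofComp`. -/
noncomputable def ofCompIso (γ : Γ) : shiftFunctor C' γ ⋙ G ≅ G :=
  ((Functor.whiskeringLeft C C' D).obj L).preimageIso
    (Functor.isoWhiskerRight (L.commShiftIso γ).symm G ≪≫ I.iso γ :
      L ⋙ shiftFunctor C' γ ⋙ G ≅ L ⋙ G)

/-- The descended isomorphism is known explicitly on objects in the image of L. By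
`natTrans_ext_of_comp` those values are enough to verify the coherence conditions. -/
lemma ofCompIso_hom_app (γ : Γ) (X : C) : (I.ofCompIso γ).hom.app (L.obj X) =
    G.map ((L.commShiftIso γ).inv.app X) ≫ (I.iso γ).hom.app X :=
  congrArg (fun t => NatTrans.app t X) (((Functor.whiskeringLeft C C' D).obj L).map_preimage
    (Functor.isoWhiskerRight (L.commShiftIso γ).symm G ≪≫ I.iso γ :
      L ⋙ shiftFunctor C' γ ⋙ G ≅ L ⋙ G).hom)

lemma natTrans_ext_of_comp {G₁ G₂ : C' ⥤ D} {τ τ' : G₁ ⟶ G₂} (L : C ⥤ C')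
    [((Functor.whiskeringLeft C C' D).obj L).Faithful]
    (h : ∀ X, τ.app (L.obj X) = τ'.app (L.obj X)) : τ = τ' :=
  ((Functor.whiskeringLeft C C' D).obj L).map_injective (NatTrans.ext (funext h))

/-- Invariance of a functor can be checked after precomposition with a localization functor. -/
noncomputable def ofComp : Invariant Γ G where
  iso := I.ofCompIso
  iso_zero := by
    -- The condition is stated as an equality of natural transformations, so that it may be tested
    -- after precomposition with L; the same is done for addition.
    have : (I.ofCompIso 0).hom = Functor.whiskerRight (shiftFunctorZero C' Γ).hom G :=
      natTrans_ext_of_comp L fun X => by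
        rw [ofCompIso_hom_app, I.iso_zero, L.commShiftIso_zero, Functor.CommShift.isoZero_inv_app]
        change G.map _ ≫ G.map _ = G.map _
        rw [← G.map_comp, Category.assoc, ← L.map_comp, Iso.inv_hom_id_app]
        simp
    exact fun X => congrArg (fun t => NatTrans.app t X) this
  iso_add γ δ := by
    have : (I.ofCompIso (γ + δ)).hom = Functor.whiskerRight (shiftFunctorAdd C' γ δ).hom G ≫
        Functor.whiskerLeft (shiftFunctor C' γ) (I.ofCompIso δ).hom ≫ (I.ofCompIso γ).hom :=
      natTrans_ext_of_comp L fun X => by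
        -- The object (L X)⟦γ⟧ is only isomorphic to one in the image of L. Naturality along L(X⟦γ⟧)
        -- ≅ (L X)⟦γ⟧ reduces to the known value at L(X⟦γ⟧).
        have h := (I.ofCompIso δ).hom.naturality ((L.commShiftIso γ).inv.app X)
        change G.map (((L.commShiftIso γ).inv.app X)⟦δ⟧') ≫ (I.ofCompIso δ).hom.app (L.obj (X⟦γ⟧)) =
          (I.ofCompIso δ).hom.app ((L.obj X)⟦γ⟧) ≫ G.map ((L.commShiftIso γ).inv.app X) at h
        rw [ofCompIso_hom_app] at h
        change _ = G.map ((shiftFunctorAdd C' γ δ).hom.app (L.obj X)) ≫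
          (I.ofCompIso δ).hom.app ((L.obj X)⟦γ⟧) ≫ (I.ofCompIso γ).hom.app (L.obj X)
        rw [ofCompIso_hom_app, ofCompIso_hom_app, ← reassoc_of% h, I.iso_add, L.commShiftIso_add,
          Functor.CommShift.isoAdd_inv_app]
        change G.map _ ≫ G.map (L.map _) ≫ _ = _
        rw [← G.map_comp_assoc]
        simp only [Category.assoc, ← L.map_comp, Iso.inv_hom_id_app]
        simp
    exact fun X => congrArg (fun t => NatTrans.app t X) this

end OfComp

end Invariant

end Invariance

/-! ### The functor on the orbit category given by an invariant functor -/

section OrbitFunctor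

universe v u w

variable {C : Type u} [Category.{v} C] [Preadditive C] {Γ : Type w} [AddGroup Γ] [HasShift C Γ]
  [∀ γ : Γ, (shiftFunctor C γ).Additive] {D : Type*} [Category* D] [Preadditive D]
  {F : C ⥤ D} [F.Additive] (I : Invariant Γ F)

namespace Invariant

open Classical in
/-- The action of an invariant functor on the morphisms of the orbit category. -/
noncomputable def orbitHom (X Y : C) :
    (DirectSum Γ fun γ => ShiftedHom X Y γ) →+ (F.obj X ⟶ F.obj Y) :=
  DirectSum.toAddMonoid fun γ => AddMonoidHom.mk' (fun f => F.map f ≫ (I.iso γ).hom.app Y)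
    (fun f g => by
      refine (congrArg (· ≫ _) F.map_add).trans ?_
      exact Preadditive.add_comp _ _ _ _ _ _)

open Classical in
lemma orbitHom_of {X Y : C} {γ : Γ} (f : ShiftedHom X Y γ) :
    I.orbitHom X Y (DirectSum.of (fun γ => ShiftedHom X Y γ) γ f) =
      F.map f ≫ (I.iso γ).hom.app Y :=
  DirectSum.toAddMonoid_of _ _ _

/-- The coherence at 0 makes the orbit functor agree with F on morphisms of C, and in particular
preserve identities. -/
lemma orbitHom_mk₀ {X Y : C} (f : X ⟶ Y) :
    F.map (ShiftedHom.mk₀ (0 : Γ) rfl f) ≫ (I.iso 0).hom.app Y = F.map f := by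
  rw [I.iso_zero, ShiftedHom.mk₀, ← F.map_comp, Category.assoc, shiftFunctorZero']
  simp

/-- Naturality of the isomorphism for γ moves it past g, and the coherence for δ + γ cancels the
comparison of shifts. This is functoriality on homogeneous morphisms. -/
lemma map_homogComp {X Y Z : C} {γ δ : Γ} (f : ShiftedHom X Y γ) (g : ShiftedHom Y Z δ) :
    F.map (f.comp g (rfl : δ + γ = δ + γ)) ≫ (I.iso (δ + γ)).hom.app Z =
      (F.map f ≫ (I.iso γ).hom.app Y) ≫ F.map g ≫ (I.iso δ).hom.app Z := by
  rw [I.iso_add, ShiftedHom.comp, shiftFunctorAdd'_eq_shiftFunctorAdd, ← F.map_comp_assoc]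
  have h := (I.iso γ).hom.naturality g
  change F.map (g⟦γ⟧') ≫ (I.iso γ).hom.app (Z⟦δ⟧) = (I.iso γ).hom.app Y ≫ F.map g at h
  simp only [Category.assoc, Iso.inv_hom_id_app, F.map_comp]
  rw [← reassoc_of% h]
  simp

open Classical in
/-- The functor from the orbit category that is given by an invariant functor. -/
noncomputable def orbitFunctor : Orbit C Γ ⥤ D where
  obj X := F.obj X.as
  map {X Y} f := I.orbitHom X.as Y.as f
  map_id X := (I.orbitHom_of _).trans ((I.orbitHom_mk₀ _).trans (F.map_id _))
  map_comp {X Y Z} f g := by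
    change I.orbitHom X.as Z.as (Orbit.compHom X.as Y.as Z.as f g) = _
    induction f using DirectSum.induction_on with
    | zero => rw [map_zero, map_zero, AddMonoidHom.zero_apply, map_zero, zero_comp]
    | add f f' hf hf' =>
      rw [map_add, map_add, AddMonoidHom.add_apply, map_add, hf, hf', Preadditive.add_comp]
    | of γ f =>
    induction g using DirectSum.induction_on with
    | zero => rw [map_zero, map_zero, map_zero, comp_zero]
    | add g g' hg hg' =>
      rw [map_add, map_add, map_add, hg, hg', Preadditive.comp_add]
    | of δ g =>
    rw [Orbit.compHom_of f g rfl, orbitHom_of, orbitHom_of, orbitHom_of, map_homogComp]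

instance : I.orbitFunctor.Additive := ⟨map_add (I.orbitHom _ _) _ _⟩

/-- The orbit functor restricts to the given functor. -/
noncomputable def toOrbitIso : Orbit.toOrbit C Γ ⋙ I.orbitFunctor ≅ F :=
  NatIso.ofComponents (fun X => Iso.refl _) fun f => by
    refine (Category.comp_id _).trans (Eq.trans ?_ (Category.id_comp _).symm)
    exact (I.orbitHom_of _).trans (I.orbitHom_mk₀ f)

open Classical in
lemma orbitFunctor_linear (k : Type*) [CommRing k] [Linear k C]
    [∀ γ : Γ, (shiftFunctor C γ).Linear k] [Linear k D] [F.Linear k] :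
    I.orbitFunctor.Linear k where
  map_smul {X Y} f r := by
    change I.orbitHom X.as Y.as (r • f) = r • I.orbitHom X.as Y.as f
    induction f using DirectSum.induction_on with
    | zero => rw [smul_zero, map_zero, smul_zero]
    | add f f' hf hf' => rw [smul_add, map_add, map_add, hf, hf', smul_add]
    | of γ f =>
    have e : r • DirectSum.of (fun γ => ShiftedHom X.as Y.as γ) γ f = DirectSum.of _ γ (r • f) :=
      ((DirectSum.lof k Γ (fun γ => ShiftedHom X.as Y.as γ) γ).map_smul r f).symm
    rw [e, orbitHom_of, orbitHom_of, ← Linear.smul_comp]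
    exact congrArg (· ≫ _) (F.map_smul r f)

section FullyFaithful

variable [Fintype Γ] {G : D ⥤ C} (adj : F ⊣ G)

open Classical in
/-- If the adjoints of the isomorphisms `F(γ Y) ≅ F(Y)` identify `G(F(Y))` with the biproduct of
the objects `γ Y`, then the orbit functor is bijective on morphisms. -/
lemma orbitHom_bijective {X Y : C} (p : ∀ γ : Γ, G.obj (F.obj Y) ⟶ Y⟦γ⟧)
    (h : ∀ γ, adj.homEquiv _ _ ((I.iso γ).hom.app Y) ≫ p γ = 𝟙 _)
    (h' : ∀ γ δ, γ ≠ δ → adj.homEquiv _ _ ((I.iso γ).hom.app Y) ≫ p δ = 0)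
    (hp : ∑ γ, p γ ≫ adj.homEquiv _ _ ((I.iso γ).hom.app Y) = 𝟙 _) :
    Function.Bijective (I.orbitHom X Y) := by
  have : G.Additive := adj.right_adjoint_additive
  constructor
  -- The left inverse transposes g to a map X → G(F Y) and projects it to the summands; `h` and `h'`
  -- say that the transposed isomorphisms are the corresponding inclusions.
  · let ψ : (F.obj X ⟶ F.obj Y) →+ DirectSum Γ fun γ => ShiftedHom X Y γ :=
      AddMonoidHom.mk' (fun g => ∑ γ, DirectSum.of (fun γ => ShiftedHom X Y γ) γ
        (adj.homEquiv _ _ g ≫ p γ)) (fun g g' => by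
          rw [← Finset.sum_add_distrib]
          refine Finset.sum_congr rfl fun γ _ => ?_
          rw [← map_add, ← Preadditive.add_comp, adj.homEquiv_unit, adj.homEquiv_unit,
            adj.homEquiv_unit, G.map_add, Preadditive.comp_add])
    have hψ (f) : ψ (I.orbitHom X Y f) = f := by
      induction f using DirectSum.induction_on with
      | zero => rw [map_zero, map_zero]
      | add f f' hf hf' => rw [map_add, map_add, hf, hf']
      | of γ f =>
        change ∑ δ, DirectSum.of (fun γ => ShiftedHom X Y γ) δ (adj.homEquiv _ _ _ ≫ p δ) = _
        rw [orbitHom_of, adj.homEquiv_naturality_left, Finset.sum_eq_single γ]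
        · rw [Category.assoc, h, Category.comp_id]
        · intro δ _ hδ
          rw [Category.assoc, h' _ _ (Ne.symm hδ), comp_zero, map_zero]
        · intro hγ
          exact (hγ (Finset.mem_univ _)).elim
    exact Function.LeftInverse.injective hψ
  · intro g
    refine ⟨∑ γ, DirectSum.of (fun γ => ShiftedHom X Y γ) γ (adj.homEquiv _ _ g ≫ p γ), ?_⟩
    have hc (Z : C) (g : F.obj Z ⟶ F.obj Y) :
        F.map (adj.homEquiv _ _ g) ≫ adj.counit.app (F.obj Y) = g :=
      (adj.homEquiv_counit (g := adj.homEquiv _ _ g)).symm.trans (Equiv.symm_apply_apply _ _)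
    -- Each isomorphism is F of its transpose followed by the counit. The sum over γ thus collects
    -- inside F as the transpose of g composed with the sum in `hp`, which is the identity.
    have e (γ : Γ) : (I.iso γ).hom.app Y =
        F.map (adj.homEquiv _ _ ((I.iso γ).hom.app Y)) ≫ adj.counit.app (F.obj Y) :=
      (hc _ _).symm
    rw [map_sum]
    have e' (γ : Γ) : I.orbitHom X Y (DirectSum.of (fun γ => ShiftedHom X Y γ) γ
        (adj.homEquiv _ _ g ≫ p γ)) = F.map (adj.homEquiv _ _ g ≫ p γ ≫
          adj.homEquiv _ _ ((I.iso γ).hom.app Y)) ≫ adj.counit.app (F.obj Y) := by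
      rw [orbitHom_of]
      conv_lhs => rw [e]
      rw [← F.map_comp_assoc, Category.assoc]
    simp only [e']
    rw [← Preadditive.sum_comp, ← F.map_sum, ← Preadditive.comp_sum, hp, Category.comp_id, hc]

end FullyFaithful

end Invariant

end OrbitFunctor

/-! ### Twists by the kernel do not change the coarse grading -/

section Regrade

variable {k : Type uk} [CommRing k] {R : Type uR} [CommRing R] [Algebra k R]
  {A : Type uA} [AddCommGroup A] {B : Type uB} [AddCommGroup B]
  {𝓐 : A → Submodule k R} {a : A} {W : R}

open GrMod Fac

namespace Regrade

/-- The composition of two regradings. -/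
def trans {𝓐' : A → Submodule k R} {a' : A} {𝓑 : B → Submodule k R} {b : B}
    (r : Regrade.{uk, uR, uA, uA, x} 𝓐 a 𝓐' a') (s : Regrade.{uk, uR, uA, uB, x} 𝓐' a' 𝓑 b) :
    Regrade.{uk, uR, uA, uB, x} 𝓐 a 𝓑 b where
  gr M := s.gr (r.mod M)
  indep M := s.indep (r.mod M)
  iSup_gr M := s.iSup_gr (r.mod M)
  smul_mem M := s.smul_mem (r.mod M)
  map_mem {M N} f hf := s.map_mem (M := r.mod M) (N := r.mod N) f (r.map_mem f hf)
  gr_tw M c := by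
    refine Eq.trans ?_ (s.gr_tw (r.mod M) c)
    -- The two gradings agree degree by degree, so the identity is homogeneous in both directions.
    refine le_antisymm (fun m hm => ?_) (fun m hm => ?_)
    · exact s.map_mem (M := r.mod (M.tw a)) (N := (r.mod M).tw a') LinearMap.id
        (fun d m hm => (r.gr_tw M d).le hm) c m hm
    · exact s.map_mem (M := (r.mod M).tw a') (N := r.mod (M.tw a)) LinearMap.id
        (fun d m hm => (r.gr_tw M d).ge hm) c m hm

/-- The grading is the only datum of a regrading; its other fields are propositions. -/
lemma ext_gr {𝓑 : B → Submodule k R} {b : B} {r s : Regrade.{uk, uR, uA, uB, x} 𝓐 a 𝓑 b}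
    (h : ∀ M c, r.gr M c = s.gr M c) : r = s := by
  have h' : r.gr = s.gr := funext fun M => funext (h M)
  cases r
  cases s
  congr

/-- Translation by an element of the kernel permutes each fibre of π. The result is an equality and
not only an isomorphism, so restriction of factorizations is strictly invariant. -/
lemma twist_trans_coarsen {π : A →+ B} {γ : A} (hγ : π γ = 0) :
    (twist.{uk, uR, uA, x} 𝓐 a γ).trans (coarsen 𝓐 a π) = coarsen 𝓐 a π :=
  ext_gr fun M b => by
    change coarse π (M.tw γ).gr b = coarse π M.gr b
    apply le_antisymm
    · refine iSup_le fun c => ?_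
      have := le_coarse π M.gr (c + γ)
      rwa [map_add, c.2, hγ, add_zero] at this
    · refine iSup_le fun c => ?_
      have := le_coarse π (M.tw γ).gr (c - γ)
      rw [map_sub, c.2, hγ, sub_zero] at this
      refine le_trans ?_ this
      change M.gr c ≤ M.gr (c - γ + γ)
      rw [sub_add_cancel]

end Regrade

end Regrade

/-! ### Strict invariance and the biproduct condition -/

section InvariantOfEq

variable {C D : Type*} [Category* C] [Category* D] {Γ : Type*} [AddMonoid Γ] [HasShift C Γ]

/-- A functor that is strictly invariant under a strict action is invariant. -/
def Invariant.ofEq {F : C ⥤ D} (h₀ : shiftFunctor C (0 : Γ) = 𝟭 C)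
    (h₁ : ∀ γ δ : Γ, shiftFunctor C (γ + δ) = shiftFunctor C γ ⋙ shiftFunctor C δ)
    (h : ∀ γ : Γ, shiftFunctor C γ ⋙ F = F) (e₀ : shiftFunctorZero C Γ = eqToIso h₀)
    (e₁ : ∀ γ δ : Γ, shiftFunctorAdd C γ δ = eqToIso (h₁ γ δ)) : Invariant Γ F where
  iso γ := eqToIso (h γ)
  iso_zero X := by
    rw [e₀]
    simp [eqToHom_app, eqToHom_map]
  iso_add γ δ X := by
    rw [e₁]
    simp [eqToHom_app, eqToHom_map]

/-- The morphisms `η` and `p` present the objects `G (F X)` as the biproducts of the twists of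
`X`. -/
structure Invariant.IsOrbitSum {Γ : Type*} [AddMonoid Γ] [HasShift C Γ] [Preadditive C] [Fintype Γ]
    {F : C ⥤ D} (I : Invariant Γ F) (G : D ⥤ C) (η : ∀ X : C, X ⟶ G.obj (F.obj X))
    (p : ∀ (γ : Γ) (X : C), G.obj (F.obj X) ⟶ X⟦γ⟧) : Prop where
  comp_same : ∀ γ X, (η (X⟦γ⟧) ≫ G.map ((I.iso γ).hom.app X)) ≫ p γ X = 𝟙 _
  comp_of_ne : ∀ γ δ X, γ ≠ δ → (η (X⟦γ⟧) ≫ G.map ((I.iso γ).hom.app X)) ≫ p δ X = 0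
  sum_comp : ∀ X, ∑ γ, p γ X ≫ η (X⟦γ⟧) ≫ G.map ((I.iso γ).hom.app X) = 𝟙 _

end InvariantOfEq

/-! ### The induced module of a restriction is the biproduct of the twists -/

section InducedRestriction

variable {k : Type uk} [CommRing k] {R : Type uR} [CommRing R] [Algebra k R]
  {A : Type uA} [AddCommGroup A] {B : Type uB} [AddCommGroup B]
  {𝓐 : A → Submodule k R} {π : A →+ B} {a : A} {W : R}

open GrMod Fac

namespace GrMod

variable [DecidableEq A] [GradedAlgebra 𝓐] [Finite π.ker]

section Proj

variable (s : Regrade.{uk, uR, uA, uB, max uk uA} 𝓐 a (coarse π 𝓐) (π a))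
  (M : GrMod.{uk, uR, uA, max uk uA} 𝓐)

lemma mem_ind_gr_of_val {γ d : A} {m : M} {y : (s.mod M).ind π}
    (hy : ∀ c, (s.mod M).val y c = M.comp m (c + γ)) (hm : m ∈ M.gr d) :
    y ∈ ((s.mod M).ind π).gr (d - γ) := by
  rw [mem_ind_gr]
  intro c hc
  rw [hy]
  exact M.comp_of_ne hm fun h => hc (eq_sub_of_add_eq h)

section

variable {s M} {γ δ : A} {j : M →ₗ[R] (s.mod M).ind π} {q : (s.mod M).ind π →ₗ[R] M}
  (hj : ∀ m c, @Eq M ((s.mod M).val (j m) c) (M.comp m (c + γ)))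
  (hq : ∀ d, ∀ y ∈ ((s.mod M).ind π).gr d, q y = M.comp ((s.mod M).val y d) (d + δ))

include hj hq

/-- For m of degree d, the family j m has the single entry m at d - γ, from which q extracts the
component of degree d - γ + δ = d. Stating this by formulas for j and q serves both components of a
factorization. -/
lemma proj_same (h : γ = δ) (m : M) : q (j m) = m := by
  subst h
  induction m using M.homog_induction with
  | h d m hm =>
    rw [hq _ _ (M.mem_ind_gr_of_val s (hj m) hm), hj, sub_add_cancel, M.comp_same hm]
    exact M.comp_same hm
  | h₀ => rw [map_zero, map_zero]
  | hadd y z hy hz =>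
    rw [map_add, map_add, hy, hz]

/-- The single entry m of degree d sits at d - γ, and q extracts its component in the degree d - γ +
δ, which differs from d. -/
lemma proj_of_ne (h : γ ≠ δ) (m : M) : q (j m) = 0 := by
  induction m using M.homog_induction with
  | h d m hm =>
    rw [hq _ _ (M.mem_ind_gr_of_val s (hj m) hm), hj, sub_add_cancel, M.comp_same hm]
    refine M.comp_of_ne hm fun e => h ?_
    rw [sub_add_eq_add_sub, sub_eq_iff_eq_add] at e
    exact (add_left_cancel e).symm
  | h₀ => rw [map_zero, map_zero]
  | hadd y z hy hz => rw [map_add, map_add, hy, hz, add_zero]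

end

variable (hs : ∀ (M : GrMod.{uk, uR, uA, max uk uA} 𝓐) b, s.gr M b = coarse π M.gr b)
include hs

/-- The fibre of π through c is c + Γ, so these are all the fine components that an element of
coarse degree π c can have. -/
lemma sum_comp_ker {Γ : AddSubgroup A} [Fintype Γ] (hΓ : ∀ c, π c = 0 ↔ c ∈ Γ) {c : A} {m : M}
    (hm : m ∈ (s.mod M).gr (π c)) : ∑ γ : Γ, M.comp m (c + γ) = m := by
  change m ∈ s.gr M (π c) at hm
  rw [hs] at hm
  refine coarse_induction (P := fun m => ∑ γ : Γ, M.comp m (c + γ) = m) hm ?_ ?_ ?_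
  · intro d hd m hm
    have hdc : d - c ∈ Γ := (hΓ _).1 (by rw [map_sub, hd, sub_self])
    -- For m homogeneous of degree d, only the translation from c to d contributes.
    rw [Finset.sum_eq_single ⟨d - c, hdc⟩]
    · rw [add_sub_cancel, M.comp_same hm]
    · intro γ _ hγ
      exact M.comp_of_ne hm fun h => hγ (Subtype.ext (eq_sub_of_add_eq' h))
    · exact fun h => (h (Finset.mem_univ _)).elim
  · simp
  · intro m n hm hn
    simp only [map_add, Finsupp.add_apply, Finset.sum_add_distrib, hm, hn]

/-- For y concentrated at d, the entry at d of the sum is the decomposition of the entry of y into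
its components of degrees d + γ. At c ≠ d one would need c + γ = d + γ, so nothing appears. -/
lemma sum_proj {Γ : AddSubgroup A} [Fintype Γ] (hΓ : ∀ c, π c = 0 ↔ c ∈ Γ)
    {j : Γ → (M →ₗ[R] (s.mod M).ind π)} {q : Γ → ((s.mod M).ind π →ₗ[R] M)}
    (hj : ∀ γ m c, @Eq M ((s.mod M).val (j γ m) c) (M.comp m (c + γ)))
    (hq : ∀ γ d, ∀ y ∈ ((s.mod M).ind π).gr d, q γ y = M.comp ((s.mod M).val y d) (d + γ))
    (y : (s.mod M).ind π) : ∑ γ : Γ, j γ (q γ y) = y := by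
  induction y using ((s.mod M).ind π).homog_induction with
  | h d y hy =>
    refine ind_ext fun c => ?_
    rw [map_sum, Finsupp.finsetSum_apply]
    simp only [hj, hq _ _ _ hy]
    by_cases hc : c = d
    · subst hc
      refine Eq.trans (Finset.sum_congr rfl fun γ _ => ?_)
        (M.sum_comp_ker s hs hΓ ((s.mod M).val_mem y c))
      exact M.comp_same (M.comp_mem _ _)
    · rw [(mem_ind_gr _ _ _).1 hy c hc]
      refine Finset.sum_eq_zero fun γ _ => ?_
      exact M.comp_of_ne (M.comp_mem _ _) fun h => hc (add_right_cancel h)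
  | h₀ => simp
  | hadd y z hy hz => simp only [map_add, Finset.sum_add_distrib, hy, hz]

end Proj

end GrMod

namespace Fac

variable {Γ : AddSubgroup A} (hΓ : ∀ c, π c = 0 ↔ c ∈ Γ)

variable (W) in
/-- A regrading that does not see twists by `Γ` is invariant under them. -/
def regradeInvariant {𝓑 : B → Submodule k R} {b : B} (s : Regrade.{uk, uR, uA, uB, x} 𝓐 a 𝓑 b)
    (h : ∀ γ : Γ, (twist 𝓐 a (γ : A)).trans s = s) : Invariant Γ (s.fac W) :=
  Invariant.ofEq twist_zero (fun γ δ => twist_add (γ : A) δ)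
    (fun γ => congrArg (Regrade.fac W) (h γ)) rfl (fun _ _ => rfl)

/-- The invariance comes from an equality of regradings, so its value at E is transport along an
equality of factorizations. -/
lemma regradeInvariant_hom_app {𝓑 : B → Submodule k R} {b : B}
    (s : Regrade.{uk, uR, uA, uB, x} 𝓐 a 𝓑 b) (h : ∀ γ : Γ, (twist 𝓐 a (γ : A)).trans s = s)
    (γ : Γ) (E : Fac.{uk, uR, uA, x} 𝓐 a W) (h') :
    ((regradeInvariant W s h).iso γ).hom.app E =
      (eqToHom h' : ((twist 𝓐 a (γ : A)).trans s).facObj E ⟶ s.facObj E) :=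
  eqToHom_app (congrArg (Regrade.fac W) (h γ)) E

include hΓ in
lemma twist_trans_coarsen (γ : Γ) :
    (twist.{uk, uR, uA, x} 𝓐 a (γ : A)).trans (coarsen 𝓐 a π) = coarsen 𝓐 a π :=
  Regrade.twist_trans_coarsen ((hΓ _).2 γ.2)

variable [DecidableEq A] [GradedAlgebra 𝓐] [Finite π.ker] (hW : W ∈ 𝓐 a)
  (E : Fac.{uk, uR, uA, max uk uA} 𝓐 a W)

section EqToHom

variable {r s : Regrade.{uk, uR, uA, uB, max uk uA} 𝓐 a (coarse π 𝓐) (π a)} (h : r = s)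
  {G : Fac.{uk, uR, uA, max uk uA} 𝓐 a W} (u : G ⟶ (ind π hW).obj (r.facObj E))
  (h' : r.facObj E = s.facObj E)

-- After substituting the equality of regradings the transport is an identity, so it leaves entries
-- unchanged. This is why the regradings are variables here.
include h in
lemma val_comp_ind_eqToHom₁ (m : G.X₁) (c : A) :
    (s.mod E.X₁).val (f₁ (E := G) (F := indObj hW (s.facObj E))
      (u ≫ (ind π hW).map (eqToHom h')) m) c =
    (r.mod E.X₁).val (f₁ (F := indObj hW (r.facObj E)) u m) c := by
  subst h
  exact val_indMap₀ (M := r.mod E.X₁) (N := r.mod E.X₁) _ (𝟙 (r.facObj E) : _ ⟶ _).2.1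
    (f₁ (F := indObj hW (r.facObj E)) u m) c

include h in
lemma val_comp_ind_eqToHom₀ (m : G.X₀) (c : A) :
    (s.mod E.X₀).val (f₀ (E := G) (F := indObj hW (s.facObj E))
      (u ≫ (ind π hW).map (eqToHom h')) m) c =
    (r.mod E.X₀).val (f₀ (F := indObj hW (r.facObj E)) u m) c := by
  subst h
  exact val_indMap₀ (M := r.mod E.X₀) (N := r.mod E.X₀) _ (𝟙 (r.facObj E) : _ ⟶ _).2.2.1
    (f₀ (F := indObj hW (r.facObj E)) u m) c

end EqToHom

section Twists

/-- The component of a morphism in degree `-1`, as an additive map. -/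
def f₁Hom {F E : Fac.{uk, uR, uA, x} 𝓐 a W} (m : E.X₁) : (E ⟶ F) →+ F.X₁ :=
  AddMonoidHom.mk' (fun f => f₁ f m) fun f g => add_f₁ f g m

/-- The component of a morphism in degree `0`, as an additive map. -/
def f₀Hom {F E : Fac.{uk, uR, uA, x} 𝓐 a W} (m : E.X₀) : (E ⟶ F) →+ F.X₀ :=
  AddMonoidHom.mk' (fun f => f₀ f m) fun f g => add_f₀ f g m

variable (s : Regrade.{uk, uR, uA, uB, max uk uA} 𝓐 a (coarse π 𝓐) (π a)) (γ : Γ)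

/-- The morphism `u` lists the homogeneous components. -/
structure IsTwistUnit (u : E⟦γ⟧ ⟶ (ind π hW).obj ((s.fac W).obj (E⟦γ⟧))) : Prop where
  val₁ : ∀ (m : E.X₁) (c : A), @Eq E.X₁ ((s.mod ((twist 𝓐 a (γ : A)).mod E.X₁)).val
    (f₁ (E := (twist 𝓐 a (γ : A)).facObj E)
      (F := indObj hW (s.facObj ((twist 𝓐 a (γ : A)).facObj E))) u m) c) (E.X₁.comp m (c + γ))
  val₀ : ∀ (m : E.X₀) (c : A), @Eq E.X₀ ((s.mod ((twist 𝓐 a (γ : A)).mod E.X₀)).val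
    (f₀ (E := (twist 𝓐 a (γ : A)).facObj E)
      (F := indObj hW (s.facObj ((twist 𝓐 a (γ : A)).facObj E))) u m) c) (E.X₀.comp m (c + γ))

/-- The morphism `p` is the projection to the entries that are shifted by `γ`. -/
structure IsTwistProj (p : (ind π hW).obj ((s.fac W).obj E) ⟶ E⟦γ⟧) : Prop where
  val₁ : ∀ d, ∀ y ∈ ((s.mod E.X₁).ind π).gr d, @Eq E.X₁ (f₁ (E := indObj hW (s.facObj E))
    (F := (twist 𝓐 a (γ : A)).facObj E) p y) (E.X₁.comp ((s.mod E.X₁).val y d) (d + γ))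
  val₀ : ∀ d, ∀ y ∈ ((s.mod E.X₀).ind π).gr d, @Eq E.X₀ (f₀ (E := indObj hW (s.facObj E))
    (F := (twist 𝓐 a (γ : A)).facObj E) p y) (E.X₀.comp ((s.mod E.X₀).val y d) (d + γ))

variable {hW E s} (hs : ∀ γ : Γ, (twist 𝓐 a (γ : A)).trans s = s)
  {u : ∀ γ : Γ, E⟦γ⟧ ⟶ (ind π hW).obj ((s.fac W).obj (E⟦γ⟧))} (hu : ∀ γ, IsTwistUnit hW E s γ (u γ))
  {p : ∀ γ : Γ, (ind π hW).obj ((s.fac W).obj E) ⟶ E⟦γ⟧} (hp : ∀ γ, IsTwistProj hW E s γ (p γ))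

include hu

/-- The invariance isomorphism does nothing to underlying elements, so the composite still lists
components shifted by γ; this is the inclusion of the summand E(γ). -/
lemma IsTwistUnit.val_comp₁ (γ : Γ) (m : E.X₁) (c : A) : @Eq E.X₁
    ((s.mod E.X₁).val (f₁ (E := (twist 𝓐 a (γ : A)).facObj E) (F := indObj hW (s.facObj E))
      (u γ ≫ (ind π hW).map (((regradeInvariant W s hs).iso γ).hom.app E)) m) c)
    (E.X₁.comp m (c + γ)) := by
  refine Eq.trans ?_ ((hu γ).val₁ m c)
  have h' := congrArg (fun r => Regrade.facObj r E) (hs γ)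
  rw [regradeInvariant_hom_app s hs γ E h']
  exact val_comp_ind_eqToHom₁ hW E (hs γ) (u γ) h' m c

lemma IsTwistUnit.val_comp₀ (γ : Γ) (m : E.X₀) (c : A) : @Eq E.X₀
    ((s.mod E.X₀).val (f₀ (E := (twist 𝓐 a (γ : A)).facObj E) (F := indObj hW (s.facObj E))
      (u γ ≫ (ind π hW).map (((regradeInvariant W s hs).iso γ).hom.app E)) m) c)
    (E.X₀.comp m (c + γ)) := by
  refine Eq.trans ?_ ((hu γ).val₀ m c)
  have h' := congrArg (fun r => Regrade.facObj r E) (hs γ)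
  rw [regradeInvariant_hom_app s hs γ E h']
  exact val_comp_ind_eqToHom₀ hW E (hs γ) (u γ) h' m c

include hp

lemma comp_proj_same (γ : Γ) :
    (u γ ≫ (ind π hW).map (((regradeInvariant W s hs).iso γ).hom.app E)) ≫ p γ = 𝟙 _ :=
  hom_ext (fun m => GrMod.proj_same (M := E.X₁) (IsTwistUnit.val_comp₁ hs hu γ) (hp γ).val₁ rfl m)
    (fun m => GrMod.proj_same (M := E.X₀) (IsTwistUnit.val_comp₀ hs hu γ) (hp γ).val₀ rfl m)

lemma comp_proj_of_ne {γ δ : Γ} (h : γ ≠ δ) :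
    (u γ ≫ (ind π hW).map (((regradeInvariant W s hs).iso γ).hom.app E)) ≫ p δ = 0 :=
  hom_ext (fun m => GrMod.proj_of_ne (M := E.X₁) (IsTwistUnit.val_comp₁ hs hu γ) (hp δ).val₁
      (fun e => h (Subtype.ext e)) m)
    (fun m => GrMod.proj_of_ne (M := E.X₀) (IsTwistUnit.val_comp₀ hs hu γ) (hp δ).val₀
      (fun e => h (Subtype.ext e)) m)

include hΓ in
lemma sum_proj_comp [Fintype Γ]
    (hs' : ∀ (M : GrMod.{uk, uR, uA, max uk uA} 𝓐) b, s.gr M b = coarse π M.gr b) :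
    ∑ γ, p γ ≫ u γ ≫ (ind π hW).map (((regradeInvariant W s hs).iso γ).hom.app E) = 𝟙 _ :=
  hom_ext
    (fun m => (map_sum (f₁Hom (F := indObj hW (s.facObj E)) (E := indObj hW (s.facObj E)) m)
      _ _).trans (E.X₁.sum_proj s hs' hΓ (IsTwistUnit.val_comp₁ hs hu) (fun γ => (hp γ).val₁) m))
    (fun m => (map_sum (f₀Hom (F := indObj hW (s.facObj E)) (E := indObj hW (s.facObj E)) m)
      _ _).trans (E.X₀.sum_proj s hs' hΓ (IsTwistUnit.val_comp₀ hs hu) (fun γ => (hp γ).val₀) m))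

omit hu hp in
include hΓ in
lemma isOrbitSum [Fintype Γ] {u : ∀ E, E ⟶ (ind π hW).obj ((s.fac W).obj E)}
    {p : ∀ (γ : Γ) (E), (ind π hW).obj ((s.fac W).obj E) ⟶ E⟦γ⟧}
    (hu : ∀ E (γ : Γ), IsTwistUnit hW E s γ (u (E⟦γ⟧))) (hp : ∀ E γ, IsTwistProj hW E s γ (p γ E))
    (hs' : ∀ (M : GrMod.{uk, uR, uA, max uk uA} 𝓐) b, s.gr M b = coarse π M.gr b) :
    (regradeInvariant W s hs).IsOrbitSum (ind π hW) u p where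
  comp_same γ E := comp_proj_same hs (hu E) (hp E) γ
  comp_of_ne γ δ E h := comp_proj_of_ne hs (hu E) (hp E) h
  sum_comp E := sum_proj_comp hΓ hs (hu E) (hp E) hs'

end Twists

lemma val_unitApp₁ (m : E.X₁) (c : A) : @Eq E.X₁ (((coarsen 𝓐 a π).mod E.X₁).val
    (f₁ (F := indObj hW ((coarsen 𝓐 a π).facObj E)) (unitApp π hW E) m) c) (E.X₁.comp m c) := rfl

lemma val_unitApp₀ (m : E.X₀) (c : A) : @Eq E.X₀ (((coarsen 𝓐 a π).mod E.X₀).val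
    (f₀ (F := indObj hW ((coarsen 𝓐 a π).facObj E)) (unitApp π hW E) m) c) (E.X₀.comp m c) := rfl

/-- The unit lists components, and the component of degree c in the twist is the one of degree c + γ
in E. -/
lemma isTwistUnit_unitApp (γ : Γ) :
    IsTwistUnit hW E (coarsen 𝓐 a π) γ (unitApp π hW (E⟦γ⟧)) where
  val₁ m c := (val_unitApp₁ hW ((twist 𝓐 a (γ : A)).facObj E) m c).trans (E.X₁.comp_tw γ m c)
  val₀ m c := (val_unitApp₀ hW ((twist 𝓐 a (γ : A)).facObj E) m c).trans (E.X₀.comp_tw γ m c)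

/-- The projection from `ind (res E)` to the twist by `γ`. -/
noncomputable def shiftProj (γ : Γ) :
    (ind π hW).obj (((coarsen 𝓐 a π).fac W).obj E) ⟶ E⟦γ⟧ :=
  proj π hW (γ : A) E

lemma isTwistProj_shiftProj (γ : Γ) :
    IsTwistProj hW E (coarsen 𝓐 a π) γ (shiftProj hW E γ) where
  val₁ d y hy := E.X₁.proj_of_mem π a γ hy
  val₀ d y hy := E.X₀.proj_of_mem π a γ hy

lemma isOrbitSum_coarsen [Fintype Γ] :
    (regradeInvariant W (coarsen 𝓐 a π) (twist_trans_coarsen hΓ)).IsOrbitSum (ind π hW)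
      (unitApp π hW) (fun γ E => shiftProj hW E γ) :=
  isOrbitSum hΓ (twist_trans_coarsen hΓ) (isTwistUnit_unitApp hW) (isTwistProj_shiftProj hW)
    fun _ _ => rfl

end Fac

end InducedRestriction

/-! ### Descent of invariance and biproducts along squares of functors -/

section InducedInvariance

universe v v' u u' w

variable {C₀ D₀ : Type*} [Category* C₀] [Category* D₀] {C : Type u} [Category.{v} C]
  {D : Type u'} [Category.{v'} D]
  {L : C₀ ⥤ C} {L' : D₀ ⥤ D} {F₀ : C₀ ⥤ D₀} {G₀ : D₀ ⥤ C₀} {F : C ⥤ D} {G : D ⥤ C}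

/-- Retracts of objects in the image descend along a commutative square of functors. -/
lemma nonempty_retract_of_iso (eF : L ⋙ F ≅ F₀ ⋙ L')
    (h : ∀ Y : D₀, ∃ X, Nonempty (Retract Y (F₀.obj X)))
    (hL' : ∀ Y : D, ∃ Y₀, L'.obj Y₀ = Y) (Y : D) : ∃ X, Nonempty (Retract Y (F.obj X)) := by
  obtain ⟨Y, rfl⟩ := hL' Y
  obtain ⟨X, ⟨r⟩⟩ := h Y
  exact ⟨L.obj X, ⟨(r.map L').trans (Retract.ofIso (eF.symm.app X))⟩⟩

variable {Γ : Type w} [AddGroup Γ] [HasShift C₀ Γ] [HasShift C Γ] [L.CommShift Γ]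
  [((Functor.whiskeringLeft C₀ C D).obj L).Full]
  [((Functor.whiskeringLeft C₀ C D).obj L).Faithful]

/-- Invariance descends along a commutative square of functors. -/
noncomputable def Invariant.descend (I : Invariant Γ F₀) (eF : L ⋙ F ≅ F₀ ⋙ L') : Invariant Γ F :=
  ((I.comp L').ofIso eF.symm).ofComp

lemma Invariant.descend_hom_app (I : Invariant Γ F₀) (eF : L ⋙ F ≅ F₀ ⋙ L') (γ : Γ) (X : C₀) :
    ((I.descend eF).iso γ).hom.app (L.obj X) = F.map ((L.commShiftIso γ).inv.app X) ≫
      eF.hom.app (X⟦γ⟧) ≫ L'.map ((I.iso γ).hom.app X) ≫ eF.inv.app X :=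
  ((I.comp L').ofIso eF.symm).ofCompIso_hom_app γ X

section Adjoint

variable (adj : F ⊣ G) (I : Invariant Γ F₀) (eF : L ⋙ F ≅ F₀ ⋙ L') (eG : L' ⋙ G ≅ G₀ ⋙ L)
  {η : ∀ X : C₀, X ⟶ G₀.obj (F₀.obj X)}
  (hη : ∀ X, adj.unit.app (L.obj X) ≫ G.map (eF.hom.app X) ≫ eG.hom.app (F₀.obj X) = L.map (η X))

variable (L F₀ G₀ F G) in
/-- The comparison isomorphism for the endofunctors that are given by two squares of functors. -/
def squareIso (eF : L ⋙ F ≅ F₀ ⋙ L') (eG : L' ⋙ G ≅ G₀ ⋙ L) (X : C₀) :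
    G.obj (F.obj (L.obj X)) ≅ L.obj (G₀.obj (F₀.obj X)) :=
  G.mapIso (eF.app X) ≪≫ eG.app (F₀.obj X)

-- Up to the comparison isomorphisms, the adjoint of the descended isomorphism is the image under L
-- of the inclusion upstairs. The biproduct relations can therefore be checked before localizing.
include hη in
lemma Invariant.homEquiv_descend (γ : Γ) (X : C₀) :
    adj.homEquiv _ _ (((I.descend eF).iso γ).hom.app (L.obj X)) =
      ((L.commShiftIso γ).app X).inv ≫ L.map (η (X⟦γ⟧) ≫ G₀.map ((I.iso γ).hom.app X)) ≫
        (squareIso L F₀ G₀ F G eF eG X).inv := by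
  rw [descend_hom_app, adj.homEquiv_naturality_left]
  refine congrArg (_ ≫ ·) ?_
  refine (adj.homEquiv_unit (L.obj (X⟦γ⟧)) _ _).trans ?_
  -- The compatibility of the units, solved for the part of the transpose that precedes the
  -- naturality square of `eG`.
  have hη' (X : C₀) : adj.unit.app (L.obj X) ≫ G.map (eF.hom.app X) =
      L.map (η X) ≫ eG.inv.app (F₀.obj X) := by
    rw [← hη]
    simp
  have hn := eG.inv.naturality ((I.iso γ).hom.app X)
  change L.map (G₀.map _) ≫ _ = _ ≫ G.map (L'.map _) at hn
  rw [G.map_comp, G.map_comp]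
  refine (reassoc_of% (hη' (X⟦γ⟧)))
    (G.map (L'.map ((I.iso γ).hom.app X)) ≫ G.map (eF.inv.app X)) |>.trans ?_
  rw [L.map_comp, Category.assoc]
  refine congrArg (_ ≫ ·) ?_
  exact ((reassoc_of% hn) (G.map (eF.inv.app X))).symm

variable [Preadditive C₀] [Preadditive C] [Preadditive D] [F.Additive] [L.Additive] [Fintype Γ]
  [∀ γ : Γ, (shiftFunctor C γ).Additive] {p : ∀ (γ : Γ) (X : C₀), G₀.obj (F₀.obj X) ⟶ X⟦γ⟧}
  (h : I.IsOrbitSum G₀ η p)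
  (hL : ∀ X : C, ∃ X₀, L.obj X₀ = X)

include hη h hL in
/-- If `G₀(F₀(X))` is the biproduct of the objects `γ X`, then the orbit functor of the descended
functor is bijective on morphisms. -/
lemma Invariant.orbitHom_descend_bijective (X Y : C) :
    Function.Bijective ((I.descend eF).orbitHom X Y) := by
  obtain ⟨Y, rfl⟩ := hL Y
  refine (I.descend eF).orbitHom_bijective adj (fun γ => (squareIso L F₀ G₀ F G eF eG Y).hom ≫
    L.map (p γ Y) ≫ ((L.commShiftIso γ).app Y).hom) (fun γ => ?_) (fun γ δ hγ => ?_) ?_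
  · rw [I.homEquiv_descend adj eF eG hη, Category.assoc, Category.assoc, Iso.inv_hom_id_assoc,
      ← L.map_comp_assoc, h.comp_same, L.map_id, Category.id_comp]
    exact Iso.inv_hom_id _
  · rw [I.homEquiv_descend adj eF eG hη, Category.assoc, Category.assoc, Iso.inv_hom_id_assoc,
      ← L.map_comp_assoc, h.comp_of_ne _ _ _ hγ, L.map_zero, zero_comp, comp_zero]
  · simp only [I.homEquiv_descend adj eF eG hη, Category.assoc, Iso.hom_inv_id_assoc]
    simp only [← L.map_comp_assoc]
    rw [← Preadditive.comp_sum, ← Preadditive.sum_comp, ← L.map_sum, h.sum_comp, L.map_id,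
      Category.id_comp,
      Iso.hom_inv_id]

end Adjoint

end InducedInvariance

/-! ### Adjunctions induced on localizations -/

section LocalizedAdjunction

variable {C₁ C₂ D₁ D₂ : Type*} [Category* C₁] [Category* C₂] [Category* D₁] [Category* D₂]
  {F : C₁ ⥤ C₂} {G : C₂ ⥤ C₁} (adj : F ⊣ G) {L₁ : C₁ ⥤ D₁} (W₁ : MorphismProperty C₁)
  [L₁.IsLocalization W₁] {L₂ : C₂ ⥤ D₂} (W₂ : MorphismProperty C₂) [L₂.IsLocalization W₂]
  {F' : D₁ ⥤ D₂} {G' : D₂ ⥤ D₁} (e : L₁ ⋙ F' ≅ F ⋙ L₂) (e' : L₂ ⋙ G' ≅ G ⋙ L₁)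

/-- The adjunction of the functors that an adjunction induces on localizations. -/
noncomputable def localizedAdjunction : F' ⊣ G' :=
  letI : CatCommSq F L₁ L₂ F' := ⟨e.symm⟩
  letI : CatCommSq G L₂ L₁ G' := ⟨e'.symm⟩
  adj.localization L₁ W₁ L₂ W₂ F' G'

/-- This compatibility of units is what `Invariant.orbitHom_descend_bijective` requires as `hη`. -/
lemma localizedAdjunction_unit (X : C₁) :
    (localizedAdjunction adj W₁ W₂ e e').unit.app (L₁.obj X) ≫ G'.map (e.hom.app X) ≫
      e'.hom.app (F.obj X) = L₁.map (adj.unit.app X) := by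
  let : CatCommSq F L₁ L₂ F' := ⟨e.symm⟩
  let : CatCommSq G L₂ L₁ G' := ⟨e'.symm⟩
  have h : (localizedAdjunction adj W₁ W₂ e e').unit.app (L₁.obj X) =
      L₁.map (adj.unit.app X) ≫ e'.inv.app (F.obj X) ≫ G'.map (e.inv.app X) :=
    adj.localization_unit_app L₁ W₁ L₂ W₂ F' G' X
  rw [h]
  simp only [Category.assoc]
  rw [← G'.map_comp_assoc, Iso.inv_hom_id_app]
  simp

end LocalizedAdjunction

/-! ### Exactness of functors on a localization -/

section ExactLocalization

variable {C D E : Type*} [Category* C] [Category* D] [Category* E]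
  [HasShift C ℤ] [HasShift D ℤ] [HasShift E ℤ]
  [HasZeroObject C] [HasZeroObject D] [HasZeroObject E]
  [Preadditive C] [Preadditive D] [Preadditive E]
  [∀ n : ℤ, (shiftFunctor C n).Additive] [∀ n : ℤ, (shiftFunctor D n).Additive]
  [∀ n : ℤ, (shiftFunctor E n).Additive]
  [Pretriangulated C] [Pretriangulated D] [Pretriangulated E]

/-- A functor on a localization is exact if its composition with the localization functor is. -/
lemma exists_isTriangulated_of_localization {L : C ⥤ D} (W : MorphismProperty C)
    [L.IsLocalization W] [L.CommShift ℤ] [L.IsTriangulated] [L.mapArrow.EssSurj]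
    [W.IsCompatibleWithShift ℤ]
    {G : D ⥤ E} {H : C ⥤ E} [H.CommShift ℤ] [H.IsTriangulated] (e : L ⋙ G ≅ H) :
    ∃ _ : G.CommShift ℤ, G.IsTriangulated := by
  let : Localization.Lifting L W H G := ⟨e⟩
  let := Functor.commShiftOfLocalization L W ℤ H G
  refine ⟨inferInstance, ?_⟩
  -- The comparison isomorphism respects shifts, so it carries the distinguished triangles obtained
  -- from H to those obtained from L and G.
  have : NatTrans.CommShift e.hom ℤ := NatTrans.commShift_iso_hom_of_localization L W ℤ H G
  exact Functor.isTriangulated_of_precomp_iso e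

end ExactLocalization

/-! ### Restriction and twists are exact and linear on the derived category -/

section Exactness

variable {k : Type uk} [CommRing k] {R : Type uR} [CommRing R] [Algebra k R]
  {A : Type uA} [AddCommGroup A] {B : Type uB} [AddCommGroup B]
  {𝓐 : A → Submodule k R} {a : A} {𝓑 : B → Submodule k R} {b : B} {W : R}

open GrMod Fac

namespace Regrade

variable (r : Regrade.{uk, uR, uA, uB, x} 𝓐 a 𝓑 b)

variable (W) in
/-- `dabs` is induced by `ho`. -/
noncomputable def dabsIso : loc 𝓐 a W ⋙ r.dabs W ≅ r.ho W ⋙ loc 𝓑 b W :=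
  Localization.fac _ _ _

/-- Regrading is already exact on homotopy categories, and arrows of the Verdier quotient lift up to
isomorphism, so exactness passes to the quotient. -/
lemma exists_isTriangulated_dabs :
    ∃ _ : (r.dabs W).CommShift ℤ, (r.dabs W).IsTriangulated :=
  have : (loc 𝓐 a W).mapArrow.EssSurj := Localization.essSurj_mapArrow _ (acyclic 𝓐 a W).trW
  exists_isTriangulated_of_localization (acyclic 𝓐 a W).trW (r.dabsIso W)

/-- Morphisms lift to factorizations, where regrading keeps the underlying linear maps. -/
instance : (r.ho W).Additive where
  map_add {E F} f g := by
    obtain ⟨f, rfl⟩ := (HoFac.quot 𝓐 a W).map_surjective f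
    obtain ⟨g, rfl⟩ := (HoFac.quot 𝓐 a W).map_surjective g
    rfl

instance : (r.ho W).Linear k where
  map_smul {E F} f s := by
    obtain ⟨f, rfl⟩ := (HoFac.quot 𝓐 a W).map_surjective f
    rfl

instance : (r.dabs W).Additive := by
  rw [Localization.functor_additive_iff (loc 𝓐 a W) (acyclic 𝓐 a W).trW]
  exact Functor.additive_of_iso (r.dabsIso W).symm

instance : (r.dabs W).Linear k := by
  have : Localization.Lifting (loc 𝓐 a W) (acyclic 𝓐 a W).trW (r.ho W ⋙ loc 𝓑 b W) (r.dabs W) :=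
    ⟨r.dabsIso W⟩
  exact (Localization.functor_linear_iff (loc 𝓐 a W) (acyclic 𝓐 a W).trW k
    (r.ho W ⋙ loc 𝓑 b W) (r.dabs W)).1 inferInstance

end Regrade

variable {Γ : AddSubgroup A}

/-- The action of γ is induced by a twist, which is a regrading and therefore exact on the homotopy
category. -/
lemma exists_isTriangulated_shiftFunctor (γ : Γ) :
    ∃ _ : (shiftFunctor (DAbs.{uk, uR, uA, x} 𝓐 a W) γ).CommShift ℤ,
      (shiftFunctor (DAbs.{uk, uR, uA, x} 𝓐 a W) γ).IsTriangulated :=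
  have : (loc 𝓐 a W).mapArrow.EssSurj := Localization.essSurj_mapArrow _ (acyclic 𝓐 a W).trW
  exists_isTriangulated_of_localization (acyclic 𝓐 a W).trW
    (((loc 𝓐 a W).commShiftIso γ).symm ≪≫ Functor.isoWhiskerRight (shiftIsoTwist γ) (loc 𝓐 a W))

end Exactness

/-! ### Restriction and induction on the absolute derived categories -/

section Cover

variable {k : Type uk} [CommRing k] {R : Type uR} [CommRing R] [Algebra k R]
  {A : Type uA} [AddCommGroup A] {B : Type uB} [AddCommGroup B]
  {𝓐 : A → Submodule k R} {π : A →+ B} {a : A} {W : R}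

open GrMod Fac

variable (𝓐 a W) in
/-- The functor from factorizations to the absolute derived category. -/
noncomputable abbrev facLoc : Fac.{uk, uR, uA, x} 𝓐 a W ⥤ DAbs.{uk, uR, uA, x} 𝓐 a W :=
  HoFac.quot 𝓐 a W ⋙ loc 𝓐 a W

/-- Neither the quotient by homotopy nor the localization changes the objects. -/
lemma facLoc_obj_surjective (X : DAbs.{uk, uR, uA, x} 𝓐 a W) : ∃ E, (facLoc 𝓐 a W).obj E = X := by
  obtain ⟨⟨E⟩, h⟩ := (Localization.Construction.objEquiv (acyclic 𝓐 a W).trW).surjective X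
  exact ⟨E, h⟩

/-- Precomposition with a quotient functor and with a localization functor is fully faithful. This
permits natural transformations on the derived category to be defined and compared on
factorizations. -/
instance {D : Type*} [Category* D] : ((Functor.whiskeringLeft _ _ D).obj
    (facLoc.{uk, uR, uA, x} 𝓐 a W)).Full :=
  have : ((Functor.whiskeringLeft _ _ D).obj (loc 𝓐 a W)).Full :=
    Localization.full_whiskeringLeft _ (acyclic 𝓐 a W).trW D
  inferInstanceAs ((Functor.whiskeringLeft _ _ D).obj (loc 𝓐 a W) ⋙
    (Functor.whiskeringLeft _ _ D).obj (HoFac.quot 𝓐 a W)).Full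

instance {D : Type*} [Category* D] : ((Functor.whiskeringLeft _ _ D).obj
    (facLoc.{uk, uR, uA, x} 𝓐 a W)).Faithful :=
  have : ((Functor.whiskeringLeft _ _ D).obj (loc 𝓐 a W)).Faithful :=
    Localization.faithful_whiskeringLeft _ (acyclic 𝓐 a W).trW D
  inferInstanceAs ((Functor.whiskeringLeft _ _ D).obj (loc 𝓐 a W) ⋙
    (Functor.whiskeringLeft _ _ D).obj (HoFac.quot 𝓐 a W)).Faithful

/-- Restriction commutes with the functors to the absolute derived categories. -/
noncomputable def facLocResIso : facLoc.{uk, uR, uA, x} 𝓐 a W ⋙ res 𝓐 a W π ≅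
    (coarsen 𝓐 a π).fac W ⋙ facLoc (coarse π 𝓐) (π a) W :=
  Functor.isoWhiskerLeft (HoFac.quot 𝓐 a W) ((coarsen 𝓐 a π).dabsIso W)

variable [DecidableEq A] [GradedAlgebra 𝓐] [Finite π.ker] (hW : W ∈ 𝓐 a)

/-- Induction commutes with the functors to the absolute derived categories. -/
noncomputable def facLocIndIso : facLoc.{uk, uR, uB, max uk uA} (coarse π 𝓐) (π a) W ⋙ indD π hW ≅
    ind π hW ⋙ facLoc 𝓐 a W :=
  Functor.isoWhiskerLeft (HoFac.quot (coarse π 𝓐) (π a) W) (indDIso hW)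

variable (π) in
/-- Restriction is left adjoint to induction. -/
noncomputable def resAdj : res.{uk, uR, uA, uB, max uk uA} 𝓐 a W π ⊣ indD π hW :=
  localizedAdjunction (hoAdj π hW) (acyclic 𝓐 a W).trW (acyclic (coarse π 𝓐) (π a) W).trW
    ((coarsen 𝓐 a π).dabsIso W) (indDIso hW)

lemma resAdj_unit (E : Fac.{uk, uR, uA, max uk uA} 𝓐 a W) :
    (resAdj π hW).unit.app ((facLoc 𝓐 a W).obj E) ≫ (indD π hW).map (facLocResIso.hom.app E) ≫
      (facLocIndIso hW).hom.app (((coarsen 𝓐 a π).fac W).obj E) =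
        (facLoc 𝓐 a W).map (unitApp π hW E) :=
  localizedAdjunction_unit (hoAdj π hW) (acyclic 𝓐 a W).trW (acyclic (coarse π 𝓐) (π a) W).trW
    ((coarsen 𝓐 a π).dabsIso W) (indDIso hW) ((HoFac.quot 𝓐 a W).obj E)

-- The retraction exists before localization: the counit is split by the inverse of the order of the
-- kernel times the diagonal.
include hW in
lemma exists_retract_res (hπ : Function.Surjective π) (hk : IsUnit (Nat.card π.ker : k))
    (Y : DAbs.{uk, uR, uB, max uk uA} (coarse π 𝓐) (π a) W) :
    ∃ X, Nonempty (Retract Y ((res 𝓐 a W π).obj X)) := by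
  obtain ⟨u, hu⟩ := hk
  refine nonempty_retract_of_iso facLocResIso (fun F => ⟨(ind π hW).obj F, ⟨?_⟩⟩)
    facLoc_obj_surjective Y
  exact
    { i := (↑u⁻¹ : k) • Fac.diag π hW F
      r := counitApp π hW F
      retract := by
        rw [Linear.smul_comp, diag_counitApp hW hπ, smul_smul, ← hu, Units.inv_mul, one_smul] }

variable {Γ : AddSubgroup A} (hΓ : ∀ c, π c = 0 ↔ c ∈ Γ)

variable (W) in
/-- Restriction is invariant under twists by elements of the kernel. -/
noncomputable def resInvariant : Invariant Γ (res.{uk, uR, uA, uB, max uk uA} 𝓐 a W π) :=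
  (regradeInvariant W (coarsen 𝓐 a π) (twist_trans_coarsen hΓ)).descend facLocResIso

-- The biproduct decomposition of ind (res E) into twists, transported to the derived category and
-- combined with the adjunction.
include hW in
lemma resInvariant_orbitHom_bijective [Fintype Γ] (X Y : DAbs.{uk, uR, uA, max uk uA} 𝓐 a W) :
    Function.Bijective ((resInvariant W hΓ).orbitHom X Y) :=
  (regradeInvariant W (coarsen 𝓐 a π) (twist_trans_coarsen hΓ)).orbitHom_descend_bijective
    (resAdj π hW) facLocResIso (facLocIndIso hW) (η := unitApp π hW) (resAdj_unit hW)
    (isOrbitSum_coarsen hΓ hW) facLoc_obj_surjective X Y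

end Cover

/-! ### Assembly of the cover -/

section MainCover

variable {k : Type uk} [CommRing k] {R : Type uR} [CommRing R] [Algebra k R]
  {A : Type uA} [AddCommGroup A] {B : Type uB} [AddCommGroup B]
  {𝓐 : A → Submodule k R} {π : A →+ B} {a : A} {W : R}
  [DecidableEq A] [GradedAlgebra 𝓐]

/-- Restriction of gradings along a surjection with finite kernel `Γ` is a `Γ`-cover if the order
of `Γ` is invertible. -/
theorem isCover_res [Finite π.ker] (hW : W ∈ 𝓐 a) {Γ : AddSubgroup A} [Finite Γ]
    (hΓ : ∀ c, π c = 0 ↔ c ∈ Γ) (hπ : Function.Surjective π) (hk : IsUnit (Nat.card π.ker : k)) :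
    IsCover Γ k (res.{uk, uR, uA, uB, max uk uA} 𝓐 a W π) where
  fg := inferInstance
  exact_action := exists_isTriangulated_shiftFunctor
  orbit := by
    have := Fintype.ofFinite Γ
    exact ⟨(resInvariant W hΓ).orbitFunctor,
      ⟨fun f => (resInvariant_orbitHom_bijective hW hΓ _ _).2 f⟩,
      ⟨fun h => (resInvariant_orbitHom_bijective hW hΓ _ _).1 h⟩,
      inferInstance, (resInvariant W hΓ).orbitFunctor_linear k, ⟨(resInvariant W hΓ).toOrbitIso⟩⟩
  exact := (coarsen 𝓐 a π).exists_isTriangulated_dabs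
  dense := exists_retract_res hW hπ hk

end MainCover

end GradedFact

/-- The quotient map is surjective with kernel Γ, whose order is a nonzero natural number and so a
unit in characteristic 0. The modules live in the universe `max uk uA` because induced modules
consist of families indexed by A. -/
theorem mainTheorem12 {k : Type uk} [Field k] [IsAlgClosed k] [CharZero k] {A : Type uA}
    [AddCommGroup A] [AddGroup.FG A] [DecidableEq A] (n : ℕ)
    (𝓐 : A → Submodule k (MvPolynomial (Fin n) k)) [GradedAlgebra 𝓐]
    (a : A) (w : MvPolynomial (Fin n) k) (hw : w ∈ 𝓐 a) (Γ : AddSubgroup A) [Finite Γ] :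
    GradedFact.IsCover Γ k
      (GradedFact.res.{uk, uk, uA, uA, max uk uA} 𝓐 a w (QuotientAddGroup.mk' Γ)) := by
  have : Finite (QuotientAddGroup.mk' Γ).ker := by
    rw [QuotientAddGroup.ker_mk']
    infer_instance
  exact GradedFact.isCover_res hw (QuotientAddGroup.eq_zero_iff (N := Γ))
    (QuotientAddGroup.mk'_surjective Γ)
    (isUnit_iff_ne_zero.2 (Nat.cast_ne_zero.2 Nat.card_pos.ne'))
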